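/- Let $X=\{0,1,2,3\}^{\mathbb N}$ with the product topology, points $\xi=(\xi_k)_{k\ge1}$, and the one-sided shift $f(\xi)_k=\xi_{k+1}$. For a continuous $\Phi:X\to\mathbb R^2$ let $\mathrm{rv}_\Phi(\mu)=\int\Phi\,d\mu$ be the rotation vector of an $f$-invariant Borel probability measure $\mu$, let $\mathrm{Rot}(\Phi)$ be the set of all rotation vectors, let $\mathcal H_\Phi(w)=\sup\{h_\mu(f):\mathrm{rv}_\Phi(\mu)=w\}$ for $w\in\mathrm{Rot}(\Phi)$, where $h_\mu(f)$ is the measure-theoretic entropy, and let $h^u_\Phi(w_0,r)$ and $h^l_\Phi(w_0,r)$ be the supremum and the infimum of $\mathcal H_\Phi$ on $\overline B(w_0,r)\cap\mathrm{Rot}(\Phi)$ (Euclidean norm), with the values $+\infty$ and $-\infty$ if this set is empty. Parameters: a real $a>0$; a continuous, non-negative, increasing, strictly concave $\ell_1:[0,a]\to\mathbb R$ with $\ell_1(0)=0$, and $\ell_2=-\ell_1$; a strictly decreasing sequence $(x_k)_{k\ge1}$ in $(0,a)$ that tends to $0$ exponentially fast; and an integer $\lambda\ge3$. Let $S_1=\{0,1\}$,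 $S_2=\{2,3\}$, let $\mathcal C_k(x)$ and $\mathcal C_k(y)$ be the cylinders of length $k$ of $x=111\ldots$ and $y=333\ldots$, and for $i=1,2$ put $\widetilde Y_i(k)=\{\xi:\xi_1,\dots,\xi_k\in S_i\}$, $Y_i(k)=\widetilde Y_i(k-1)\setminus\widetilde Y_i(k)$, $Y_i(\infty)=\bigcap_k\widetilde Y_i(k)$, $X(k)=(Y_1(k)\setminus\mathcal C_{k-1}(x))\cup(Y_2(k)\setminus\mathcal C_{k-1}(y))$. Define $$\Phi(\xi)=\begin{cases}(a,0)&\xi\notin\widetilde Y_1(\lambda)\cup\widetilde Y_2(\lambda),\\(x_{k-\lambda},0)&\xi\in X(k),\ k>\lambda,\\(x_{k-\lambda},\ell_1(x_{k-\lambda}))&\xi\in\mathcal C_{k-1}(x)\cap Y_1(k),\ k>\lambda,\\(x_{k-\lambda},\ell_2(x_{k-\lambda}))&\xi\in\mathcal C_{k-1}(y)\cap Y_2(k),\ k>\lambda,\\(0,0)&\xi\in Y_1(\infty)\cup Y_2(\infty).\end{cases}$$ Let $\epsilon_n=2^{-n}$, and let $K=K(n)\ge2\lambda$ be integers such that, with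 $p_j=(x_j,\ell_1(x_j))$, $\|p_{k-\lambda}\|<\epsilon_n$ and $\|p_{k-\lambda}-p_{l-\lambda}\|<\epsilon_n$ for all $k,l\ge K(n)$. Let $\Phi_{\epsilon_n}$ be equal to $(x_{K+1-\lambda},\ell_1(x_{K+1-\lambda}))$ on $\mathcal C_K(x)$, to $(x_{K+1-\lambda},\ell_2(x_{K+1-\lambda}))$ on $\mathcal C_K(y)$, to $(x_{K+1-\lambda},0)$ on the rest of $\widetilde Y_1(K)\cup\widetilde Y_2(K)$, and to $\Phi$ elsewhere. Write $w_\infty=(0,0)$. (1) For all parameters: $\Phi$ is continuous; $w_\infty$ is an exposed point of $\mathrm{Rot}(\Phi)$ and lies on its boundary; $\mathcal H_\Phi(w_\infty)=\log2$; the function $(\Psi,w)\mapsto\mathcal H_\Psi(w)$ on $\{(\Psi,w):\Psi\in C(X,\mathbb R^2),\ w\in\mathrm{Rot}(\Psi)\}$ is not continuous at $(\Phi,w_\infty)$; admissible $K(n)$ exist; and for every admissible choice of them the $\Phi_{\epsilon_n}$ are continuous and locally constant (constant on cylinders of length $K(n)$), $\|\Phi_{\epsilon_n}-\Phi\|_\infty<2^{-n}$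 for all $n$, and $$\lim_{n\to\infty}h^l_{\Phi_{\epsilon_n}}(w_\infty,\epsilon_n)=0<\lim_{n\to\infty}h^u_{\Phi_{\epsilon_n}}(w_\infty,\epsilon_n)=\mathcal H_\Phi(w_\infty)=\log2 .$$ (2) The parameters can be chosen such that, moreover, $\partial\mathrm{Rot}(\Phi)$ is an infinite polygon whose vertices accumulate only at $w_\infty$ and $w_\infty$ is a smooth boundary point of $\mathrm{Rot}(\Phi)$ (it has exactly one supporting line there). Here an infinite polygon means: there are pairwise distinct points $v_n\ne w_\infty$, $n\in\mathbb Z$, with $v_n\to w_\infty$ as $n\to\pm\infty$, such that the extreme points of $\mathrm{Rot}(\Phi)$ are $w_\infty$ and the $v_n$, and $\partial\mathrm{Rot}(\Phi)=\{w_\infty\}\cup\bigcup_{n\in\mathbb Z}[v_n,v_{n+1}]$. -/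

import Mathlib

namespace LocEnt

open MeasureTheory Filter Topology Set

/-! ### Measure-theoretic entropy -/

section Entropy

/-- Shannon entropy `-∑ μ(P = i) log μ(P = i)` of the finite partition into the fibres of `P`. -/
noncomputable def partitionEntropy {X ι : Type*} [MeasurableSpace X] [Fintype ι]
    (μ : Measure X) (P : X → ι) : ℝ :=
  ∑ i, Real.negMulLog (μ.real (P ⁻¹' {i}))

/-- The join of the partitions `P, f⁻¹ P, …, f⁻⁽ⁿ⁻¹⁾ P`, given by its labelling function. -/
def joinPartition {X ι : Type*} (f : X → X) (P : X → ι) (n : ℕ) : X → (Fin n → ι) :=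
  fun x j => P (f^[j] x)

/-- The entropy `h_μ(f, P) = lim (1/n) H_μ(P ∨ f⁻¹ P ∨ … ∨ f⁻⁽ⁿ⁻¹⁾ P)` of `f` relative to `P`.
For invariant `μ` the limit exists by subadditivity, so that it is the upper limit. -/
noncomputable def entropyRate {X ι : Type*} [MeasurableSpace X] [Fintype ι]
    (f : X → X) (μ : Measure X) (P : X → ι) : EReal :=
  limsup (fun n : ℕ => ((partitionEntropy μ (joinPartition f P n) / (n : ℝ) : ℝ) : EReal)) atTop

/-- The measure-theoretic (Kolmogorov-Sinai) entropy `h_μ(f)`: the supremum of `h_μ(f, P)` over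
all finite measurable partitions `P`. -/
noncomputable def entropy {X : Type*} [MeasurableSpace X] (f : X → X) (μ : Measure X) : EReal :=
  ⨆ (k : ℕ) (P : X → Fin k) (_ : Measurable P), entropyRate f μ P

end Entropy

/-! ### Rotation sets and localized entropy -/

section Rotation

/-- The `f`-invariant probability measures. -/
def invariantMeasures {X : Type*} [MeasurableSpace X] (f : X → X) : Set (ProbabilityMeasure X) :=
  {μ | MeasurePreserving f (μ : Measure X) (μ : Measure X)}

/-- The rotation vector of `μ`: the vector of the integrals of the coordinates of `Φ`. -/
noncomputable def rotationVector {X : Type*} [MeasurableSpace X] {m : ℕ}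
    (Φ : X → EuclideanSpace ℝ (Fin m)) (μ : ProbabilityMeasure X) : EuclideanSpace ℝ (Fin m) :=
  WithLp.toLp 2 (fun i => ∫ ξ, Φ ξ i ∂(μ : Measure X))

/-- The rotation set `Rot(Φ)`. -/
def rotationSet {X : Type*} [MeasurableSpace X] {m : ℕ} (f : X → X)
    (Φ : X → EuclideanSpace ℝ (Fin m)) : Set (EuclideanSpace ℝ (Fin m)) :=
  rotationVector Φ '' invariantMeasures f

/-- The rotation class of `w`: the invariant probability measures with rotation vector `w`. -/
def rotationClass {X : Type*} [MeasurableSpace X] {m : ℕ} (f : X → X)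
    (Φ : X → EuclideanSpace ℝ (Fin m)) (w : EuclideanSpace ℝ (Fin m)) :
    Set (ProbabilityMeasure X) :=
  {μ | μ ∈ invariantMeasures f ∧ rotationVector Φ μ = w}

/-- The localized entropy `H_Φ(w)`, for `w ∈ Rot(Φ)`. -/
noncomputable def localizedEntropy {X : Type*} [MeasurableSpace X] {m : ℕ} (f : X → X)
    (Φ : X → EuclideanSpace ℝ (Fin m)) (w : EuclideanSpace ℝ (Fin m)) : EReal :=
  ⨆ μ ∈ rotationClass f Φ w, entropy f (μ : Measure X)

open scoped Classical in
/-- The maximum local entropy `h^u_Φ(w₀, r)` (equal to `+∞` if the ball misses `Rot(Φ)`). -/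
noncomputable def maxLocalEntropy {X : Type*} [MeasurableSpace X] {m : ℕ} (f : X → X)
    (Φ : X → EuclideanSpace ℝ (Fin m)) (w₀ : EuclideanSpace ℝ (Fin m)) (r : ℝ) : EReal :=
  if (Metric.closedBall w₀ r ∩ rotationSet f Φ).Nonempty then
    ⨆ w ∈ Metric.closedBall w₀ r ∩ rotationSet f Φ, localizedEntropy f Φ w
  else ⊤

open scoped Classical in
/-- The minimum local entropy `h^l_Φ(w₀, r)` (equal to `-∞` if the ball misses `Rot(Φ)`). -/
noncomputable def minLocalEntropy {X : Type*} [MeasurableSpace X] {m : ℕ} (f : X → X)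
    (Φ : X → EuclideanSpace ℝ (Fin m)) (w₀ : EuclideanSpace ℝ (Fin m)) (r : ℝ) : EReal :=
  if (Metric.closedBall w₀ r ∩ rotationSet f Φ).Nonempty then
    ⨅ w ∈ Metric.closedBall w₀ r ∩ rotationSet f Φ, localizedEntropy f Φ w
  else ⊥

end Rotation

/-! ### Planar convex geometry -/

section Geometry

/-- The boundary of the (compact convex) set `K` is an infinite polygon whose vertices accumulate
exactly at `w`: going round the boundary, the vertices other than `w` are listed by an injective
family `v n`, `n ∈ ℤ`, tending to `w` as `n → ±∞`; the sides are the segments `[v n, v (n+1)]`, and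
every `v n` is a genuine vertex, that is, an extreme point of `K`. -/
def BoundaryIsInfinitePolygon (K : Set (EuclideanSpace ℝ (Fin 2)))
    (w : EuclideanSpace ℝ (Fin 2)) : Prop :=
  ∃ v : ℤ → EuclideanSpace ℝ (Fin 2),
    Function.Injective v ∧ w ∉ range v ∧ Tendsto v cofinite (𝓝 w) ∧
    K.extremePoints ℝ = insert w (range v) ∧
    frontier K = insert w (⋃ n : ℤ, segment ℝ (v n) (v (n + 1)))

/-- `w` is a smooth boundary point of the convex set `K`: there is exactly one supporting line of
`K` at `w`, that is, exactly one outer unit normal vector. -/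
def IsSmoothBoundaryPoint (K : Set (EuclideanSpace ℝ (Fin 2)))
    (w : EuclideanSpace ℝ (Fin 2)) : Prop :=
  w ∈ K ∧ w ∈ frontier K ∧
    ∃! u : EuclideanSpace ℝ (Fin 2), ‖u‖ = 1 ∧ ∀ y ∈ K, inner ℝ u y ≤ inner ℝ u w

end Geometry

/-! ### The full shift on four symbols and the potentials -/

section Example

/-- The one-sided shift space on the symbols `0, 1, 2, 3`, with the product topology. The
coordinate written `ξ_k` (`k ≥ 1`) on paper is `ξ (k - 1)` here. -/
abbrev FourShift : Type := ℕ → Fin 4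

/-- The shift map. -/
def shift (ξ : FourShift) : FourShift := fun k => ξ (k + 1)

/-- The cylinder of length `k` generated by `η`. -/
def cyl (k : ℕ) (η : FourShift) : Set FourShift := {ξ | ∀ j < k, ξ j = η j}

/-- The fixed point `111…`. -/
def ptOne : FourShift := fun _ => 1

/-- The fixed point `333…`. -/
def ptThree : FourShift := fun _ => 3

/-- The symbol set `S₁ = {0, 1}`. -/
def symOne : Set (Fin 4) := {0, 1}

/-- The symbol set `S₂ = {2, 3}`. -/
def symTwo : Set (Fin 4) := {2, 3}

/-- `Ỹ(k)` for the symbol set `S`: the first `k` symbols lie in `S`. -/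
def Ytilde (S : Set (Fin 4)) (k : ℕ) : Set FourShift := {ξ | ∀ j < k, ξ j ∈ S}

/-- `Y(k) = Ỹ(k-1) \ Ỹ(k)` for the symbol set `S`: the first `k - 1` symbols lie in `S` and the
`k`-th one does not. -/
def Yexit (S : Set (Fin 4)) (k : ℕ) : Set FourShift := Ytilde S (k - 1) \ Ytilde S k

/-- `X(k)`. -/
def Xset (k : ℕ) : Set FourShift :=
  (Yexit symOne k \ cyl (k - 1) ptOne) ∪ (Yexit symTwo k \ cyl (k - 1) ptThree)

/-- The parameters of the construction. -/
structure Params where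
  /-- the right end point of the domain of `ℓ₁` -/
  a : ℝ
  /-- the function `ℓ₁` (used on `[0, a]` only); `ℓ₂ = -ℓ₁` -/
  ell : ℝ → ℝ
  /-- the sequence `x_1, x_2, …` (the value at the index `0` is not used) -/
  x : ℕ → ℝ
  /-- the natural number `λ` -/
  lam : ℕ
  a_pos : 0 < a
  ell_cont : ContinuousOn ell (Icc 0 a)
  ell_nonneg : ∀ t ∈ Icc 0 a, 0 ≤ ell t
  ell_mono : MonotoneOn ell (Icc 0 a)
  ell_concave : StrictConcaveOn ℝ (Icc 0 a) ell
  ell_zero : ell 0 = 0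
  x_mem : ∀ k, 1 ≤ k → x k ∈ Ioo 0 a
  x_anti : StrictAntiOn x (Ici 1)
  x_exp : ∃ C r : ℝ, 0 < r ∧ r < 1 ∧ ∀ k, 1 ≤ k → x k ≤ C * r ^ k
  lam_ge : 3 ≤ lam

open scoped Classical in
/-- The potential `Φ`. For given `ξ` there is at most one `k` as in each of the cases, so that
`Nat.find` picks that `k`. -/
noncomputable def Params.potential (D : Params) (ξ : FourShift) : EuclideanSpace ℝ (Fin 2) :=
  if ξ ∉ Ytilde symOne D.lam ∪ Ytilde symTwo D.lam then !₂[D.a, 0]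
  else if h : ∃ k, D.lam < k ∧ ξ ∈ Xset k then
    !₂[D.x (Nat.find h - D.lam), 0]
  else if h : ∃ k, D.lam < k ∧ ξ ∈ cyl (k - 1) ptOne ∩ Yexit symOne k then
    !₂[D.x (Nat.find h - D.lam), D.ell (D.x (Nat.find h - D.lam))]
  else if h : ∃ k, D.lam < k ∧ ξ ∈ cyl (k - 1) ptThree ∩ Yexit symTwo k then
    !₂[D.x (Nat.find h - D.lam), -D.ell (D.x (Nat.find h - D.lam))]
  else 0

/-- The admissible choices of the cut-offs `K(n)`, where `ε_n = 2⁻ⁿ`. -/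
def Params.IsCutoff (D : Params) (K : ℕ → ℕ) : Prop :=
  ∀ n, 2 * D.lam ≤ K n ∧
    (∀ k, K n ≤ k →
      ‖(!₂[D.x (k - D.lam), D.ell (D.x (k - D.lam))] : EuclideanSpace ℝ (Fin 2))‖
        < (1 / 2 : ℝ) ^ n) ∧
    ∀ k l, K n ≤ k → K n ≤ l →
      ‖(!₂[D.x (k - D.lam), D.ell (D.x (k - D.lam))] : EuclideanSpace ℝ (Fin 2))
        - !₂[D.x (l - D.lam), D.ell (D.x (l - D.lam))]‖ < (1 / 2 : ℝ) ^ n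

open scoped Classical in
/-- The approximating potential with cut-off `K`. The points treated in the last case are those
of `Y₀(λ)` and those that leave `S₁` or `S₂` at a time `k` with `λ < k ≤ K`. -/
noncomputable def Params.approx (D : Params) (K : ℕ) (ξ : FourShift) :
    EuclideanSpace ℝ (Fin 2) :=
  if ξ ∈ cyl K ptOne then !₂[D.x (K + 1 - D.lam), D.ell (D.x (K + 1 - D.lam))]
  else if ξ ∈ cyl K ptThree then !₂[D.x (K + 1 - D.lam), -D.ell (D.x (K + 1 - D.lam))]
  else if ξ ∈ Ytilde symOne K ∪ Ytilde symTwo K then !₂[D.x (K + 1 - D.lam), 0]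
  else D.potential ξ

end Example

end LocEnt

namespace LocEnt

open MeasureTheory Filter Topology Set

/-! ### Values of the potentials -/

/-! Entropy near the origin. A point whose first two symbols lie in different sets `S₁`, `S₂` is in
neither `Ỹ₁(λ)` nor `Ỹ₂(λ)`, so `Φ` has first coordinate `a` there. Since first coordinates are
non-negative, an invariant measure with rotation vector `w` switches symbol sets with frequency `t ≤
w₀ / a` (`measureReal_switches_le`). Once the initial symbol set and all switches are known, one bit
per symbol remains, so the entropy is at most `log 2` plus the binary entropy of `t`
(`entropy_le_log_two_add`). This tends to `log 2` as `w` tends to `0`, and the Bernoulli measure on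
`{0, 1}^ℕ` supplies the matching lower bound.

Zero entropy arbitrarily close by. For the truncation with cut-off `K`, the least first coordinate
is `x_{K+1-λ}`, taken only on `Ỹ₁(K) ∪ Ỹ₂(K)`; on that set the second coordinate has maximum
`ℓ₁(x_{K+1-λ})`, taken only on the cylinder `1⋯1`. A measure with rotation vector `p_{K+1-λ}`
therefore lives on this cylinder, and by invariance it is the Dirac measure at `111…`
(`eq_dirac_of_rotationVector_approx`). As `p_{K+1-λ}` is within `ε_n` of `0`, the minimal local
entropy vanishes and joint continuity fails.

Shape of the rotation set. The periodic word `1⋯12` of period `λ + N` averages to `V_N = (λ(a,0) +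
p_1 + ⋯ + p_N) / (λ + N)`. When the polygon is a convex chain, `Rot(Φ)` is the convex hull of `0`,
the `V_N` and their mirror images (`rotationSet_eq_convexHull`). One inclusion is convexity. For the
other, a functional with non-negative second coefficient that is at most `M` on the `V_N`, evaluated
along `Φ` and reduced by `M`, is dominated by a coboundary `u - u ∘ shift`, with `u` the total gain
until `S₁` is left (`potential_sub_le_transfer`); integration gives the bound, and exchanging the
symbol sets handles the other sign.

Strict concavity of `ℓ₁` puts the `V_N` in strictly convex position, because positivity of
determinants passes to partial sums (`det3_partialSums_pos`). The slope of `V_N` is `∑ ℓ₁(x_k) / (λa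
+ ∑ x_k)`, whose denominator stays bounded, so divergence of `∑ ℓ₁(x_k)` forces a vertical tangent
at `0`. With `ℓ₁ = -1/log` and `x_k = e^{-(k+3)}` that sum is a tail of the harmonic series. -/

lemma mem_symOne {s : Fin 4} : s ∈ symOne ↔ s = 0 ∨ s = 1 := by simp [symOne]

lemma mem_symTwo {s : Fin 4} : s ∈ symTwo ↔ s = 2 ∨ s = 3 := by simp [symTwo]

lemma mem_symTwo_iff_notMem_symOne (s : Fin 4) : s ∈ symTwo ↔ s ∉ symOne := by
  rw [mem_symTwo, mem_symOne]; revert s; decide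

lemma mem_Yexit_succ {S : Set (Fin 4)} {m : ℕ} {ξ : FourShift} :
    ξ ∈ Yexit S (m + 1) ↔ (∀ j < m, ξ j ∈ S) ∧ ξ m ∉ S := by
  simp only [Yexit, Ytilde, Nat.add_sub_cancel, Set.mem_sdiff, mem_ofPred_eq]
  constructor
  · rintro ⟨h, h'⟩
    refine ⟨h, fun hm => h' fun j hj => ?_⟩
    rcases Nat.lt_succ_iff_lt_or_eq.1 hj with hj | rfl
    · exact h j hj
    · exact hm
  · exact fun ⟨h, h'⟩ => ⟨h, fun hm => h' (hm m m.lt_succ_self)⟩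

lemma eq_of_exits {S : Set (Fin 4)} {m k : ℕ} {ξ : FourShift}
    (h : (∀ j < m, ξ j ∈ S) ∧ ξ m ∉ S) (h' : (∀ j < k, ξ j ∈ S) ∧ ξ k ∉ S) : m = k := by
  rcases lt_trichotomy m k with hlt | rfl | hlt
  · exact absurd (h'.1 m hlt) h.2
  · rfl
  · exact absurd (h.1 k hlt) h'.2

lemma Ytilde_or_exits (S : Set (Fin 4)) (l : ℕ) {ξ : FourShift} (h : ∀ j < l, ξ j ∈ S) :
    (∀ j, ξ j ∈ S) ∨ ∃ m, l ≤ m ∧ (∀ j < m, ξ j ∈ S) ∧ ξ m ∉ S := by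
  classical
  by_cases hall : ∀ j, ξ j ∈ S
  · exact Or.inl hall
  · push Not at hall
    refine Or.inr ⟨Nat.find hall, ?_, fun j hj => ?_, Nat.find_spec hall⟩
    · by_contra hlt
      exact Nat.find_spec hall (h _ (not_le.1 hlt))
    · by_contra hj'
      exact Nat.find_min hall hj hj'

namespace Params

variable (D : Params)

lemma lam_pos : 0 < D.lam := by have := D.lam_ge; omega

lemma potential_out {ξ : FourShift} (h1 : ¬ ∀ j < D.lam, ξ j ∈ symOne)
    (h2 : ¬ ∀ j < D.lam, ξ j ∈ symTwo) : D.potential ξ = !₂[D.a, 0] := by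
  unfold potential
  rw [if_pos]
  rintro (h | h)
  · exact h1 h
  · exact h2 h

-- Here `m` is the zero-based position of the first symbol outside `S₁`, so the index `k` of the
-- definition is `m + 1`. Exit times are unique, which forces `Nat.find` to return `m + 1` in
-- whichever case applies.
open scoped Classical in
lemma potential_exit_one {ξ : FourShift} {m : ℕ} (hm : D.lam ≤ m)
    (h : (∀ j < m, ξ j ∈ symOne) ∧ ξ m ∉ symOne) :
    D.potential ξ = !₂[D.x (m + 1 - D.lam),
      if ∀ j < m, ξ j = 1 then D.ell (D.x (m + 1 - D.lam)) else 0] := by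
  have hl := D.lam_pos
  have h0 : ξ 0 ∉ symTwo := by
    rw [mem_symTwo_iff_notMem_symOne, not_not]; exact h.1 0 (by omega)
  have no2 : ∀ k, D.lam < k → ξ ∉ Yexit symTwo k := by
    rintro (_ | k) hk hk'
    · omega
    · exact h0 ((mem_Yexit_succ.1 hk').1 0 (by omega))
  have uniq : ∀ k, D.lam < k → ξ ∈ Yexit symOne k → k = m + 1 := by
    rintro (_ | k) hk hk'
    · omega
    · rw [eq_of_exits (mem_Yexit_succ.1 hk') h]
  unfold potential
  have hY : ξ ∈ Ytilde symOne D.lam ∪ Ytilde symTwo D.lam :=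
    Or.inl fun j hj => h.1 j (by omega)
  rw [if_neg (not_not.2 hY)]
  by_cases hone : ∀ j < m, ξ j = 1
  · have nX : ¬ ∃ k, D.lam < k ∧ ξ ∈ Xset k := by
      rintro ⟨k, hk, hX | hX⟩
      · obtain rfl := uniq k hk hX.1
        exact hX.2 hone
      · exact no2 k hk hX.1
    have yes : ∃ k, D.lam < k ∧ ξ ∈ cyl (k - 1) ptOne ∩ Yexit symOne k :=
      ⟨m + 1, by omega, hone, mem_Yexit_succ.2 h⟩
    have hf := Nat.find_spec yes
    rw [dif_neg nX, dif_pos yes, uniq _ hf.1 hf.2.2, if_pos hone]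
  · have yes : ∃ k, D.lam < k ∧ ξ ∈ Xset k :=
      ⟨m + 1, by omega, Or.inl ⟨mem_Yexit_succ.2 h, hone⟩⟩
    have hf := Nat.find_spec yes
    have hk : Nat.find yes = m + 1 := by
      rcases hf.2 with hX | hX
      · exact uniq _ hf.1 hX.1
      · exact absurd hX.1 (no2 _ hf.1)
    rw [dif_pos yes, hk, if_neg hone]

open scoped Classical in
lemma potential_exit_two {ξ : FourShift} {m : ℕ} (hm : D.lam ≤ m)
    (h : (∀ j < m, ξ j ∈ symTwo) ∧ ξ m ∉ symTwo) :
    D.potential ξ = !₂[D.x (m + 1 - D.lam),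
      if ∀ j < m, ξ j = 3 then -D.ell (D.x (m + 1 - D.lam)) else 0] := by
  have hl := D.lam_pos
  have h0 : ξ 0 ∉ symOne := by
    rw [← mem_symTwo_iff_notMem_symOne]; exact h.1 0 (by omega)
  have no1 : ∀ k, D.lam < k → ξ ∉ Yexit symOne k := by
    rintro (_ | k) hk hk'
    · omega
    · exact h0 ((mem_Yexit_succ.1 hk').1 0 (by omega))
  have uniq : ∀ k, D.lam < k → ξ ∈ Yexit symTwo k → k = m + 1 := by
    rintro (_ | k) hk hk'
    · omega
    · rw [eq_of_exits (mem_Yexit_succ.1 hk') h]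
  have n1 : ¬ ∃ k, D.lam < k ∧ ξ ∈ cyl (k - 1) ptOne ∩ Yexit symOne k :=
    fun ⟨k, hk, h'⟩ => no1 k hk h'.2
  unfold potential
  have hY : ξ ∈ Ytilde symOne D.lam ∪ Ytilde symTwo D.lam :=
    Or.inr fun j hj => h.1 j (by omega)
  rw [if_neg (not_not.2 hY)]
  by_cases hone : ∀ j < m, ξ j = 3
  · have nX : ¬ ∃ k, D.lam < k ∧ ξ ∈ Xset k := by
      rintro ⟨k, hk, hX | hX⟩
      · exact no1 k hk hX.1
      · obtain rfl := uniq k hk hX.1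
        exact hX.2 hone
    have yes : ∃ k, D.lam < k ∧ ξ ∈ cyl (k - 1) ptThree ∩ Yexit symTwo k :=
      ⟨m + 1, by omega, hone, mem_Yexit_succ.2 h⟩
    have hf := Nat.find_spec yes
    rw [dif_neg nX, dif_neg n1, dif_pos yes, uniq _ hf.1 hf.2.2, if_pos hone]
  · have yes : ∃ k, D.lam < k ∧ ξ ∈ Xset k :=
      ⟨m + 1, by omega, Or.inr ⟨mem_Yexit_succ.2 h, hone⟩⟩
    have hf := Nat.find_spec yes
    have hk : Nat.find yes = m + 1 := by
      rcases hf.2 with hX | hX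
      · exact absurd hX.1 (no1 _ hf.1)
      · exact uniq _ hf.1 hX.1
    rw [dif_pos yes, hk, if_neg hone]

lemma potential_never {ξ : FourShift} (h : (∀ j, ξ j ∈ symOne) ∨ ∀ j, ξ j ∈ symTwo) :
    D.potential ξ = 0 := by
  have no1 : ∀ k, D.lam < k → ξ ∉ Yexit symOne k := by
    rintro (_ | k) hk hk'
    · omega
    · have hk' := mem_Yexit_succ.1 hk'
      rcases h with h | h
      · exact hk'.2 (h k)
      · have := D.lam_pos
        exact (mem_symTwo_iff_notMem_symOne _).1 (h 0) (hk'.1 0 (by omega))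
  have no2 : ∀ k, D.lam < k → ξ ∉ Yexit symTwo k := by
    rintro (_ | k) hk hk'
    · omega
    · have hk' := mem_Yexit_succ.1 hk'
      rcases h with h | h
      · have := D.lam_pos
        exact (mem_symTwo_iff_notMem_symOne _).1 (hk'.1 0 (by omega)) (h 0)
      · exact hk'.2 (h k)
  unfold potential
  rw [if_neg, dif_neg, dif_neg, dif_neg]
  · exact fun ⟨k, hk, h'⟩ => no2 k hk h'.2
  · exact fun ⟨k, hk, h'⟩ => no1 k hk h'.2
  · rintro ⟨k, hk, h' | h'⟩
    · exact no1 k hk h'.1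
    · exact no2 k hk h'.1
  · rw [not_not]
    exact h.imp (fun h j _ => h j) (fun h j _ => h j)

/-- These are exactly the cases in which the value of `Φ` is known explicitly; later computations of
`Φ` split along them. -/
lemma trichotomy (ξ : FourShift) :
    ((¬ ∀ j < D.lam, ξ j ∈ symOne) ∧ ¬ ∀ j < D.lam, ξ j ∈ symTwo) ∨
    ((∀ j, ξ j ∈ symOne) ∨ ∀ j, ξ j ∈ symTwo) ∨
    (∃ m, D.lam ≤ m ∧ (∀ j < m, ξ j ∈ symOne) ∧ ξ m ∉ symOne) ∨
    ∃ m, D.lam ≤ m ∧ (∀ j < m, ξ j ∈ symTwo) ∧ ξ m ∉ symTwo := by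
  by_cases h1 : ∀ j < D.lam, ξ j ∈ symOne
  · rcases Ytilde_or_exits _ _ h1 with h | h
    · exact Or.inr (Or.inl (Or.inl h))
    · exact Or.inr (Or.inr (Or.inl h))
  by_cases h2 : ∀ j < D.lam, ξ j ∈ symTwo
  · rcases Ytilde_or_exits _ _ h2 with h | h
    · exact Or.inr (Or.inl (Or.inr h))
    · exact Or.inr (Or.inr (Or.inr h))
  exact Or.inl ⟨h1, h2⟩

/-! ### The parameters -/

lemma x_pos {k : ℕ} (hk : 1 ≤ k) : 0 < D.x k := (D.x_mem k hk).1

lemma x_lt {k : ℕ} (hk : 1 ≤ k) : D.x k < D.a := (D.x_mem k hk).2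

lemma x_mem_Icc {k : ℕ} (hk : 1 ≤ k) : D.x k ∈ Icc 0 D.a := Ioo_subset_Icc_self (D.x_mem k hk)

lemma x_le {k l : ℕ} (hk : 1 ≤ k) (hl : k ≤ l) : D.x l ≤ D.x k :=
  D.x_anti.antitoneOn hk (hk.trans hl) hl

lemma ell_x_nonneg {k : ℕ} (hk : 1 ≤ k) : 0 ≤ D.ell (D.x k) := D.ell_nonneg _ (D.x_mem_Icc hk)

lemma ell_x_le {k l : ℕ} (hk : 1 ≤ k) (hl : k ≤ l) : D.ell (D.x l) ≤ D.ell (D.x k) :=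
  D.ell_mono (D.x_mem_Icc (hk.trans hl)) (D.x_mem_Icc hk) (D.x_le hk hl)

/-- Strict concavity on `[0, t]` gives `ℓ₁(t/2) > ℓ₁(t)/2`, while monotonicity gives `ℓ₁(t/2) ≤
ℓ₁(t)`. -/
lemma ell_pos {t : ℝ} (ht : t ∈ Ioc 0 D.a) : 0 < D.ell t := by
  have h0 : (0 : ℝ) ∈ Icc 0 D.a := ⟨le_rfl, D.a_pos.le⟩
  have ht' : t ∈ Icc 0 D.a := ⟨ht.1.le, ht.2⟩
  have h := D.ell_concave.2 h0 ht' ht.1.ne (by norm_num : (0 : ℝ) < 1 / 2)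
    (by norm_num : (0 : ℝ) < 1 / 2) (by norm_num)
  have h2 : D.ell ((1 / 2 : ℝ) • 0 + (1 / 2 : ℝ) • t) ≤ D.ell t := by
    apply D.ell_mono _ ht'
    · simp only [smul_eq_mul]; linarith [ht.1]
    · simp only [smul_eq_mul]; constructor <;> linarith [ht.1, ht.2]
  simp only [D.ell_zero, smul_eq_mul] at h h2
  linarith

lemma tendsto_x : Tendsto D.x atTop (𝓝 0) := by
  obtain ⟨C, r, hr0, hr1, h⟩ := D.x_exp
  have := (tendsto_pow_atTop_nhds_zero_of_lt_one hr0.le hr1).const_mul C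
  rw [mul_zero] at this
  refine squeeze_zero' ?_ ?_ this
  · filter_upwards [eventually_ge_atTop 1] with k hk using (D.x_pos hk).le
  · filter_upwards [eventually_ge_atTop 1] with k hk using h k hk

lemma tendsto_ell_x : Tendsto (fun k => D.ell (D.x k)) atTop (𝓝 0) := by
  have h0 : (0 : ℝ) ∈ Icc 0 D.a := ⟨le_rfl, D.a_pos.le⟩
  have h := D.ell_cont 0 h0
  rw [ContinuousWithinAt, D.ell_zero] at h
  refine h.comp (tendsto_nhdsWithin_iff.2 ⟨D.tendsto_x, ?_⟩)
  filter_upwards [eventually_ge_atTop 1] with k hk using D.x_mem_Icc hk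

/-- The point `p_k = (x_k, ℓ₁(x_k))`. -/
noncomputable def curvePoint (k : ℕ) : EuclideanSpace ℝ (Fin 2) := !₂[D.x k, D.ell (D.x k)]

lemma norm_curvePoint_eq (k : ℕ) :
    ‖D.curvePoint k‖ = √(D.x k ^ 2 + D.ell (D.x k) ^ 2) := by
  simp [curvePoint, EuclideanSpace.norm_eq]

lemma norm_le_norm_curvePoint {k : ℕ} {w : EuclideanSpace ℝ (Fin 2)} (h0 : |w 0| ≤ D.x k)
    (h1 : |w 1| ≤ D.ell (D.x k)) : ‖w‖ ≤ ‖D.curvePoint k‖ := by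
  rw [norm_curvePoint_eq, EuclideanSpace.norm_eq]
  apply Real.sqrt_le_sqrt
  simp only [Fin.sum_univ_two, Real.norm_eq_abs]
  gcongr

lemma tendsto_curvePoint : Tendsto D.curvePoint atTop (𝓝 0) := by
  have h : Tendsto (fun k => ‖D.curvePoint k‖) atTop (𝓝 0) := by
    simp only [norm_curvePoint_eq]
    have := ((D.tendsto_x.pow 2).add (D.tendsto_ell_x.pow 2)).sqrt
    simpa using this
  exact tendsto_zero_iff_norm_tendsto_zero.2 h

lemma exists_isCutoff : ∃ K : ℕ → ℕ, D.IsCutoff K := by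
  -- Half of `ε_n` for single norms leaves `ε_n` for differences of two points.
  have key : ∀ n : ℕ, ∃ N : ℕ, ∀ k ≥ N, ‖D.curvePoint k‖ < (1 / 2 : ℝ) ^ n / 2 := by
    intro n
    have h := (tendsto_zero_iff_norm_tendsto_zero.1 D.tendsto_curvePoint).eventually
      (gt_mem_nhds (show (0 : ℝ) < (1 / 2 : ℝ) ^ n / 2 by positivity))
    exact eventually_atTop.1 h
  choose N hN using key
  refine ⟨fun n => 2 * D.lam + N n, fun n => ?_⟩
  beta_reduce
  refine ⟨by omega, fun k hk => ?_, fun k l hk hl => ?_⟩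
  · have h := hN n (k - D.lam) (by omega)
    have : (0 : ℝ) < (1 / 2 : ℝ) ^ n := by positivity
    change ‖D.curvePoint _‖ < _
    linarith
  · have h := hN n (k - D.lam) (by omega)
    have h' := hN n (l - D.lam) (by omega)
    change ‖D.curvePoint _ - D.curvePoint _‖ < _
    linarith [norm_sub_le (D.curvePoint (k - D.lam)) (D.curvePoint (l - D.lam))]

/-! ### Continuity and bounds -/

lemma potential_zero_nonneg (ξ : FourShift) : 0 ≤ D.potential ξ 0 := by
  classical
  rcases D.trichotomy ξ with h | h | ⟨m, hm, h⟩ | ⟨m, hm, h⟩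
  · rw [D.potential_out h.1 h.2]; exact D.a_pos.le
  · rw [D.potential_never h]; simp
  · rw [D.potential_exit_one hm h]; exact (D.x_pos (by omega)).le
  · rw [D.potential_exit_two hm h]; exact (D.x_pos (by omega)).le

lemma never_of_potential_zero_eq {ξ : FourShift} (h0 : D.potential ξ 0 = 0) :
    (∀ j, ξ j ∈ symOne) ∨ ∀ j, ξ j ∈ symTwo := by
  classical
  rcases D.trichotomy ξ with h | h | ⟨m, hm, h⟩ | ⟨m, hm, h⟩
  · rw [D.potential_out h.1 h.2] at h0; exact absurd h0 D.a_pos.ne'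
  · exact h
  · rw [D.potential_exit_one hm h] at h0; exact absurd h0 (D.x_pos (by omega)).ne'
  · rw [D.potential_exit_two hm h] at h0; exact absurd h0 (D.x_pos (by omega)).ne'

/-- Both `x_k` and `ℓ₁(x_k)` decrease with the exit time, so the earliest possible exit, at position
`K`, bounds all later ones. A prefix other than `1⋯1` excludes every cylinder around `111…` used
later on. -/
lemma potential_tail_one {ξ : FourShift} {K : ℕ} (hK : D.lam ≤ K) (h : ∀ j < K, ξ j ∈ symOne) :
    D.potential ξ 0 ∈ Icc 0 (D.x (K + 1 - D.lam)) ∧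
      D.potential ξ 1 ∈ Icc 0 (D.ell (D.x (K + 1 - D.lam))) ∧
      (¬ (∀ j < K, ξ j = 1) → D.potential ξ 1 = 0) := by
  classical
  have hK' : 1 ≤ K + 1 - D.lam := by omega
  rcases Ytilde_or_exits _ _ h with h' | ⟨m, hm, h'⟩
  · rw [D.potential_never (Or.inl h')]
    simp [(D.x_pos hK').le, D.ell_x_nonneg hK']
  · have hle : K + 1 - D.lam ≤ m + 1 - D.lam := by omega
    rw [D.potential_exit_one (hK.trans hm) h']
    refine ⟨⟨(D.x_pos (hK'.trans hle)).le, D.x_le hK' hle⟩, ?_, fun hn => ?_⟩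
    · simp only [Matrix.cons_val_one, Matrix.cons_val_fin_one]
      split_ifs
      · exact ⟨D.ell_x_nonneg (hK'.trans hle), D.ell_x_le hK' hle⟩
      · exact ⟨le_rfl, D.ell_x_nonneg hK'⟩
    · rw [if_neg fun h1 => hn fun j hj => h1 j (by omega)]
      simp

lemma potential_tail_two {ξ : FourShift} {K : ℕ} (hK : D.lam ≤ K) (h : ∀ j < K, ξ j ∈ symTwo) :
    D.potential ξ 0 ∈ Icc 0 (D.x (K + 1 - D.lam)) ∧
      D.potential ξ 1 ∈ Icc (-D.ell (D.x (K + 1 - D.lam))) 0 ∧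
      (¬ (∀ j < K, ξ j = 3) → D.potential ξ 1 = 0) := by
  classical
  have hK' : 1 ≤ K + 1 - D.lam := by omega
  rcases Ytilde_or_exits _ _ h with h' | ⟨m, hm, h'⟩
  · rw [D.potential_never (Or.inr h')]
    simp [(D.x_pos hK').le, D.ell_x_nonneg hK']
  · have hle : K + 1 - D.lam ≤ m + 1 - D.lam := by omega
    rw [D.potential_exit_two (hK.trans hm) h']
    refine ⟨⟨(D.x_pos (hK'.trans hle)).le, D.x_le hK' hle⟩, ?_, fun hn => ?_⟩
    · simp only [Matrix.cons_val_one, Matrix.cons_val_fin_one]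
      split_ifs
      · exact ⟨neg_le_neg (D.ell_x_le hK' hle), neg_nonpos.2 (D.ell_x_nonneg (hK'.trans hle))⟩
      · exact ⟨neg_nonpos.2 (D.ell_x_nonneg hK'), le_rfl⟩
    · rw [if_neg fun h1 => hn fun j hj => h1 j (by omega)]
      simp

lemma approx_cyl_one {ξ : FourShift} {K : ℕ} (h : ∀ j < K, ξ j = 1) :
    D.approx K ξ = D.curvePoint (K + 1 - D.lam) := by
  unfold approx
  rw [if_pos (show ξ ∈ cyl K ptOne from h), curvePoint]

lemma approx_cyl_three {ξ : FourShift} {K : ℕ} (hK : 0 < K) (h : ∀ j < K, ξ j = 3) :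
    D.approx K ξ = !₂[D.x (K + 1 - D.lam), -D.ell (D.x (K + 1 - D.lam))] := by
  unfold approx
  rw [if_neg, if_pos (show ξ ∈ cyl K ptThree from h)]
  intro h'
  have := h' 0 hK
  rw [h 0 hK] at this
  exact absurd this (by decide)

lemma approx_rest {ξ : FourShift} {K : ℕ} (h : (∀ j < K, ξ j ∈ symOne) ∨ ∀ j < K, ξ j ∈ symTwo)
    (h1 : ¬ ∀ j < K, ξ j = 1) (h3 : ¬ ∀ j < K, ξ j = 3) :
    D.approx K ξ = !₂[D.x (K + 1 - D.lam), 0] := by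
  unfold approx
  rw [if_neg (show ¬ ξ ∈ cyl K ptOne from h1), if_neg (show ¬ ξ ∈ cyl K ptThree from h3),
    if_pos (show ξ ∈ Ytilde symOne K ∪ Ytilde symTwo K from h)]

lemma approx_out {ξ : FourShift} {K : ℕ}
    (h : ¬ ((∀ j < K, ξ j ∈ symOne) ∨ ∀ j < K, ξ j ∈ symTwo)) :
    D.approx K ξ = D.potential ξ := by
  unfold approx
  rw [if_neg, if_neg, if_neg (show ¬ ξ ∈ Ytilde symOne K ∪ Ytilde symTwo K from h)]
  · exact fun h' => h (Or.inr fun j hj => mem_symTwo.2 (Or.inr (h' j hj)))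
  · exact fun h' => h (Or.inl fun j hj => mem_symOne.2 (Or.inr (h' j hj)))

/-- The possible values of the approximating potential on `Ỹ₁(K) ∪ Ỹ₂(K)`, and its value
elsewhere. -/
lemma approx_cases {K : ℕ} (hK : 0 < K) (ξ : FourShift) :
    ((∀ j < K, ξ j ∈ symOne) ∧ D.approx K ξ 0 = D.x (K + 1 - D.lam) ∧
      ((∀ j < K, ξ j = 1) ∧ D.approx K ξ 1 = D.ell (D.x (K + 1 - D.lam)) ∨
        (¬ ∀ j < K, ξ j = 1) ∧ D.approx K ξ 1 = 0)) ∨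
    ((∀ j < K, ξ j ∈ symTwo) ∧ D.approx K ξ 0 = D.x (K + 1 - D.lam) ∧
      ((∀ j < K, ξ j = 3) ∧ D.approx K ξ 1 = -D.ell (D.x (K + 1 - D.lam)) ∨
        (¬ ∀ j < K, ξ j = 3) ∧ D.approx K ξ 1 = 0)) ∨
    ((¬ ∀ j < K, ξ j ∈ symOne) ∧ (¬ ∀ j < K, ξ j ∈ symTwo) ∧ D.approx K ξ = D.potential ξ) := by
  by_cases h1 : ∀ j < K, ξ j ∈ symOne
  · left
    refine ⟨h1, ?_⟩
    by_cases hc : ∀ j < K, ξ j = 1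
    · rw [D.approx_cyl_one hc]
      exact ⟨rfl, Or.inl ⟨hc, rfl⟩⟩
    · rw [D.approx_rest (Or.inl h1) hc fun h3 => ?_]
      · exact ⟨rfl, Or.inr ⟨hc, rfl⟩⟩
      · have := h1 0 hK
        rw [h3 0 hK, mem_symOne] at this
        exact absurd this (by decide)
  right
  by_cases h2 : ∀ j < K, ξ j ∈ symTwo
  · left
    refine ⟨h2, ?_⟩
    by_cases hc : ∀ j < K, ξ j = 3
    · rw [D.approx_cyl_three hK hc]
      exact ⟨rfl, Or.inl ⟨hc, rfl⟩⟩
    · rw [D.approx_rest (Or.inr h2) (fun h => ?_) hc]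
      · exact ⟨rfl, Or.inr ⟨hc, rfl⟩⟩
      · have := h2 0 hK
        rw [h 0 hK, mem_symTwo] at this
        exact absurd this (by decide)
  · exact Or.inr ⟨h1, h2, D.approx_out (not_or.2 ⟨h1, h2⟩)⟩

/-- Where the two potentials can differ, both values lie in the same box with opposite corners `0`
and `p_{K+1-λ}`, or in its mirror image. -/
lemma norm_approx_sub_le {K : ℕ} (hK : D.lam ≤ K) (ξ : FourShift) :
    ‖D.approx K ξ - D.potential ξ‖ ≤ ‖D.curvePoint (K + 1 - D.lam)‖ := by
  have hl := D.lam_pos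
  have hl' : 1 ≤ K + 1 - D.lam := by omega
  have he := D.ell_x_nonneg hl'
  rcases D.approx_cases (by omega : 0 < K) ξ with ⟨h, ha, hb⟩ | ⟨h, ha, hb⟩ | ⟨-, -, h⟩
  · obtain ⟨⟨t0, t1⟩, ⟨t2, t3⟩, -⟩ := D.potential_tail_one hK h
    apply D.norm_le_norm_curvePoint
    · rw [PiLp.sub_apply, ha, abs_le]; constructor <;> linarith
    · rw [PiLp.sub_apply, abs_le]
      rcases hb with ⟨-, hb⟩ | ⟨-, hb⟩ <;> rw [hb] <;> constructor <;> linarith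
  · obtain ⟨⟨t0, t1⟩, ⟨t2, t3⟩, -⟩ := D.potential_tail_two hK h
    apply D.norm_le_norm_curvePoint
    · rw [PiLp.sub_apply, ha, abs_le]; constructor <;> linarith
    · rw [PiLp.sub_apply, abs_le]
      rcases hb with ⟨-, hb⟩ | ⟨-, hb⟩ <;> rw [hb] <;> constructor <;> linarith
  · rw [h, sub_self, norm_zero]; exact norm_nonneg _

/-- A point outside `Ỹ₁(K) ∪ Ỹ₂(K)` that reaches time `λ` inside one symbol set leaves it at a
position `m < K`, so the first `K` symbols already reveal the exit. -/
lemma approx_eq_of_cylinder {K : ℕ} (hK : D.lam ≤ K) {ξ η : FourShift}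
    (h : ∀ j < K, ξ j = η j) : D.approx K ξ = D.approx K η := by
  classical
  have hall : ∀ Q : Fin 4 → Prop, (∀ j < K, Q (ξ j)) ↔ ∀ j < K, Q (η j) := fun Q =>
    forall₂_congr fun j hj => by rw [h j hj]
  by_cases hY : (∀ j < K, ξ j ∈ symOne) ∨ ∀ j < K, ξ j ∈ symTwo
  · unfold approx
    have e1 : ξ ∈ cyl K ptOne ↔ η ∈ cyl K ptOne := hall (· = 1)
    have e3 : ξ ∈ cyl K ptThree ↔ η ∈ cyl K ptThree := hall (· = 3)
    have hY' : (∀ j < K, η j ∈ symOne) ∨ ∀ j < K, η j ∈ symTwo := by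
      rwa [hall (· ∈ symOne), hall (· ∈ symTwo)] at hY
    simp only [e1, e3, if_pos (show ξ ∈ Ytilde symOne K ∪ Ytilde symTwo K from hY),
      if_pos (show η ∈ Ytilde symOne K ∪ Ytilde symTwo K from hY')]
  · have hY' : ¬ ((∀ j < K, η j ∈ symOne) ∨ ∀ j < K, η j ∈ symTwo) := by
      rwa [hall (· ∈ symOne), hall (· ∈ symTwo)] at hY
    rw [D.approx_out hY, D.approx_out hY']
    have lt_of : ∀ {S : Set (Fin 4)} {m : ℕ}, (¬ ∀ j < K, ξ j ∈ S) → (∀ j < m, ξ j ∈ S) →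
        m < K := fun h1 h2 => by
      by_contra hc
      exact h1 fun j hj => h2 j (by omega)
    have hm : ∀ {S : Set (Fin 4)} {m : ℕ}, m < K → (∀ j < m, ξ j ∈ S) ∧ ξ m ∉ S →
        (∀ j < m, η j ∈ S) ∧ η m ∉ S := fun hmK h' =>
      ⟨fun j hj => h j (by omega) ▸ h'.1 j hj, h _ hmK ▸ h'.2⟩
    rw [not_or] at hY
    rcases D.trichotomy ξ with h' | h' | ⟨m, hm', h'⟩ | ⟨m, hm', h'⟩
    · rw [D.potential_out h'.1 h'.2, D.potential_out]
      · exact fun hc => h'.1 fun j hj => (h j (by omega)).symm ▸ hc j hj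
      · exact fun hc => h'.2 fun j hj => (h j (by omega)).symm ▸ hc j hj
    · rcases h' with h' | h'
      · exact absurd (fun j _ => h' j) hY.1
      · exact absurd (fun j _ => h' j) hY.2
    · have hmK := lt_of hY.1 h'.1
      rw [D.potential_exit_one hm' h', D.potential_exit_one hm' (hm hmK h')]
      have : (∀ j < m, ξ j = 1) ↔ ∀ j < m, η j = 1 :=
        forall₂_congr fun j hj => by rw [h j (by omega)]
      simp only [this]
    · have hmK := lt_of hY.2 h'.1
      rw [D.potential_exit_two hm' h', D.potential_exit_two hm' (hm hmK h')]
      have : (∀ j < m, ξ j = 3) ↔ ∀ j < m, η j = 3 :=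
        forall₂_congr fun j hj => by rw [h j (by omega)]
      simp only [this]

lemma isLocallyConstant_approx {K : ℕ} (hK : D.lam ≤ K) : IsLocallyConstant (D.approx K) := by
  rw [IsLocallyConstant.iff_exists_open]
  intro ξ
  refine ⟨⋂ j ∈ Finset.range K, {η : FourShift | η j = ξ j},
    isOpen_biInter_finset fun j _ => ?_, by simp, fun η hη => ?_⟩
  · exact (isOpen_discrete ({ξ j} : Set (Fin 4))).preimage
      (continuous_apply (A := fun _ : ℕ => Fin 4) j)
  · refine D.approx_eq_of_cylinder hK fun j hj => ?_
    simp only [mem_iInter, Finset.mem_range] at hη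
    exact hη j hj

/-- `Φ` is the uniform limit of its locally constant truncations, as `p_k → 0`. -/
lemma continuous_potential : Continuous D.potential := by
  refine continuous_of_uniform_approx_of_continuous fun u hu => ?_
  obtain ⟨ε, hε, hu⟩ := Metric.mem_uniformity_dist.1 hu
  have h := (tendsto_zero_iff_norm_tendsto_zero.1 D.tendsto_curvePoint).eventually
    (gt_mem_nhds hε)
  obtain ⟨N, hN⟩ := eventually_atTop.1 h
  refine ⟨D.approx (D.lam + N), (D.isLocallyConstant_approx (by omega)).continuous, fun ξ => ?_⟩
  apply hu
  rw [dist_comm, dist_eq_norm]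
  exact (D.norm_approx_sub_le (by omega) ξ).trans_lt (hN _ (by omega))

end Params

/-! ### Shannon entropy of finite partitions -/

section PartitionEntropy

/-- This is `log t ≤ t - 1` at `t = pq/a`, multiplied by `a`. Summed over joint probabilities `a`
with marginals `p`, `q` it yields subadditivity; with `p = 1` and `q = 1/N` it yields the bound `log
N`. -/
lemma negMulLog_le_of_le {a p q : ℝ} (ha : 0 ≤ a) (hp : 0 ≤ p) (hq : 0 ≤ q) (hap : 0 < a → 0 < p)
    (haq : 0 < a → 0 < q) :
    Real.negMulLog a ≤ -(a * Real.log p) - a * Real.log q + p * q - a := by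
  rcases ha.eq_or_lt with rfl | ha
  · simpa using mul_nonneg hp hq
  · have hp := hap ha
    have hq := haq ha
    have h := mul_le_mul_of_nonneg_left
      (Real.log_le_sub_one_of_pos (div_pos (mul_pos hp hq) ha)) ha.le
    rw [Real.log_div (mul_pos hp hq).ne' ha.ne', Real.log_mul hp.ne' hq.ne', mul_sub, mul_sub,
      mul_add, mul_div_cancel₀ _ ha.ne'] at h
    rw [Real.negMulLog]
    linarith

lemma joinPartition_eq_iff {X ι : Type*} {f : X → X} {P : X → ι} {n : ℕ} {x y : X} :
    joinPartition f P n x = joinPartition f P n y ↔ ∀ j < n, P (f^[j] x) = P (f^[j] y) := by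
  rw [funext_iff, Fin.forall_iff]
  rfl

lemma measurable_joinPartition {X ι : Type*} [MeasurableSpace X] [MeasurableSpace ι] {f : X → X}
    (hf : Measurable f) {P : X → ι} (hP : Measurable P) (n : ℕ) :
    Measurable (joinPartition f P n) :=
  measurable_pi_lambda _ fun j => hP.comp (hf.iterate j)

variable {X ι κ : Type*} [MeasurableSpace X] [Fintype ι] [Fintype κ] {μ : Measure X}

lemma partitionEntropy_nonneg [IsProbabilityMeasure μ] (P : X → ι) : 0 ≤ partitionEntropy μ P :=
  Finset.sum_nonneg fun _ _ => Real.negMulLog_nonneg measureReal_nonneg measureReal_le_one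

/-- A factor of a partition has less entropy than the partition. -/
lemma partitionEntropy_le_of_factor [MeasurableSpace κ] [MeasurableSingletonClass κ]
    [IsProbabilityMeasure μ] {P : X → ι} {Q : X → κ}
    (hQ : Measurable Q) (h : ∀ x y, Q x = Q y → P x = P y) :
    partitionEntropy μ P ≤ partitionEntropy μ Q := by
  classical
  have hX : Nonempty X := by
    by_contra hX
    rw [not_nonempty_iff] at hX
    have h1 := measure_univ (μ := μ)
    rw [univ_eq_empty_iff.2 hX, measure_empty] at h1
    exact zero_ne_one h1
  have : Nonempty ι := hX.map P
  obtain ⟨g, rfl⟩ : ∃ g : κ → ι, P = g ∘ Q :=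
    (Function.factorsThrough_iff _).1 fun {x y} hxy => h x y hxy
  have hfib : ∀ i, μ.real (g ∘ Q ⁻¹' {i}) = ∑ j with g j = i, μ.real (Q ⁻¹' {j}) := by
    intro i
    rw [← measureReal_biUnion_finset]
    · congr 1
      ext x
      simp
    · intro j _ k _ hjk
      exact Disjoint.preimage _ (disjoint_singleton.2 hjk)
    · exact fun j _ => hQ (measurableSet_singleton j)
  unfold partitionEntropy
  -- Group the cells of `Q` by the cell of `P` containing them; inside a group the logarithm of the
  -- larger mass dominates term by term.
  rw [← Finset.sum_fiberwise (s := Finset.univ) (g := g)]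
  refine Finset.sum_le_sum fun i _ => ?_
  rw [hfib]
  generalize hs : (Finset.univ.filter fun j => g j = i) = s
  rw [Real.negMulLog, neg_mul, Finset.sum_mul, ← Finset.sum_neg_distrib]
  refine Finset.sum_le_sum fun j hj => ?_
  rw [Real.negMulLog, neg_mul]
  rcases (measureReal_nonneg (μ := μ) (s := Q ⁻¹' {j})).eq_or_lt with h0 | h0
  · rw [← h0]; simp
  · have hle : μ.real (Q ⁻¹' {j}) ≤ ∑ j ∈ s, μ.real (Q ⁻¹' {j}) :=
      Finset.single_le_sum (f := fun j => μ.real (Q ⁻¹' {j})) (fun _ _ => measureReal_nonneg) hj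
    have := mul_le_mul_of_nonneg_left (Real.log_le_log h0 hle) h0.le
    linarith

variable [MeasurableSpace ι] [MeasurableSingletonClass ι] [MeasurableSpace κ]
  [MeasurableSingletonClass κ]

lemma sum_measureReal_preimage_singleton [IsProbabilityMeasure μ] {P : X → ι}
    (hP : Measurable P) : ∑ i, μ.real (P ⁻¹' {i}) = 1 := by
  rw [MeasureTheory.sum_measureReal_preimage_singleton Finset.univ fun i _ => hP
      (measurableSet_singleton i)]
  simp

/-- Subadditivity of the entropy of partitions. -/
lemma partitionEntropy_prod_le [IsProbabilityMeasure μ] {P : X → ι} {Q : X → κ}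
    (hP : Measurable P) (hQ : Measurable Q) :
    partitionEntropy μ (fun x => (P x, Q x)) ≤ partitionEntropy μ P + partitionEntropy μ Q := by
  set b : ι × κ → ℝ := fun z => μ.real ((fun x => (P x, Q x)) ⁻¹' {z}) with hb
  set p : ι → ℝ := fun i => μ.real (P ⁻¹' {i}) with hp
  set q : κ → ℝ := fun j => μ.real (Q ⁻¹' {j}) with hq
  have hset : ∀ i j, (fun x => (P x, Q x)) ⁻¹' {(i, j)} = P ⁻¹' {i} ∩ Q ⁻¹' {j} := by
    intro i j; ext x; simp
  have hbp : ∀ i, ∑ j, b (i, j) = p i := by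
    intro i
    simp only [hb, hp, hset]
    rw [← measureReal_biUnion_finset]
    · congr 1; ext x; simp
    · intro j _ k _ hjk
      exact (Disjoint.preimage _ (disjoint_singleton.2 hjk)).mono inter_subset_right
        inter_subset_right
    · exact fun j _ => (hP (measurableSet_singleton _)).inter (hQ (measurableSet_singleton _))
  have hbq : ∀ j, ∑ i, b (i, j) = q j := by
    intro j
    simp only [hb, hq, hset]
    rw [← measureReal_biUnion_finset]
    · congr 1; ext x; simp
    · intro j _ k _ hjk
      exact (Disjoint.preimage _ (disjoint_singleton.2 hjk)).mono inter_subset_left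
        inter_subset_left
    · exact fun j _ => (hP (measurableSet_singleton _)).inter (hQ (measurableSet_singleton _))
  have hb0 : ∀ z, 0 ≤ b z := fun _ => measureReal_nonneg
  have hp0 : ∀ z, 0 ≤ p z := fun _ => measureReal_nonneg
  have hq0 : ∀ z, 0 ≤ q z := fun _ => measureReal_nonneg
  have hp1 : ∑ i, p i = 1 := sum_measureReal_preimage_singleton hP
  have hq1 : ∑ i, q i = 1 := sum_measureReal_preimage_singleton hQ
  have hbple : ∀ i j, b (i, j) ≤ p i := fun i j => hbp i ▸
    Finset.single_le_sum (f := fun j => b (i, j)) (fun _ _ => hb0 _) (Finset.mem_univ j)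
  have hbqle : ∀ i j, b (i, j) ≤ q j := fun i j => hbq j ▸
    Finset.single_le_sum (f := fun i => b (i, j)) (fun _ _ => hb0 _) (Finset.mem_univ i)
  calc partitionEntropy μ (fun x => (P x, Q x))
      = ∑ i, ∑ j, Real.negMulLog (b (i, j)) := by
        rw [partitionEntropy, Fintype.sum_prod_type]
    _ ≤ ∑ i, ∑ j, (-(b (i, j) * Real.log (p i)) - b (i, j) * Real.log (q j) + p i * q j
          - b (i, j)) := by
        refine Finset.sum_le_sum fun i _ => Finset.sum_le_sum fun j _ => ?_
        exact negMulLog_le_of_le (hb0 _) (hp0 _) (hq0 _) (fun h => h.trans_le (hbple i j))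
          fun h => h.trans_le (hbqle i j)
    _ = partitionEntropy μ P + partitionEntropy μ Q := by
        have e1 : ∑ i, ∑ j, b (i, j) * Real.log (p i) = ∑ i, p i * Real.log (p i) := by
          refine Finset.sum_congr rfl fun i _ => ?_
          rw [← Finset.sum_mul, hbp]
        have e2 : ∑ i, ∑ j, b (i, j) * Real.log (q j) = ∑ j, q j * Real.log (q j) := by
          rw [Finset.sum_comm]
          refine Finset.sum_congr rfl fun i _ => ?_
          rw [← Finset.sum_mul, hbq]
        have e3 : ∑ i, ∑ j, p i * q j = 1 := by
          simp only [← Finset.mul_sum, hq1, mul_one, hp1]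
        have e4 : ∑ i, ∑ j, b (i, j) = 1 := by simp only [hbp, hp1]
        simp only [Finset.sum_add_distrib, Finset.sum_sub_distrib, Finset.sum_neg_distrib, e1, e2,
          e3, e4, partitionEntropy, Real.negMulLog, neg_mul]
        ring

/-- The entropy of a partition into `N` sets is at most `log N`. -/
lemma partitionEntropy_le_log_card [IsProbabilityMeasure μ] {P : X → ι} (hP : Measurable P) :
    partitionEntropy μ P ≤ Real.log (Fintype.card ι) := by
  have h1 := sum_measureReal_preimage_singleton (μ := μ) hP
  have hne : Nonempty ι := by
    by_contra h
    rw [not_nonempty_iff] at h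
    simp at h1
  have hc : (0 : ℝ) < Fintype.card ι := by exact_mod_cast Fintype.card_pos
  calc partitionEntropy μ P
      ≤ ∑ i, (-(μ.real (P ⁻¹' {i}) * Real.log 1)
          - μ.real (P ⁻¹' {i}) * Real.log (Fintype.card ι : ℝ)⁻¹ + 1 * (Fintype.card ι : ℝ)⁻¹
          - μ.real (P ⁻¹' {i})) :=
        Finset.sum_le_sum fun i _ => negMulLog_le_of_le measureReal_nonneg zero_le_one
          (by positivity) (fun _ => zero_lt_one) (fun _ => by positivity)
    _ = Real.log (Fintype.card ι) := by
        simp only [Real.log_one, mul_zero, neg_zero, zero_sub, Real.log_inv, mul_neg, neg_neg,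
          one_mul, Finset.sum_add_distrib, Finset.sum_sub_distrib, ← Finset.sum_mul, h1,
          Finset.sum_const, Finset.card_univ, nsmul_eq_mul, mul_inv_cancel₀ hc.ne']
        ring

lemma partitionEntropy_comp {f : X → X} (hf : MeasurePreserving f μ μ) {P : X → ι}
    (hP : Measurable P) : partitionEntropy μ (P ∘ f) = partitionEntropy μ P := by
  unfold partitionEntropy
  refine Finset.sum_congr rfl fun i _ => ?_
  rw [preimage_comp, hf.measureReal_preimage (hP (measurableSet_singleton i)).nullMeasurableSet]

lemma partitionEntropy_joinPartition_le [IsProbabilityMeasure μ] {f : X → X}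
    (hf : MeasurePreserving f μ μ) {P : X → ι} (hP : Measurable P) (n : ℕ) :
    partitionEntropy μ (joinPartition f P n) ≤ n * partitionEntropy μ P := by
  induction n with
  | zero =>
    have := partitionEntropy_le_log_card (μ := μ) (measurable_joinPartition hf.measurable hP 0)
    simpa using this
  | succ n ih =>
    have h1 : partitionEntropy μ (joinPartition f P (n + 1)) ≤
        partitionEntropy μ fun x => (joinPartition f P n x, (P ∘ f^[n]) x) := by
      refine partitionEntropy_le_of_factor ((measurable_joinPartition hf.measurable hP n).prodMk
        (hP.comp (hf.measurable.iterate n))) fun x y hxy => ?_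
      rw [Prod.mk.injEq, joinPartition_eq_iff] at hxy
      rw [joinPartition_eq_iff]
      intro j hj
      rcases Nat.lt_succ_iff_lt_or_eq.1 hj with hj | rfl
      · exact hxy.1 j hj
      · exact hxy.2
    have h2 := partitionEntropy_prod_le (μ := μ) (measurable_joinPartition hf.measurable hP n)
      (hP.comp (hf.measurable.iterate n))
    rw [partitionEntropy_comp (hf.iterate n) hP] at h2
    push_cast
    linarith

/-- Entropies are non-negative. -/
lemma entropy_nonneg (f : X → X) (μ : Measure X) [IsProbabilityMeasure μ] : 0 ≤ entropy f μ := by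
  have h : 0 ≤ entropyRate f μ (fun _ : X => (0 : Fin 1)) := by
    refine le_limsup_of_frequently_le (Frequently.of_forall fun n => ?_)
    exact_mod_cast div_nonneg (partitionEntropy_nonneg _) n.cast_nonneg
  exact h.trans (le_iSup₂_of_le 1 _ (le_iSup_of_le measurable_const le_rfl))

lemma entropy_dirac (f : X → X) (x : X) : entropy f (Measure.dirac x) ≤ 0 := by
  refine iSup₂_le fun k P => iSup_le fun hP => ?_
  unfold entropyRate
  have : ∀ n, partitionEntropy (Measure.dirac x) (joinPartition f P n) = 0 := by
    intro n
    refine Finset.sum_eq_zero fun v _ => ?_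
    rcases Measure.dirac_apply_eq_zero_or_one (a := x) (s := joinPartition f P n ⁻¹' {v})
      with h | h <;> simp [measureReal_def, h]
  simp [this]

end PartitionEntropy

/-! ### Entropy of invariant measures of the full shift -/

lemma shift_iterate_apply (j k : ℕ) (ξ : FourShift) : (shift^[j] ξ) k = ξ (k + j) := by
  induction j generalizing k with
  | zero => rfl
  | succ j ih =>
    rw [Function.iterate_succ_apply', shift, ih]
    congr 1
    omega

lemma measurable_shift : Measurable shift :=
  measurable_pi_lambda _ fun k => measurable_pi_apply (k + 1)

/-- Which of the two symbol sets a symbol belongs to. -/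
def symType (s : Fin 4) : Bool := decide (2 ≤ s)

/-- The position of a symbol in its symbol set. -/
def symBit (s : Fin 4) : Bool := decide (s = 1 ∨ s = 3)

lemma eq_of_symType_eq_of_symBit_eq {s t : Fin 4} (h : symType s = symType t)
    (h' : symBit s = symBit t) : s = t := by
  revert s t; decide

/-- Whether the first two symbols lie in different symbol sets. -/
def switches (ξ : FourShift) : Bool := xor (symType (ξ 0)) (symType (ξ 1))

lemma measurable_of_dependsOn_prefix {β : Type*} [MeasurableSpace β] {P : FourShift → β} {m : ℕ}
    (h : ∀ ξ η : FourShift, (∀ j < m, ξ j = η j) → P ξ = P η) : Measurable P := by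
  have hP : P = (fun v : Fin m → Fin 4 => P fun k => if hk : k < m then v ⟨k, hk⟩ else 0) ∘
      fun ξ j => ξ j := by
    funext ξ
    refine h _ _ fun j hj => ?_
    simp [hj]
  rw [hP]
  exact (measurable_of_countable _).comp (measurable_pi_lambda _ fun j => measurable_pi_apply _)

lemma measurable_comp_zero {β : Type*} [MeasurableSpace β] (g : Fin 4 → β) :
    Measurable fun ξ : FourShift => g (ξ 0) :=
  (measurable_of_countable g).comp (measurable_pi_apply 0)

lemma measurable_switches : Measurable switches :=
  measurable_of_dependsOn_prefix (m := 2) fun ξ η h => by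
    rw [switches, switches, h 0 (by norm_num), h 1 (by norm_num)]

/-- The type of the first symbol and the successive switches determine all types; together with the
bits they determine the symbols. The first type costs `log 2` once, each bit at most `log 2`, each
switch at most the entropy of `switches`. -/
lemma partitionEntropy_symbols_le (μ : Measure FourShift) [IsProbabilityMeasure μ]
    (hμ : MeasurePreserving shift μ μ) (n : ℕ) :
    partitionEntropy μ (joinPartition shift (fun ξ => ξ 0) n) ≤
      Real.log 2 + n * (Real.log 2 + partitionEntropy μ switches) := by
  have hT := measurable_comp_zero symType
  have hB := measurable_comp_zero symBit
  have hBn := measurable_joinPartition hμ.measurable hB n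
  have hSn := measurable_joinPartition hμ.measurable measurable_switches n
  have h1 : partitionEntropy μ (joinPartition shift (fun ξ => ξ 0) n) ≤
      partitionEntropy μ fun ξ => ((symType (ξ 0), joinPartition shift (fun ξ => symBit (ξ 0)) n ξ),
        joinPartition shift switches n ξ) := by
    refine partitionEntropy_le_of_factor ((hT.prodMk hBn).prodMk hSn) fun ξ η h => ?_
    simp only [Prod.mk.injEq, joinPartition_eq_iff] at h
    obtain ⟨⟨h0, hb⟩, hs⟩ := h
    have ht : ∀ j ≤ n, symType (ξ j) = symType (η j) := by
      intro j hj
      induction j with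
      | zero => exact h0
      | succ j ih =>
        have h2 := hs j hj
        simp only [switches, shift_iterate_apply, zero_add, ih (by omega)] at h2
        rw [add_comm]
        exact Bool.xor_right_inj.1 h2
    rw [joinPartition_eq_iff]
    intro j hj
    refine eq_of_symType_eq_of_symBit_eq ?_ (hb j hj)
    simp only [shift_iterate_apply, zero_add]
    exact ht j hj.le
  have h2 := partitionEntropy_prod_le (μ := μ) (hT.prodMk hBn) hSn
  have h3 := partitionEntropy_prod_le (μ := μ) hT hBn
  have h4 : partitionEntropy μ (fun ξ : FourShift => symType (ξ 0)) ≤ Real.log 2 := by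
    simpa using partitionEntropy_le_log_card (μ := μ) hT
  have h5 : partitionEntropy μ (fun ξ : FourShift => symBit (ξ 0)) ≤ Real.log 2 := by
    simpa using partitionEntropy_le_log_card (μ := μ) hB
  have h6 := partitionEntropy_joinPartition_le hμ hB n
  have h7 := partitionEntropy_joinPartition_le hμ measurable_switches n
  have h8 := mul_le_mul_of_nonneg_left h5 n.cast_nonneg
  linarith

/-- Measurable sets are approximated by unions of cylinders. -/
lemma exists_prefix_set_symmDiff_lt (μ : Measure FourShift) [IsProbabilityMeasure μ]
    {A : Set FourShift} (hA : MeasurableSet A) {ε : ℝ} (hε : 0 < ε) :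
    ∃ (m : ℕ) (B : Set FourShift), (∀ ξ η : FourShift, (∀ j < m, ξ j = η j) → (ξ ∈ B ↔ η ∈ B)) ∧
      μ.real (symmDiff B A) < ε := by
  obtain ⟨B, hB, hBA⟩ := exists_measure_symmDiff_lt_of_generateFrom_isSetRing (μ := μ)
    isSetRing_measurableCylinders
    ⟨{univ}, countable_singleton _, singleton_subset_iff.2 (univ_mem_measurableCylinders _),
      by simp⟩ generateFrom_measurableCylinders.symm hA (ENNReal.ofReal_pos.2 hε)
  obtain ⟨s, S, -, rfl⟩ := (mem_measurableCylinders _).1 hB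
  refine ⟨s.sup id + 1, cylinder s S, fun ξ η h => ?_, ?_⟩
  · rw [mem_cylinder, mem_cylinder]
    have : s.restrict ξ = s.restrict η := by
      funext j
      exact h j (Nat.lt_succ_of_le (Finset.le_sup (f := id) j.2))
    rw [this]
  · rw [measureReal_def]
    exact (ENNReal.lt_ofReal_iff_toReal_lt (measure_ne_top _ _)).1 hBA

/-- Finite measurable partitions are approximated by partitions into unions of cylinders. -/
lemma exists_prefix_partition {k : ℕ} (μ : Measure FourShift) [IsProbabilityMeasure μ]
    {P : FourShift → Fin k} (hP : Measurable P) {ε : ℝ} (hε : 0 < ε) :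
    ∃ (m : ℕ) (Q : FourShift → Fin k), (∀ ξ η : FourShift, (∀ j < m, ξ j = η j) → Q ξ = Q η) ∧
      μ.real {ξ | P ξ ≠ Q ξ} < ε := by
  classical
  have hk : (0 : ℝ) < k := by exact_mod_cast (P 0).pos
  choose m B hB hBP using fun i : Fin k =>
    exists_prefix_set_symmDiff_lt μ (hP (measurableSet_singleton i)) (div_pos hε hk)
  let g : (Fin k → Prop) → Fin k := fun p => if h : ∃ i, p i then h.choose else P 0
  refine ⟨Finset.univ.sup m, fun ξ => g fun i => ξ ∈ B i, fun ξ η h => ?_, ?_⟩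
  · have : (fun i => ξ ∈ B i) = fun i => η ∈ B i := funext fun i => propext
      (hB i ξ η fun j hj => h j (hj.trans_le (Finset.le_sup (Finset.mem_univ i))))
    simp only [this]
  · have hsub : {ξ | P ξ ≠ g fun i => ξ ∈ B i} ⊆ ⋃ i, symmDiff (B i) (P ⁻¹' {i}) := by
      intro ξ hξ
      by_contra hn
      simp only [mem_iUnion, not_exists, Set.mem_symmDiff, mem_preimage, mem_singleton_iff] at hn
      have hiff : ∀ i, ξ ∈ B i ↔ P ξ = i := fun i => by have := hn i; tauto
      apply hξ
      have hex : ∃ i, ξ ∈ B i := ⟨P ξ, (hiff _).2 rfl⟩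
      simp only [g, dif_pos hex]
      exact (hiff _).1 hex.choose_spec
    calc μ.real {ξ | P ξ ≠ g fun i => ξ ∈ B i}
        ≤ μ.real (⋃ i, symmDiff (B i) (P ⁻¹' {i})) := measureReal_mono hsub
      _ ≤ ∑ i, μ.real (symmDiff (B i) (P ⁻¹' {i})) := measureReal_iUnion_fintype_le _
      _ < ∑ _i : Fin k, ε / k :=
        Finset.sum_lt_sum_of_nonempty ⟨P 0, Finset.mem_univ _⟩ fun i _ => hBP i
      _ = ε := by simp [mul_div_cancel₀ _ hk.ne']

/-- The partition that records where `P` differs from `Q`, and the value of `P` there. -/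
def errorPartition {k : ℕ} (P Q : FourShift → Fin k) (ξ : FourShift) : Bool × Fin k :=
  if P ξ = Q ξ then (false, P 0) else (true, P ξ)

lemma measurable_errorPartition {k : ℕ} {P Q : FourShift → Fin k} (hP : Measurable P)
    (hQ : Measurable Q) : Measurable (errorPartition P Q) :=
  Measurable.ite (measurableSet_eq_fun hP hQ) measurable_const (measurable_const.prodMk hP)

/-- The cell where `P = Q` has mass near `1` and the remaining cells have mass near `0`; `negMulLog`
is continuous and vanishes at both values. There are `2k` cells in all. -/
lemma exists_partitionEntropy_errorPartition_le {k : ℕ} (hk : 0 < k) (μ : Measure FourShift)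
    [IsProbabilityMeasure μ] {ε : ℝ} (hε : 0 < ε) :
    ∃ δ > 0, ∀ P Q : FourShift → Fin k, Measurable P → Measurable Q →
      μ.real {ξ | P ξ ≠ Q ξ} < δ → partitionEntropy μ (errorPartition P Q) ≤ ε := by
  have hk' : (0 : ℝ) < 2 * k := by positivity
  have h0 : ∀ᶠ t in 𝓝 (0 : ℝ), Real.negMulLog t < ε / (2 * k) :=
    Real.continuous_negMulLog.continuousAt.eventually_lt_const (by simp; positivity)
  have h1 : ∀ᶠ t in 𝓝 (1 : ℝ), Real.negMulLog t < ε / (2 * k) :=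
    Real.continuous_negMulLog.continuousAt.eventually_lt_const (by simp; positivity)
  obtain ⟨δ₀, hδ₀, h0⟩ := Metric.eventually_nhds_iff.1 h0
  obtain ⟨δ₁, hδ₁, h1⟩ := Metric.eventually_nhds_iff.1 h1
  refine ⟨min δ₀ δ₁, lt_min hδ₀ hδ₁, fun P Q hP hQ h => ?_⟩
  have hD : MeasurableSet {ξ | P ξ ≠ Q ξ} := (measurableSet_eq_fun hP hQ).compl
  calc partitionEntropy μ (errorPartition P Q) ≤ ∑ _i : Bool × Fin k, ε / (2 * k) := by
        refine Finset.sum_le_sum fun i _ => ?_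
        -- The label `(false, P 0)` marks agreement of `P` and `Q`; its second entry is merely some
        -- element of `Fin k`.
        by_cases hi : i = (false, P 0)
        · refine (h1 ?_).le
          have : {ξ | P ξ ≠ Q ξ}ᶜ = errorPartition P Q ⁻¹' {i} := by
            ext ξ
            simp only [errorPartition, hi, mem_compl_iff, mem_ofPred_eq, not_not, mem_preimage,
              mem_singleton_iff]
            split_ifs with h <;> simp [h]
          rw [← this, probReal_compl_eq_one_sub hD, Real.dist_eq]
          rw [show 1 - μ.real {ξ | P ξ ≠ Q ξ} - 1 = -μ.real {ξ | P ξ ≠ Q ξ} by ring, abs_neg,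
            abs_of_nonneg measureReal_nonneg]
          exact h.trans_le (min_le_right _ _)
        · refine (h0 ?_).le
          rw [Real.dist_eq, sub_zero, abs_of_nonneg measureReal_nonneg]
          refine (measureReal_mono ?_).trans_lt (h.trans_le (min_le_left _ _))
          intro ξ hξ hξ'
          rw [mem_preimage, mem_singleton_iff, errorPartition, if_pos hξ'] at hξ
          exact hi hξ.symm
    _ = ε := by
      simp only [Finset.sum_const, Finset.card_univ, Fintype.card_prod, Fintype.card_bool,
        Fintype.card_fin, nsmul_eq_mul]
      push_cast
      field_simp

/-- An upper bound for the entropy in terms of the frequency of changes of the symbol set. -/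
lemma entropy_le_log_two_add (μ : Measure FourShift) [IsProbabilityMeasure μ]
    (hμ : MeasurePreserving shift μ μ) :
    entropy shift μ ≤ ((Real.log 2 + partitionEntropy μ switches : ℝ) : EReal) := by
  refine iSup₂_le fun k P => iSup_le fun hP => ?_
  set c := Real.log 2 + partitionEntropy μ switches with hc
  -- An arbitrary partition is compared with a cylinder partition `Q` at the cost of an error
  -- partition of entropy at most `ε`, which avoids a separate generator theorem.
  have key : ∀ ε : ℝ, 0 < ε → entropyRate shift μ P ≤ ((c + ε : ℝ) : EReal) := by
    intro ε hε
    obtain ⟨δ, hδ, hE⟩ := exists_partitionEntropy_errorPartition_le (P 0).pos μ hε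
    obtain ⟨m, Q, hQ, hPQ⟩ := exists_prefix_partition μ hP hδ
    have hQm := measurable_of_dependsOn_prefix hQ
    have hEm := measurable_errorPartition hP hQm
    have hS : Measurable fun ξ : FourShift => ξ 0 := measurable_pi_apply 0
    -- The first `n + m` symbols determine `Q` along `n` steps; the error partition tells where `P`
    -- agrees with `Q` and gives `P` elsewhere.
    have bound : ∀ n : ℕ, partitionEntropy μ (joinPartition shift P n) ≤
        Real.log 2 + (n + m) * c + n * ε := by
      intro n
      have h1 : partitionEntropy μ (joinPartition shift P n) ≤
          partitionEntropy μ fun ξ => (joinPartition shift (fun ξ => ξ 0) (n + m) ξ,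
            joinPartition shift (errorPartition P Q) n ξ) := by
        refine partitionEntropy_le_of_factor ((measurable_joinPartition hμ.measurable hS _).prodMk
          (measurable_joinPartition hμ.measurable hEm n)) fun ξ η h => ?_
        simp only [Prod.mk.injEq, joinPartition_eq_iff, shift_iterate_apply, zero_add] at h
        rw [joinPartition_eq_iff]
        intro j hj
        have hQeq : Q (shift^[j] ξ) = Q (shift^[j] η) := hQ _ _ fun i hi => by
          rw [shift_iterate_apply, shift_iterate_apply]
          exact h.1 _ (by omega)
        have hEeq := h.2 j hj
        unfold errorPartition at hEeq
        split_ifs at hEeq with h1 h2 h2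
        · rw [h1, h2, hQeq]
        · simp at hEeq
        · simp at hEeq
        · exact (Prod.mk.inj hEeq).2
      have h2 := partitionEntropy_prod_le (μ := μ)
        (measurable_joinPartition hμ.measurable hS (n + m))
        (measurable_joinPartition hμ.measurable hEm n)
      have h3 := partitionEntropy_symbols_le μ hμ (n + m)
      have h4 := partitionEntropy_joinPartition_le hμ hEm n
      have h5 := mul_le_mul_of_nonneg_left (hE P Q hP hQm hPQ) n.cast_nonneg
      push_cast at h3
      linarith
    have hlim : Tendsto (fun n : ℕ => ((c + ε + (Real.log 2 + m * c) / n : ℝ) : EReal)) atTop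
        (𝓝 ((c + ε : ℝ) : EReal)) := by
      rw [EReal.tendsto_coe]
      have := (tendsto_const_nhds (x := c + ε)).add
        (tendsto_const_div_atTop_nhds_zero_nat (Real.log 2 + m * c))
      rwa [add_zero] at this
    refine (limsup_le_limsup ?_).trans hlim.limsup_eq.le
    filter_upwards [eventually_gt_atTop 0] with n hn
    have hn' : (0 : ℝ) < n := by exact_mod_cast hn
    rw [EReal.coe_le_coe_iff, div_le_iff₀ hn']
    have h := bound n
    rw [add_mul, div_mul_cancel₀ _ hn'.ne']
    linarith
  refine EReal.le_of_forall_lt_iff_le.1 fun z hz => ?_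
  have := key (z - c) (sub_pos.2 (EReal.coe_lt_coe_iff.1 hz))
  rwa [add_sub_cancel] at this

lemma partitionEntropy_switches (μ : Measure FourShift) [IsProbabilityMeasure μ] :
    partitionEntropy μ switches =
      Real.negMulLog (μ.real {ξ | switches ξ = true}) +
        Real.negMulLog (1 - μ.real {ξ | switches ξ = true}) := by
  have hm : MeasurableSet {ξ | switches ξ = true} := measurable_switches
      (measurableSet_singleton true)
  rw [partitionEntropy, Fintype.sum_bool, ← probReal_compl_eq_one_sub hm]
  congr 3
  ext ξ
  simp

/-! ### The Bernoulli measure on `{0, 1}^ℕ` -/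

/-- The uniform distribution on the symbols `0, 1`. -/
noncomputable def coin : Measure (Fin 4) :=
  (2⁻¹ : ENNReal) • (Measure.dirac 0 + Measure.dirac 1)

instance : IsProbabilityMeasure coin := ⟨by simp [coin, ENNReal.inv_two_add_inv_two]⟩

/-- The `(1/2, 1/2)`-Bernoulli measure on `{0, 1}^ℕ`. -/
noncomputable def bernoulli : Measure FourShift := Measure.infinitePi fun _ => coin

instance : IsProbabilityMeasure bernoulli := by unfold bernoulli; infer_instance

lemma measurePreserving_shift_bernoulli : MeasurePreserving shift bernoulli bernoulli := by
  refine ⟨measurable_shift, ?_⟩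
  conv_rhs => unfold bernoulli
  refine Measure.eq_infinitePi _ fun s t ht => ?_
  rw [Measure.map_apply measurable_shift (MeasurableSet.pi s.countable_toSet fun i _ => ht i)]
  -- The preimage of a box is the box with its index set moved up by one, so `i - 1` is only
  -- evaluated at successors.
  have : shift ⁻¹' (s : Set ℕ).pi t =
      ((s.map ⟨Nat.succ, Nat.succ_injective⟩ : Finset ℕ) : Set ℕ).pi fun i => t (i - 1) := by
    ext ξ
    simp [Set.mem_pi, shift]
  rw [this, bernoulli, Measure.infinitePi_pi _ fun i _ => ht _, Finset.prod_map]
  simp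

lemma bernoulli_symOne : ∀ᵐ ξ ∂bernoulli, ∀ j, ξ j ∈ symOne := by
  rw [ae_all_iff]
  intro j
  have h := Measure.infinitePi_map_eval (fun _ : ℕ => coin) j
  have h2 : ∀ᵐ s ∂coin, s ∈ symOne := by
    rw [ae_iff]
    simp [coin, symOne]
  rw [← h] at h2
  exact ae_of_ae_map (measurable_pi_apply j).aemeasurable h2

lemma coin_real_singleton (s : Fin 4) : coin.real {s} = 2⁻¹ ∨ coin.real {s} = 0 := by
  fin_cases s <;> simp [coin, measureReal_def]

/-- A cylinder of length `n` has mass `0` or `2⁻ⁿ`; in both cases its entropy term is its mass times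
`n log 2`, so the total is `n log 2`. -/
lemma negMulLog_prod_coin (n : ℕ) (v : Fin n → Fin 4) :
    Real.negMulLog (∏ j, coin.real {v j}) = (∏ j, coin.real {v j}) * (n * Real.log 2) := by
  by_cases h : ∃ j, coin.real {v j} = 0
  · obtain ⟨j, hj⟩ := h
    rw [Finset.prod_eq_zero (Finset.mem_univ j) hj]
    simp
  · push Not at h
    have : ∀ j, coin.real {v j} = 2⁻¹ := fun j => (coin_real_singleton _).resolve_right (h j)
    simp [this, Real.negMulLog]

lemma bernoulli_real_cylinder (n : ℕ) (v : Fin n → Fin 4) :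
    bernoulli.real (joinPartition shift (fun ξ => ξ 0) n ⁻¹' {v}) = ∏ j, coin.real {v j} := by
  have : joinPartition shift (fun ξ => ξ 0) n ⁻¹' {v} =
      ((Finset.range n : Finset ℕ) : Set ℕ).pi
        fun i => if hi : i < n then {v ⟨i, hi⟩} else univ := by
    ext ξ
    simp only [mem_preimage, mem_singleton_iff, funext_iff, Fin.forall_iff, joinPartition,
      shift_iterate_apply, zero_add, Set.mem_pi, Finset.coe_range, mem_Iio]
    exact forall₂_congr fun j hj => by simp [hj]
  rw [this, measureReal_def, bernoulli, Measure.infinitePi_pi _ (fun i _ => by measurability),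
    ENNReal.toReal_prod, Finset.prod_range]
  simp [measureReal_def]

lemma log_two_le_entropy_bernoulli : ((Real.log 2 : ℝ) : EReal) ≤ entropy shift bernoulli := by
  have hS : Measurable fun ξ : FourShift => ξ 0 := measurable_pi_apply 0
  refine le_iSup₂_of_le 4 (fun ξ => ξ 0) (le_iSup_of_le hS ?_)
  refine le_limsup_of_frequently_le (Eventually.frequently ?_)
  filter_upwards [eventually_gt_atTop 0] with n hn
  have hn' : (0 : ℝ) < n := by exact_mod_cast hn
  rw [EReal.coe_le_coe_iff, le_div_iff₀ hn']
  have h1 := sum_measureReal_preimage_singleton (μ := bernoulli)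
    (measurable_joinPartition measurable_shift hS n)
  simp only [bernoulli_real_cylinder] at h1
  simp only [partitionEntropy, bernoulli_real_cylinder, negMulLog_prod_coin, ← Finset.sum_mul, h1]
  linarith

/-! ### Rotation vectors -/

lemma integrable_coord {Ψ : FourShift → EuclideanSpace ℝ (Fin 2)} (hΨ : Continuous Ψ)
    (μ : Measure FourShift) [IsProbabilityMeasure μ] (i : Fin 2) :
    Integrable (fun ξ => Ψ ξ i) μ :=
  (show Continuous fun ξ => Ψ ξ i by fun_prop).integrable_of_hasCompactSupport
    (HasCompactSupport.of_compactSpace _)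

lemma rotationVector_apply {Ψ : FourShift → EuclideanSpace ℝ (Fin 2)}
    (μ : ProbabilityMeasure FourShift) (i : Fin 2) :
    rotationVector Ψ μ i = ∫ ξ, Ψ ξ i ∂(μ : Measure FourShift) := rfl

lemma localizedEntropy_nonneg {Ψ : FourShift → EuclideanSpace ℝ (Fin 2)}
    {w : EuclideanSpace ℝ (Fin 2)} (hw : w ∈ rotationSet shift Ψ) :
    0 ≤ localizedEntropy shift Ψ w := by
  obtain ⟨μ, hμ, rfl⟩ := hw
  exact (entropy_nonneg shift (μ : Measure FourShift)).trans
    (le_iSup₂_of_le μ ⟨hμ, rfl⟩ le_rfl)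

/-- The Dirac measure at the fixed point `111…`. -/
noncomputable def diracOne : ProbabilityMeasure FourShift :=
  ⟨Measure.dirac ptOne, inferInstance⟩

lemma diracOne_mem : diracOne ∈ invariantMeasures shift := by
  refine ⟨measurable_shift, ?_⟩
  change Measure.map shift (Measure.dirac ptOne) = Measure.dirac ptOne
  rw [Measure.map_dirac' measurable_shift]
  rfl

lemma rotationVector_diracOne {Ψ : FourShift → EuclideanSpace ℝ (Fin 2)} :
    rotationVector Ψ diracOne = Ψ ptOne := by
  ext i
  rw [rotationVector_apply]
  exact integral_dirac _ _

/-- The Bernoulli measure on `{0, 1}^ℕ` as a probability measure. -/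
noncomputable def bernoulliPM : ProbabilityMeasure FourShift := ⟨bernoulli, inferInstance⟩

lemma bernoulliPM_mem : bernoulliPM ∈ invariantMeasures shift := measurePreserving_shift_bernoulli

lemma notMem_symOne_iff {s : Fin 4} : s ∉ symOne ↔ symType s = true := by
  rw [mem_symOne]; revert s; decide

lemma mem_symTwo_iff {s : Fin 4} : s ∈ symTwo ↔ symType s = true := by
  rw [mem_symTwo_iff_notMem_symOne, notMem_symOne_iff]

lemma not_prefix_of_switches {ξ : FourShift} (h : switches ξ = true) {l : ℕ} (hl : 2 ≤ l) :
    (¬ ∀ j < l, ξ j ∈ symOne) ∧ ¬ ∀ j < l, ξ j ∈ symTwo := by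
  constructor <;> intro hc <;> have h0 := hc 0 (by omega) <;> have h1 := hc 1 (by omega)
  · have h0 := mt notMem_symOne_iff.2 (not_not.2 h0)
    have h1 := mt notMem_symOne_iff.2 (not_not.2 h1)
    simp only [Bool.not_eq_true] at h0 h1
    simp [switches, h0, h1] at h
  · simp [switches, mem_symTwo_iff.1 h0, mem_symTwo_iff.1 h1] at h

/-- A Markov inequality: each switch contributes `a` to the first coordinate and nothing contributes
negatively. It turns closeness of the rotation vector to `0` into rarity of switches. -/
lemma measureReal_switches_le {Ψ : FourShift → EuclideanSpace ℝ (Fin 2)} (hΨ : Continuous Ψ)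
    {a : ℝ} (h0 : ∀ ξ, 0 ≤ Ψ ξ 0) (ha : ∀ ξ, switches ξ = true → Ψ ξ 0 = a)
    (μ : ProbabilityMeasure FourShift) :
    a * (μ : Measure FourShift).real {ξ | switches ξ = true} ≤ rotationVector Ψ μ 0 := by
  have hm : MeasurableSet {ξ | switches ξ = true} := measurable_switches
      (measurableSet_singleton true)
  have hint := integrable_coord hΨ (μ : Measure FourShift) 0
  calc a * (μ : Measure FourShift).real {ξ | switches ξ = true}
      = ∫ _ξ in {ξ | switches ξ = true}, a ∂(μ : Measure FourShift) := by
        rw [setIntegral_const, smul_eq_mul, mul_comm]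
    _ = ∫ ξ in {ξ | switches ξ = true}, Ψ ξ 0 ∂(μ : Measure FourShift) :=
        setIntegral_congr_fun hm fun ξ hξ => (ha ξ hξ).symm
    _ ≤ ∫ ξ, Ψ ξ 0 ∂(μ : Measure FourShift) :=
        setIntegral_le_integral hint (Eventually.of_forall h0)

/-- The bound of `entropy_le_log_two_add` as a function of the frequency of switches. -/
noncomputable def switchBound (t : ℝ) : ℝ :=
  Real.log 2 + (Real.negMulLog t + Real.negMulLog (1 - t))

lemma continuous_switchBound : Continuous switchBound := by
  unfold switchBound
  have h := Real.continuous_negMulLog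
  fun_prop

lemma switchBound_zero : switchBound 0 = Real.log 2 := by simp [switchBound]

lemma entropy_le_switchBound (μ : ProbabilityMeasure FourShift)
    (hμ : μ ∈ invariantMeasures shift) :
    entropy shift (μ : Measure FourShift) ≤
      (switchBound ((μ : Measure FourShift).real {ξ | switches ξ = true}) : EReal) := by
  rw [switchBound, ← partitionEntropy_switches]
  exact entropy_le_log_two_add _ hμ

lemma eq_dirac_of_ae_eq {X : Type*} [MeasurableSpace X] {μ : Measure X} [IsProbabilityMeasure μ]
    {x : X} (h : ∀ᵐ y ∂μ, y = x) : μ = Measure.dirac x := by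
  have h1 : μ.map id = μ.map fun _ => x := Measure.map_congr h
  rwa [Measure.map_id, Measure.map_const, measure_univ, one_smul] at h1

lemma eq_diracOne {μ : ProbabilityMeasure FourShift} (hμ : μ ∈ invariantMeasures shift)
    (h : ∀ᵐ ξ ∂(μ : Measure FourShift), ξ 0 = 1) : (μ : Measure FourShift) = Measure.dirac ptOne
        := by
  apply eq_dirac_of_ae_eq
  have hall : ∀ᵐ ξ ∂(μ : Measure FourShift), ∀ j : ℕ, (shift^[j] ξ) 0 = 1 :=
    ae_all_iff.2 fun j => (MeasurePreserving.iterate hμ j).quasiMeasurePreserving.ae h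
  filter_upwards [hall] with ξ hξ
  funext j
  have := hξ j
  rwa [shift_iterate_apply, zero_add] at this

/-! ### Localized entropy of the potential at the origin -/

namespace Params

variable (D : Params)

/-- The potential as a continuous map. -/
noncomputable def potentialMap : C(FourShift, EuclideanSpace ℝ (Fin 2)) :=
  ⟨D.potential, D.continuous_potential⟩

lemma ptOne_mem_symOne (j : ℕ) : ptOne j ∈ symOne := mem_symOne.2 (Or.inr rfl)

lemma potential_ptOne : D.potential ptOne = 0 := D.potential_never (Or.inl ptOne_mem_symOne)

lemma zero_mem_rotationSet : 0 ∈ rotationSet shift D.potential :=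
  ⟨diracOne, diracOne_mem, by rw [rotationVector_diracOne, potential_ptOne]⟩

lemma rotationVector_zero_nonneg (μ : ProbabilityMeasure FourShift) :
    0 ≤ rotationVector D.potential μ 0 :=
  integral_nonneg fun ξ => D.potential_zero_nonneg ξ

lemma ae_never_of_rotationVector {μ : ProbabilityMeasure FourShift}
    (h : rotationVector D.potential μ 0 = 0) :
    ∀ᵐ ξ ∂(μ : Measure FourShift), (∀ j, ξ j ∈ symOne) ∨ ∀ j, ξ j ∈ symTwo := by
  rw [rotationVector_apply, integral_eq_zero_iff_of_nonneg (fun ξ => D.potential_zero_nonneg ξ)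
    (integrable_coord D.continuous_potential _ 0)] at h
  filter_upwards [h] with ξ hξ using D.never_of_potential_zero_eq hξ

/-- A vanishing mean of the non-negative first coordinate forces the measure onto `Y₁(∞) ∪ Y₂(∞)`,
where both coordinates vanish. This makes the origin exposed by `-z₀`. -/
lemma rotationVector_eq_zero {μ : ProbabilityMeasure FourShift}
    (h : rotationVector D.potential μ 0 = 0) : rotationVector D.potential μ = 0 := by
  have hae := D.ae_never_of_rotationVector h
  ext i
  rw [rotationVector_apply, integral_congr_ae (g := fun _ => 0)]
  · simp
  · filter_upwards [hae] with ξ hξ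
    rw [D.potential_never hξ]
    rfl

lemma zero_mem_exposedPoints : 0 ∈ (rotationSet shift D.potential).exposedPoints ℝ := by
  refine ⟨D.zero_mem_rotationSet, -EuclideanSpace.proj 0, ?_⟩
  rintro _ ⟨μ, hμ, rfl⟩
  have h0 := D.rotationVector_zero_nonneg μ
  simp only [neg_apply, PiLp.proj_apply, PiLp.zero_apply, neg_zero, Left.neg_nonpos_iff,
    Left.nonneg_neg_iff]
  exact ⟨h0, fun h => D.rotationVector_eq_zero (le_antisymm h h0)⟩

lemma zero_mem_frontier : 0 ∈ frontier (rotationSet shift D.potential) := by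
  refine ⟨subset_closure D.zero_mem_rotationSet, fun hint => ?_⟩
  -- The points `(-t, 0)` with `t > 0` approach the origin from outside the rotation set.
  have hc : Tendsto (fun t : ℝ => (!₂[-t, 0] : EuclideanSpace ℝ (Fin 2))) (𝓝 0) (𝓝 0) := by
    have : Continuous fun t : ℝ => (!₂[-t, 0] : EuclideanSpace ℝ (Fin 2)) := by fun_prop
    have h := this.tendsto 0
    have e : (!₂[-0, 0] : EuclideanSpace ℝ (Fin 2)) = 0 := by ext i; fin_cases i <;> simp
    rwa [e] at h
  have hev := hc.eventually (mem_interior_iff_mem_nhds.1 hint)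
  obtain ⟨t, ht, ht0⟩ := ((hev.filter_mono nhdsWithin_le_nhds).and
    (self_mem_nhdsWithin (a := (0 : ℝ)) (s := Ioi 0))).exists
  obtain ⟨μ, -, hμ⟩ := ht
  have h0 := D.rotationVector_zero_nonneg μ
  rw [hμ] at h0
  simp at h0
  exact absurd ht0 (not_lt.2 h0)

lemma potential_of_switches {ξ : FourShift} (h : switches ξ = true) : D.potential ξ 0 = D.a := by
  obtain ⟨h1, h2⟩ := not_prefix_of_switches h (by have := D.lam_ge; omega : 2 ≤ D.lam)
  rw [D.potential_out h1 h2]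
  rfl

lemma localizedEntropy_zero :
    localizedEntropy shift D.potential 0 = ((Real.log 2 : ℝ) : EReal) := by
  apply le_antisymm
  · refine iSup₂_le fun μ hμ => ?_
    have h := measureReal_switches_le D.continuous_potential D.potential_zero_nonneg
      (fun ξ => D.potential_of_switches) μ
    rw [hμ.2, PiLp.zero_apply] at h
    have h0 : (μ : Measure FourShift).real {ξ | switches ξ = true} = 0 :=
      le_antisymm (nonpos_of_mul_nonpos_right h D.a_pos) measureReal_nonneg
    have := entropy_le_switchBound μ hμ.1
    rwa [h0, switchBound_zero] at this
  · refine log_two_le_entropy_bernoulli.trans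
      (le_iSup₂_of_le bernoulliPM ⟨bernoulliPM_mem, ?_⟩ le_rfl)
    apply D.rotationVector_eq_zero
    rw [rotationVector_apply, integral_congr_ae (g := fun _ => 0)]
    · simp
    · filter_upwards [bernoulli_symOne] with ξ hξ
      rw [D.potential_never (Or.inl hξ)]
      rfl

/-! ### The approximating potentials -/

variable {D} {K : ℕ}

lemma continuous_approx (hK : D.lam ≤ K) : Continuous (D.approx K) :=
  (D.isLocallyConstant_approx hK).continuous

/-- Exits at positions `m < K` have the larger value `x_{m+1-λ}`, and `a` exceeds all `x_k`, so the
minimum is attained only by points that stay in one symbol set up to time `K`. -/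
lemma le_approx_zero (hK : D.lam ≤ K) (ξ : FourShift) :
    D.x (K + 1 - D.lam) ≤ D.approx K ξ 0 ∧ (D.approx K ξ 0 = D.x (K + 1 - D.lam) →
      (∀ j < K, ξ j ∈ symOne) ∨ ∀ j < K, ξ j ∈ symTwo) := by
  classical
  have hl := D.lam_pos
  have hs := D.x_lt (by omega : 1 ≤ K + 1 - D.lam)
  have hlt : ∀ m, D.lam ≤ m → m < K → D.x (K + 1 - D.lam) < D.x (m + 1 - D.lam) :=
    fun m h1 h2 => D.x_anti (mem_Ici.2 (by omega)) (mem_Ici.2 (by omega)) (by omega)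
  have exit_lt : ∀ {S : Set (Fin 4)} {m : ℕ}, (¬ ∀ j < K, ξ j ∈ S) → (∀ j < m, ξ j ∈ S) →
      m < K := fun h1 h2 => by
    by_contra hc
    exact h1 fun j hj => h2 j (by omega)
  rcases D.approx_cases (by omega : 0 < K) ξ with ⟨h, ha, -⟩ | ⟨h, ha, -⟩ | ⟨h1, h2, h⟩
  · exact ⟨ha.ge, fun _ => Or.inl h⟩
  · exact ⟨ha.ge, fun _ => Or.inr h⟩
  · have key : D.x (K + 1 - D.lam) < D.approx K ξ 0 := by
      rw [h]
      rcases D.trichotomy ξ with h' | h' | ⟨m, hm, h'⟩ | ⟨m, hm, h'⟩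
      · rw [D.potential_out h'.1 h'.2]; exact hs
      · rcases h' with h' | h'
        · exact absurd (fun j _ => h' j) h1
        · exact absurd (fun j _ => h' j) h2
      · rw [D.potential_exit_one hm h']; exact hlt m hm (exit_lt h1 h'.1)
      · rw [D.potential_exit_two hm h']; exact hlt m hm (exit_lt h2 h'.1)
    exact ⟨key.le, fun he => absurd he key.ne'⟩

lemma approx_zero_nonneg (hK : D.lam ≤ K) (ξ : FourShift) : 0 ≤ D.approx K ξ 0 :=
  (D.x_pos (by omega)).le.trans (le_approx_zero hK ξ).1

lemma approx_of_switches (hK : D.lam ≤ K) {ξ : FourShift} (h : switches ξ = true) :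
    D.approx K ξ 0 = D.a := by
  have hl := D.lam_ge
  rw [D.approx_out (not_or.2 (not_prefix_of_switches h (by omega))), D.potential_of_switches h]

/-- The rotation class of `p_{K+1-λ}` for the approximating potential is the Dirac measure. -/
lemma eq_dirac_of_rotationVector_approx (hK : D.lam ≤ K) {μ : ProbabilityMeasure FourShift}
    (hμ : μ ∈ invariantMeasures shift)
    (h : rotationVector (D.approx K) μ = D.curvePoint (K + 1 - D.lam)) :
    (μ : Measure FourShift) = Measure.dirac ptOne := by
  have hl := D.lam_pos
  have hs := D.x_mem (K + 1 - D.lam) (by omega)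
  have he := D.ell_pos ⟨hs.1, hs.2.le⟩
  have hi := integrable_coord (continuous_approx hK) (μ : Measure FourShift)
  -- The mean of the first coordinate equals its minimum, so the minimum is attained almost
  -- everywhere.
  have h0 : ∫ ξ, (D.approx K ξ 0 - D.x (K + 1 - D.lam)) ∂(μ : Measure FourShift) = 0 := by
    rw [integral_sub (hi 0) (integrable_const _), ← rotationVector_apply, h]
    simp [curvePoint]
  rw [integral_eq_zero_iff_of_nonneg (fun ξ => sub_nonneg.2 (le_approx_zero hK ξ).1)
    ((hi 0).sub (integrable_const _))] at h0
  have hcases : ∀ᵐ ξ ∂(μ : Measure FourShift), D.approx K ξ 1 ≤ D.ell (D.x (K + 1 - D.lam)) ∧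
      (D.approx K ξ 1 = D.ell (D.x (K + 1 - D.lam)) → ∀ j < K, ξ j = 1) := by
    filter_upwards [h0] with ξ hξ
    have hY := (le_approx_zero hK ξ).2 (sub_eq_zero.1 hξ)
    rcases D.approx_cases (by omega : 0 < K) ξ with ⟨-, -, hb⟩ | ⟨-, -, hb⟩ | ⟨h1, h2, -⟩
    · rcases hb with ⟨hb, hv⟩ | ⟨-, hv⟩ <;> rw [hv]
      · exact ⟨le_rfl, fun _ => hb⟩
      · exact ⟨he.le, fun hc => absurd hc he.ne⟩
    · rcases hb with ⟨-, hv⟩ | ⟨-, hv⟩ <;> rw [hv] <;>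
        exact ⟨by linarith, fun hc => by linarith⟩
    · exact absurd hY (not_or.2 ⟨h1, h2⟩)
  -- On that set the second coordinate has its maximum as mean, so almost every point begins with
  -- `1⋯1`.
  have h1 : ∫ ξ, (D.ell (D.x (K + 1 - D.lam)) - D.approx K ξ 1) ∂(μ : Measure FourShift) = 0 := by
    rw [integral_sub (integrable_const _) (hi 1), ← rotationVector_apply, h]
    simp [curvePoint]
  rw [integral_eq_zero_iff_of_nonneg_ae (hcases.mono fun ξ hξ => sub_nonneg.2 hξ.1)
    ((integrable_const _).sub (hi 1))] at h1
  refine eq_diracOne hμ ?_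
  filter_upwards [hcases, h1] with ξ hξ hξ'
  exact hξ.2 (sub_eq_zero.1 hξ').symm 0 (by omega)

lemma curvePoint_mem_rotationSet_approx :
    D.curvePoint (K + 1 - D.lam) ∈ rotationSet shift (D.approx K) :=
  ⟨diracOne, diracOne_mem, by rw
      [rotationVector_diracOne, D.approx_cyl_one (ξ := ptOne) fun _ _ => rfl]⟩

lemma localizedEntropy_approx (hK : D.lam ≤ K) :
    localizedEntropy shift (D.approx K) (D.curvePoint (K + 1 - D.lam)) = 0 := by
  apply le_antisymm
  · refine iSup₂_le fun μ hμ => ?_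
    rw [eq_dirac_of_rotationVector_approx hK hμ.1 hμ.2]
    exact entropy_dirac _ _
  · exact localizedEntropy_nonneg curvePoint_mem_rotationSet_approx

lemma minLocalEntropy_approx (hK : D.lam ≤ K) {r : ℝ} (hr : ‖D.curvePoint (K + 1 - D.lam)‖ ≤ r) :
    minLocalEntropy shift (D.approx K) 0 r = 0 := by
  have hmem : D.curvePoint (K + 1 - D.lam) ∈
      Metric.closedBall 0 r ∩ rotationSet shift (D.approx K) :=
    ⟨mem_closedBall_zero_iff.2 hr, curvePoint_mem_rotationSet_approx⟩
  rw [minLocalEntropy, if_pos ⟨_, hmem⟩]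
  apply le_antisymm
  · exact (iInf₂_le _ hmem).trans (localizedEntropy_approx hK).le
  · exact le_iInf₂ fun w hw => localizedEntropy_nonneg hw.2

lemma norm_rotationVector_bernoulli_le (hK : D.lam ≤ K) :
    ‖rotationVector (D.approx K) bernoulliPM‖ ≤ ‖D.curvePoint (K + 1 - D.lam)‖ := by
  have hl := D.lam_pos
  have hs := D.x_pos (by omega : 1 ≤ K + 1 - D.lam)
  have he := D.ell_x_nonneg (by omega : 1 ≤ K + 1 - D.lam)
  have hbound : ∀ᵐ ξ ∂bernoulli, ‖D.approx K ξ 0‖ ≤ D.x (K + 1 - D.lam) ∧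
      ‖D.approx K ξ 1‖ ≤ D.ell (D.x (K + 1 - D.lam)) := by
    filter_upwards [bernoulli_symOne] with ξ hξ
    rcases D.approx_cases (by omega : 0 < K) ξ with ⟨-, ha, hb⟩ | ⟨-, ha, hb⟩ | ⟨h1, -, -⟩
    · rw [ha, Real.norm_of_nonneg hs.le]
      rcases hb with ⟨-, hb⟩ | ⟨-, hb⟩ <;> rw [hb, Real.norm_eq_abs] <;> simp [abs_of_nonneg, he]
    · rw [ha, Real.norm_of_nonneg hs.le]
      rcases hb with ⟨-, hb⟩ | ⟨-, hb⟩ <;> rw [hb, Real.norm_eq_abs] <;> simp [abs_of_nonneg, he]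
    · exact absurd (fun j _ => hξ j) h1
  apply D.norm_le_norm_curvePoint
  · have h := norm_integral_le_of_norm_le_const (hbound.mono fun ξ hξ => hξ.1)
    rw [probReal_univ, mul_one] at h
    exact h
  · have h := norm_integral_le_of_norm_le_const (hbound.mono fun ξ hξ => hξ.2)
    rw [probReal_univ, mul_one] at h
    exact h

lemma log_two_le_maxLocalEntropy (hK : D.lam ≤ K) {r : ℝ}
    (hr : ‖D.curvePoint (K + 1 - D.lam)‖ ≤ r) :
    ((Real.log 2 : ℝ) : EReal) ≤ maxLocalEntropy shift (D.approx K) 0 r := by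
  have hmem : rotationVector (D.approx K) bernoulliPM ∈
      Metric.closedBall 0 r ∩ rotationSet shift (D.approx K) :=
    ⟨mem_closedBall_zero_iff.2 ((norm_rotationVector_bernoulli_le hK).trans hr),
      bernoulliPM, bernoulliPM_mem, rfl⟩
  rw [maxLocalEntropy, if_pos ⟨_, hmem⟩]
  exact log_two_le_entropy_bernoulli.trans (le_iSup₂_of_le _ hmem
    (le_iSup₂_of_le bernoulliPM ⟨bernoulliPM_mem, rfl⟩ le_rfl))

/-- A rotation vector of norm at most `r` has first coordinate at most `r`, so its measures switch
with frequency at most `r / a`. -/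
lemma maxLocalEntropy_le (hK : D.lam ≤ K) {r : ℝ} (hr : ‖D.curvePoint (K + 1 - D.lam)‖ ≤ r)
    {z : ℝ} (hz : ∀ t, 0 ≤ t → t ≤ r / D.a → switchBound t ≤ z) :
    maxLocalEntropy shift (D.approx K) 0 r ≤ (z : EReal) := by
  have hmem : D.curvePoint (K + 1 - D.lam) ∈
      Metric.closedBall 0 r ∩ rotationSet shift (D.approx K) :=
    ⟨mem_closedBall_zero_iff.2 hr, curvePoint_mem_rotationSet_approx⟩
  rw [maxLocalEntropy, if_pos ⟨_, hmem⟩]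
  refine iSup₂_le fun w hw => iSup₂_le fun μ hμ => ?_
  refine (entropy_le_switchBound μ hμ.1).trans ?_
  rw [EReal.coe_le_coe_iff]
  refine hz _ measureReal_nonneg ?_
  rw [le_div_iff₀ D.a_pos, mul_comm]
  refine (measureReal_switches_le (continuous_approx hK) (approx_zero_nonneg hK)
    (fun ξ => approx_of_switches hK) μ).trans ?_
  rw [hμ.2]
  exact (le_abs_self _).trans ((PiLp.norm_apply_le w 0).trans (mem_closedBall_zero_iff.1 hw.1))

variable {K : ℕ → ℕ}

lemma IsCutoff.lam_le (hK : D.IsCutoff K) (n : ℕ) : D.lam ≤ K n := by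
  have := (hK n).1; omega

lemma IsCutoff.norm_lt (hK : D.IsCutoff K) (n : ℕ) :
    ‖D.curvePoint (K n + 1 - D.lam)‖ < (1 / 2 : ℝ) ^ n :=
  (hK n).2.1 (K n + 1) (by omega)

/-- The approximating potentials as continuous maps. -/
noncomputable def approxMap (hK : D.IsCutoff K) (n : ℕ) : C(FourShift, EuclideanSpace ℝ (Fin 2)) :=
  ⟨D.approx (K n), continuous_approx (hK.lam_le n)⟩

lemma norm_approxMap_sub_lt (hK : D.IsCutoff K) (n : ℕ) :
    ‖approxMap hK n - D.potentialMap‖ < (1 / 2 : ℝ) ^ n :=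
  ((ContinuousMap.norm_le _ (norm_nonneg _)).2 fun ξ =>
    D.norm_approx_sub_le (hK.lam_le n) ξ).trans_lt (hK.norm_lt n)

lemma tendsto_half_pow : Tendsto (fun n : ℕ => (1 / 2 : ℝ) ^ n) atTop (𝓝 0) :=
  tendsto_pow_atTop_nhds_zero_of_lt_one (by norm_num) (by norm_num)

lemma tendsto_approxMap (hK : D.IsCutoff K) :
    Tendsto (approxMap hK) atTop (𝓝 D.potentialMap) :=
  tendsto_iff_norm_sub_tendsto_zero.2 (squeeze_zero (fun _ => norm_nonneg _)
    (fun n => (norm_approxMap_sub_lt hK n).le) tendsto_half_pow)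

lemma tendsto_maxLocalEntropy (hK : D.IsCutoff K) :
    Tendsto (fun n => maxLocalEntropy shift (approxMap hK n) 0 ((1 / 2 : ℝ) ^ n)) atTop
      (𝓝 ((Real.log 2 : ℝ) : EReal)) := by
  refine tendsto_order.2 ⟨fun c hc => Eventually.of_forall fun n =>
    hc.trans_le (log_two_le_maxLocalEntropy (hK.lam_le n) (hK.norm_lt n).le), fun c hc => ?_⟩
  obtain ⟨z, hz, hzc⟩ := EReal.lt_iff_exists_real_btwn.1 hc
  rw [EReal.coe_lt_coe_iff, ← switchBound_zero] at hz
  obtain ⟨δ, hδ, hball⟩ := Metric.eventually_nhds_iff.1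
    (continuous_switchBound.continuousAt.eventually_lt_const hz)
  have h : Tendsto (fun n : ℕ => (1 / 2 : ℝ) ^ n / D.a) atTop (𝓝 0) := by
    simpa using tendsto_half_pow.div_const D.a
  filter_upwards [h.eventually (gt_mem_nhds hδ)] with n hn
  refine (maxLocalEntropy_le (hK.lam_le n) (hK.norm_lt n).le fun t ht0 ht => ?_).trans_lt hzc
  refine (hball ?_).le
  rw [Real.dist_eq, sub_zero, abs_of_nonneg ht0]
  exact ht.trans_lt hn

/-- Along the pairs consisting of the truncations and their points `p_{K+1-λ}` the entropy is `0`,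
while it is `log 2` at the limit. -/
lemma not_continuousWithinAt_localizedEntropy (D : Params) :
    ¬ ContinuousWithinAt
      (fun p : C(FourShift, EuclideanSpace ℝ (Fin 2)) × EuclideanSpace ℝ (Fin 2) =>
        localizedEntropy shift p.1 p.2)
      {p | p.2 ∈ rotationSet shift p.1} (D.potentialMap, 0) := by
  intro h
  obtain ⟨K, hK⟩ := D.exists_isCutoff
  have hw : Tendsto (fun n => D.curvePoint (K n + 1 - D.lam)) atTop (𝓝 0) :=
    squeeze_zero_norm (fun n => (hK.norm_lt n).le) tendsto_half_pow
  have hseq : Tendsto (fun n => (approxMap hK n, D.curvePoint (K n + 1 - D.lam))) atTop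
      (𝓝[{p | p.2 ∈ rotationSet shift p.1}] (D.potentialMap, 0)) :=
    tendsto_nhdsWithin_iff.2 ⟨(tendsto_approxMap hK).prodMk_nhds hw,
      Eventually.of_forall fun n => curvePoint_mem_rotationSet_approx⟩
  have h1 := Tendsto.comp h hseq
  have h2 : (fun n => localizedEntropy shift (approxMap hK n)
      (D.curvePoint (K n + 1 - D.lam))) = fun _ => 0 :=
    funext fun n => localizedEntropy_approx (hK.lam_le n)
  change Tendsto (fun n => localizedEntropy shift (approxMap hK n)
    (D.curvePoint (K n + 1 - D.lam))) atTop (𝓝 (localizedEntropy shift D.potential 0)) at h1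
  rw [h2] at h1
  have h3 := tendsto_nhds_unique h1 tendsto_const_nhds
  rw [D.localizedEntropy_zero, EReal.coe_eq_zero] at h3
  exact (Real.log_pos one_lt_two).ne' h3

end Params

/-! ### Convex hulls and their faces -/

section Hull

variable {E : Type*} [NormedAddCommGroup E] [NormedSpace ℝ E]

lemma le_of_mem_convexHull {S : Set E} {φ : E →L[ℝ] ℝ} {M : ℝ} (h : ∀ g ∈ S, φ g ≤ M) {z : E}
    (hz : z ∈ convexHull ℝ S) : φ z ≤ M :=
  convexHull_min (t := {z | φ z ≤ M}) h (convex_halfSpace_le φ.isLinear M) hz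

/-- The face of a convex hull where a functional attains its maximum is generated by generators. -/
lemma mem_convexHull_face {S : Set E} {φ : E →L[ℝ] ℝ} {M : ℝ} (h : ∀ g ∈ S, φ g ≤ M) {z : E}
    (hz : z ∈ convexHull ℝ S) (hzM : φ z = M) : z ∈ convexHull ℝ {g ∈ S | φ g = M} := by
  have hH : ∀ y ∈ convexHull ℝ {g ∈ S | φ g = M}, φ y ≤ M := fun y hy =>
    le_of_mem_convexHull (fun g hg => hg.2.le) hy
  -- The open half-space `φ < M` together with the hull of the maximal generators is convex and
  -- contains `S`, hence contains the whole hull.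
  have hconv : Convex ℝ {y | φ y < M ∨ y ∈ convexHull ℝ {g ∈ S | φ g = M}} := by
    have key : ∀ x y : E, ∀ a b : ℝ, φ x < M → φ y ≤ M → 0 < a → 0 ≤ b → a + b = 1 →
        φ (a • x + b • y) < M := fun x y a b hx hy ha hb hab => by
      rw [map_add, map_smul, map_smul, smul_eq_mul, smul_eq_mul]
      have h1 := mul_lt_mul_of_pos_left hx ha
      have h2 := mul_le_mul_of_nonneg_left hy hb
      have h3 : a * M + b * M = M := by rw [← add_mul, hab, one_mul]
      linarith
    have le : ∀ y, (φ y < M ∨ y ∈ convexHull ℝ {g ∈ S | φ g = M}) → φ y ≤ M :=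
      fun y hy => hy.elim le_of_lt (hH y)
    intro x hx y hy a b ha hb hab
    rcases ha.eq_or_lt with rfl | ha
    · rw [zero_add] at hab; subst hab; simpa using hy
    rcases hb.eq_or_lt with rfl | hb
    · rw [add_zero] at hab; subst hab; simpa using hx
    rcases hx with hx | hx
    · exact Or.inl (key x y a b hx (le y hy) ha hb.le hab)
    rcases hy with hy | hy
    · left
      rw [add_comm] at hab ⊢
      exact key y x b a hy (hH x hx) hb ha.le hab
    · exact Or.inr (convex_convexHull ℝ _ hx hy ha.le hb.le hab)
  have hsub : S ⊆ {y | φ y < M ∨ y ∈ convexHull ℝ {g ∈ S | φ g = M}} := fun g hg =>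
    (h g hg).lt_or_eq.imp id fun he => subset_convexHull ℝ _ ⟨hg, he⟩
  exact (convexHull_min hsub hconv hz).resolve_left hzM.not_lt

lemma mem_extremePoints_convexHull {S : Set E} {φ : E →L[ℝ] ℝ} {p : E} (hp : p ∈ S)
    (h : ∀ g ∈ S, g ≠ p → φ g < φ p) : p ∈ (convexHull ℝ S).extremePoints ℝ := by
  have hle : ∀ g ∈ S, φ g ≤ φ p := fun g hg => by
    rcases eq_or_ne g p with rfl | hne
    · exact le_rfl
    · exact (h g hg hne).le
  refine exposedPoints_subset_extremePoints ⟨subset_convexHull ℝ _ hp, φ, fun y hy =>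
    ⟨le_of_mem_convexHull hle hy, fun hy' => ?_⟩⟩
  have hface := mem_convexHull_face hle hy (le_antisymm (le_of_mem_convexHull hle hy) hy')
  have hsub : {g ∈ S | φ g = φ p} ⊆ {p} := fun g hg => by
    by_contra hne
    exact (h g hg.1 hne).ne hg.2
  simpa using convexHull_mono hsub hface

/-- At an interior maximum the derivative of `φ`, which is `φ` itself, would vanish. -/
lemma notMem_interior_of_le {K : Set E} {φ : E →L[ℝ] ℝ} (hφ : φ ≠ 0) {z : E}
    (h : ∀ y ∈ K, φ y ≤ φ z) : z ∉ interior K := fun hz =>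
  hφ (IsLocalMax.hasFDerivAt_eq_zero
    (Filter.eventually_of_mem (mem_interior_iff_mem_nhds.1 hz) h) φ.hasFDerivAt)

/-- In finite dimension the convex hull of a compact set is compact. -/
lemma isCompact_convexHull_of_finiteDimensional [FiniteDimensional ℝ E] {S : Set E}
    (hS : IsCompact S) : IsCompact (convexHull ℝ S) := by
  classical
  rcases S.eq_empty_or_nonempty with rfl | ⟨s₀, hs₀⟩
  · simp
  -- Carathéodory: `dim + 1` points suffice, so the hull is a continuous image of simplex × `S^N`.
  set N := Module.finrank ℝ E + 1
  let F : (Fin N → ℝ) × (Fin N → E) → E := fun p => ∑ j, p.1 j • p.2 j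
  have hF : Continuous F := by fun_prop
  have hcpt : IsCompact (stdSimplex ℝ (Fin N) ×ˢ univ.pi fun _ : Fin N => S) :=
    (isCompact_stdSimplex ℝ (Fin N)).prod (isCompact_univ_pi fun _ => hS)
  convert hcpt.image hF
  apply subset_antisymm
  · intro x hx
    obtain ⟨ι, _, z, w, hz, hind, hw, hw1, rfl⟩ := eq_pos_convex_span_of_mem_convexHull hx
    have hcard : Fintype.card ι ≤ Fintype.card (Fin N) := by
      rw [Fintype.card_fin]
      exact hind.card_le_finrank_succ.trans (Nat.succ_le_succ (Submodule.finrank_le _))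
    obtain ⟨e⟩ := Function.Embedding.nonempty_of_card_le hcard
    -- Shorter combinations are padded with weight `0` at the arbitrary point `s₀`.
    refine ⟨(Function.extend e w 0, Function.extend e z fun _ => s₀), ⟨⟨fun j => ?_, ?_⟩, ?_⟩, ?_⟩
    · by_cases hj : ∃ i, e i = j
      · obtain ⟨i, rfl⟩ := hj
        simp only [e.injective.extend_apply]
        exact (hw i).le
      · simp only [Function.extend_apply' _ _ _ hj]
        exact le_rfl
    · rw [← hw1]
      exact (Fintype.sum_of_injective e e.injective w (Function.extend e w 0)
        (fun j hj => Function.extend_apply' w (0 : Fin N → ℝ) j hj)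
        fun i => (e.injective.extend_apply w 0 i).symm).symm
    · intro j _
      by_cases hj : ∃ i, e i = j
      · obtain ⟨i, rfl⟩ := hj
        simp only [e.injective.extend_apply]
        exact hz ⟨i, rfl⟩
      · simp only [Function.extend_apply' _ _ _ hj]
        exact hs₀
    · refine (Fintype.sum_of_injective e e.injective _ _ (fun j hj => ?_) fun i => ?_).symm
      · simp only [Function.extend_apply' w (0 : Fin N → ℝ) j hj, Pi.zero_apply, zero_smul]
      · simp only [e.injective.extend_apply]
  · rintro _ ⟨⟨w, z⟩, ⟨hw, hz⟩, rfl⟩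
    exact (convex_convexHull ℝ S).sum_mem (fun j _ => hw.1 j) hw.2
      fun j _ => subset_convexHull ℝ _ (hz j trivial)

end Hull

/-! ### Polygons with infinitely many vertices -/

/-- Twice the signed area of the triangle `A B C`. -/
def orient (A B C : EuclideanSpace ℝ (Fin 2)) : ℝ :=
  (B 0 - A 0) * (C 1 - A 1) - (B 1 - A 1) * (C 0 - A 0)

lemma orient_rotate (A B C : EuclideanSpace ℝ (Fin 2)) : orient B C A = orient A B C := by
  unfold orient; ring

lemma orient_swap (A B C : EuclideanSpace ℝ (Fin 2)) : orient A C B = -orient A B C := by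
  unfold orient; ring

/-- The functional `z ↦ p z₀ + q z₁`. -/
noncomputable def planeFunctional (p q : ℝ) : EuclideanSpace ℝ (Fin 2) →L[ℝ] ℝ :=
  p • EuclideanSpace.proj 0 + q • EuclideanSpace.proj 1

@[simp]
lemma planeFunctional_apply (p q : ℝ) (z : EuclideanSpace ℝ (Fin 2)) :
    planeFunctional p q z = p * z 0 + q * z 1 := rfl

lemma exists_eq_planeFunctional (φ : EuclideanSpace ℝ (Fin 2) →L[ℝ] ℝ) :
    ∃ p q, φ = planeFunctional p q := by
  refine ⟨φ !₂[1, 0], φ !₂[0, 1], ContinuousLinearMap.ext fun z => ?_⟩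
  have hz : z = z 0 • !₂[1, 0] + z 1 • !₂[0, 1] := by ext i; fin_cases i <;> simp
  conv_lhs => rw [hz]
  rw [map_add, map_smul, map_smul, planeFunctional_apply, smul_eq_mul, smul_eq_mul]
  ring

/-- The functional that is constant on the lines parallel to `A B`, and increasing to the right of
them. -/
noncomputable def edgeFunctional (A B : EuclideanSpace ℝ (Fin 2)) :
    EuclideanSpace ℝ (Fin 2) →L[ℝ] ℝ :=
  planeFunctional (B 1 - A 1) (A 0 - B 0)

lemma edgeFunctional_apply (A B z : EuclideanSpace ℝ (Fin 2)) :
    edgeFunctional A B z = edgeFunctional A B A - orient A B z := by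
  simp only [edgeFunctional, planeFunctional_apply, orient]; ring

/-- A sequence of points of the right half-plane in strictly convex position that accumulates at
the origin only, and does so tangentially to the vertical axis. -/
structure IsConvexChain (v : ℤ → EuclideanSpace ℝ (Fin 2)) : Prop where
  orient_pos : ∀ {i j k}, i < j → j < k → 0 < orient (v i) (v j) (v k)
  tendsto : Tendsto v cofinite (𝓝 0)
  pos : ∀ n, 0 < v n 0
  smooth : ∀ p q : ℝ, (∀ n, p * v n 0 + q * v n 1 ≤ 0) → q = 0

namespace IsConvexChain

variable {v : ℤ → EuclideanSpace ℝ (Fin 2)} (hv : IsConvexChain v)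
include hv

lemma injective : Function.Injective v := by
  have key : ∀ i j, i < j → v i ≠ v j := fun i j hij h => by
    have := hv.orient_pos hij (lt_add_one j)
    rw [h] at this
    simp [orient] at this
  intro i j h
  rcases lt_trichotomy i j with hij | hij | hij
  · exact absurd h (key i j hij)
  · exact hij
  · exact absurd h.symm (key j i hij)

lemma zero_notMem_range : 0 ∉ range v := by
  rintro ⟨n, hn⟩
  have := hv.pos n
  rw [hn] at this
  simp at this

lemma isCompact_hull : IsCompact (convexHull ℝ (insert 0 (range v))) :=
  isCompact_convexHull_of_finiteDimensional hv.tendsto.isCompact_insert_range_of_cofinite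

/-- A line through the origin that supports the chain must be vertical, and the vertical axis meets
no `v n`. -/
lemma eq_zero_of_nonpos {p q : ℝ} (h : ∀ n, p * v n 0 + q * v n 1 ≤ 0) {n : ℤ}
    (hn : p * v n 0 + q * v n 1 = 0) : p = 0 ∧ q = 0 := by
  have hq := hv.smooth p q h
  rw [hq, zero_mul, add_zero] at hn
  exact ⟨(mul_eq_zero.1 hn).resolve_right (hv.pos n).ne', hq⟩

lemma orient_edge_pos (n : ℤ) {k : ℤ} (h1 : k ≠ n) (h2 : k ≠ n + 1) :
    0 < orient (v n) (v (n + 1)) (v k) := by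
  rcases lt_or_gt_of_ne h1 with h | h
  · rw [orient_rotate]
    exact hv.orient_pos h (lt_add_one n)
  · exact hv.orient_pos (lt_add_one n) (by omega)

lemma orient_edge_nonneg (n k : ℤ) : 0 ≤ orient (v n) (v (n + 1)) (v k) := by
  by_cases h1 : k = n
  · simp [orient, h1]
  by_cases h2 : k = n + 1
  · rw [h2]; unfold orient; apply le_of_eq; ring
  exact (hv.orient_edge_pos n h1 h2).le

/-- The sign `≥ 0` is a limit along the chain. Equality would put the origin on the line of the
side, whose functional would then be non-positive on the chain and zero at `v n`, hence zero; but it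
is not zero at `v (n + 2)`. -/
lemma orient_edge_zero_pos (n : ℤ) : 0 < orient (v n) (v (n + 1)) 0 := by
  have hcont : Continuous fun z => orient (v n) (v (n + 1)) z := by unfold orient; fun_prop
  have hlim := (hcont.tendsto 0).comp hv.tendsto
  have h0 : 0 ≤ orient (v n) (v (n + 1)) 0 :=
    ge_of_tendsto hlim (Eventually.of_forall fun k => hv.orient_edge_nonneg n k)
  refine h0.lt_of_ne fun he => ?_
  have h1 : ∀ z, (v (n + 1) 1 - v n 1) * z 0 + (v n 0 - v (n + 1) 0) * z 1 =
      -orient (v n) (v (n + 1)) z := by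
    intro z
    simp only [orient, PiLp.zero_apply] at he ⊢
    linear_combination -he
  have h2 := hv.eq_zero_of_nonpos (n := n)
    (fun k => by rw [h1]; exact neg_nonpos.2 (hv.orient_edge_nonneg n k))
    (by rw [h1]; simp [orient])
  have h3 := hv.orient_edge_pos n (k := n + 2) (by omega) (by omega)
  have h4 := h1 (v (n + 2))
  rw [h2.1, h2.2] at h4
  linarith

lemma edgeFunctional_le (n : ℤ) :
    ∀ g ∈ insert 0 (range v), edgeFunctional (v n) (v (n + 1)) g ≤
      edgeFunctional (v n) (v (n + 1)) (v n) := by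
  rintro _ (rfl | ⟨k, rfl⟩) <;> rw [edgeFunctional_apply]
  · linarith [hv.orient_edge_zero_pos n]
  · linarith [hv.orient_edge_nonneg n k]

lemma edgeFunctional_ne_zero (n : ℤ) : edgeFunctional (v n) (v (n + 1)) ≠ 0 := by
  intro h
  have h1 := edgeFunctional_apply (v n) (v (n + 1)) 0
  simp only [h, zero_apply] at h1
  linarith [hv.orient_edge_zero_pos n]

lemma extremePoints_hull :
    (convexHull ℝ (insert 0 (range v))).extremePoints ℝ = insert 0 (range v) := by
  apply subset_antisymm extremePoints_convexHull_subset
  rintro _ (rfl | ⟨n, rfl⟩)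
  · refine mem_extremePoints_convexHull (φ := planeFunctional (-1) 0) (mem_insert _ _) ?_
    rintro _ (rfl | ⟨k, rfl⟩) hne
    · exact absurd rfl hne
    · simpa using hv.pos k
  -- Each of the two sides at `v n` maximises its own functional; their sum is maximal only at the
  -- common vertex.
  · refine mem_extremePoints_convexHull (φ := edgeFunctional (v (n - 1)) (v n) +
      edgeFunctional (v n) (v (n + 1))) (mem_insert_of_mem _ (mem_range_self n)) ?_
    have e : ∀ z, (edgeFunctional (v (n - 1)) (v n) + edgeFunctional (v n) (v (n + 1))) z =
        edgeFunctional (v (n - 1)) (v n) (v (n - 1)) +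
        edgeFunctional (v n) (v (n + 1)) (v n) -
        (orient (v (n - 1)) (v n) z + orient (v n) (v (n + 1)) z) := by
      intro z
      rw [add_apply, edgeFunctional_apply, edgeFunctional_apply (v n)]
      ring
    have e0 : orient (v (n - 1)) (v n) (v n) + orient (v n) (v (n + 1)) (v n) = 0 := by
      unfold orient; ring
    have hz := hv.orient_edge_zero_pos (n - 1)
    have hge := hv.orient_edge_nonneg (n - 1)
    have hgt := fun k => hv.orient_edge_pos (n - 1) (k := k)
    rw [sub_add_cancel] at hz
    simp only [sub_add_cancel] at hge hgt
    rintro _ (rfl | ⟨k, rfl⟩) hne <;> rw [e, e (v n), e0]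
    · linarith [hv.orient_edge_zero_pos n]
    · have hk : k ≠ n := fun h => hne (h ▸ rfl)
      by_cases hk' : k = n - 1
      · linarith [hge k, hv.orient_edge_pos n hk (by omega)]
      · linarith [hgt k hk' hk, hv.orient_edge_nonneg n k]

/-- If `v n` and `v m` lay on a supporting line with a vertex between them, `v (n + 1)` and `v (m +
1)` would lie strictly on opposite sides of it. -/
lemma eq_add_one_of_maximal {p q M : ℝ} (hpq : p ≠ 0 ∨ q ≠ 0)
    (hM : ∀ k, p * v k 0 + q * v k 1 ≤ M) {n m : ℤ} (hnm : n < m)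
    (hn : p * v n 0 + q * v n 1 = M) (hm : p * v m 0 + q * v m 1 = M) : m = n + 1 := by
  by_contra hne
  set s := (v m 0 - v n 0) ^ 2 + (v m 1 - v n 1) ^ 2 with hs
  set κ := q * (v m 0 - v n 0) - p * (v m 1 - v n 1) with hκ
  -- The functional is constant on the line through `v n` and `v m`, so up to the squared length `s`
  -- it is a multiple `κ` of the signed area; the two neighbours force `κ = 0`.
  have hid : ∀ z : EuclideanSpace ℝ (Fin 2),
      s * (p * z 0 + q * z 1 - M) = κ * orient (v n) (v m) z := by
    intro z
    simp only [hs, hκ, orient]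
    linear_combination ((z 0 - v n 0) * (v m 0 - v n 0) + (z 1 - v n 1) * (v m 1 - v n 1)) *
      (hm - hn) + ((v m 0 - v n 0) ^ 2 + (v m 1 - v n 1) ^ 2) * hn
  have h1 := hv.orient_pos hnm (lt_add_one m)
  have h2 := hv.orient_pos (lt_add_one n) (show n + 1 < m by omega)
  rw [← neg_neg (orient (v n) _ _), ← orient_swap] at h2
  have hs0 : 0 ≤ s := by positivity
  have e1 := hid (v (m + 1))
  have e2 := hid (v (n + 1))
  have hκ1 : κ ≤ 0 := by
    have : s * (p * v (m + 1) 0 + q * v (m + 1) 1 - M) ≤ 0 :=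
      mul_nonpos_of_nonneg_of_nonpos hs0 (sub_nonpos.2 (hM _))
    rw [e1] at this
    exact nonpos_of_mul_nonpos_left this h1
  have hκ2 : 0 ≤ κ := by
    have : s * (p * v (n + 1) 0 + q * v (n + 1) 1 - M) ≤ 0 :=
      mul_nonpos_of_nonneg_of_nonpos hs0 (sub_nonpos.2 (hM _))
    rw [e2] at this
    by_contra hneg
    linarith [mul_pos_of_neg_of_neg (not_le.1 hneg) (neg_pos.1 h2)]
  have hκ0 : κ = 0 := le_antisymm hκ1 hκ2
  have hsp : s * p = 0 := by
    simp only [hs, hκ] at hκ0 ⊢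
    linear_combination (v m 0 - v n 0) * (hm - hn) - (v m 1 - v n 1) * hκ0
  have hsq : s * q = 0 := by
    simp only [hs, hκ] at hκ0 ⊢
    linear_combination (v m 1 - v n 1) * (hm - hn) + (v m 0 - v n 0) * hκ0
  have hs1 : s = 0 := by
    rcases hpq with h | h
    · exact (mul_eq_zero.1 hsp).resolve_right h
    · exact (mul_eq_zero.1 hsq).resolve_right h
  have hd0 : v m 0 = v n 0 := by nlinarith [sq_nonneg (v m 0 - v n 0), sq_nonneg (v m 1 - v n 1)]
  have hd1 : v m 1 = v n 1 := by nlinarith [sq_nonneg (v m 0 - v n 0), sq_nonneg (v m 1 - v n 1)]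
  refine hnm.ne' (hv.injective ?_)
  ext i
  fin_cases i
  · exact hd0
  · exact hd1

/-- A maximal face cannot contain both the origin and a vertex, by `eq_zero_of_nonpos`, and any two
vertices on it are adjacent. -/
lemma maximal_subset {p q M : ℝ} (hpq : p ≠ 0 ∨ q ≠ 0)
    (hM : ∀ g ∈ insert 0 (range v), planeFunctional p q g ≤ M) :
    {g ∈ insert 0 (range v) | planeFunctional p q g = M} ⊆ {0} ∨
      ∃ n, {g ∈ insert 0 (range v) | planeFunctional p q g = M} ⊆ {v n, v (n + 1)} := by
  have hM' : ∀ k, p * v k 0 + q * v k 1 ≤ M := fun k =>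
    hM _ (mem_insert_of_mem _ (mem_range_self k))
  by_cases hex : ∃ n, p * v n 0 + q * v n 1 = M
  swap
  · left
    rintro _ ⟨rfl | ⟨k, rfl⟩, hk⟩
    · rfl
    · exact absurd ⟨k, hk⟩ hex
  right
  obtain ⟨n, hn⟩ := hex
  have h0 : planeFunctional p q 0 ≠ M := by
    rintro rfl
    simp only [map_zero] at hM' hn
    have := hv.eq_zero_of_nonpos hM' hn
    tauto
  have step : ∀ m, p * v m 0 + q * v m 1 = M → m = n ∨ m = n + 1 ∨ m = n - 1 := by
    intro m hm
    rcases lt_trichotomy n m with h | h | h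
    · exact Or.inr (Or.inl (hv.eq_add_one_of_maximal hpq hM' h hn hm))
    · exact Or.inl h.symm
    · have := hv.eq_add_one_of_maximal hpq hM' h hm hn
      exact Or.inr (Or.inr (by omega))
  by_cases hprev : p * v (n - 1) 0 + q * v (n - 1) 1 = M
  · refine ⟨n - 1, ?_⟩
    rintro _ ⟨rfl | ⟨k, rfl⟩, hk⟩
    · exact absurd hk h0
    · rw [sub_add_cancel]
      rcases step k hk with rfl | rfl | rfl
      · exact Or.inr rfl
      · have := hv.eq_add_one_of_maximal hpq hM' (by omega) hprev hk
        omega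
      · exact Or.inl rfl
  · refine ⟨n, ?_⟩
    rintro _ ⟨rfl | ⟨k, rfl⟩, hk⟩
    · exact absurd hk h0
    · rcases step k hk with rfl | rfl | rfl
      · exact Or.inl rfl
      · exact Or.inr rfl
      · exact absurd hk hprev

lemma interior_hull_nonempty : (interior (convexHull ℝ (insert 0 (range v)))).Nonempty := by
  rw [interior_convexHull_nonempty_iff_affineSpan_eq_top]
  refine top_unique fun z _ => ?_
  have ho := hv.orient_pos (show (0 : ℤ) < 1 by norm_num) (show (1 : ℤ) < 2 by norm_num)
  have hmem : ∀ k, v k ∈ affineSpan ℝ (insert 0 (range v)) := fun k =>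
    subset_affineSpan ℝ _ (mem_insert_of_mem _ (mem_range_self k))
  -- By Cramer's rule, the coordinates of `z` relative to the triangle `v 0, v 1, v 2` are quotients
  -- of signed areas.
  have h1 := AffineSubspace.smul_vsub_vadd_mem _
    (orient (v 0) z (v 2) / orient (v 0) (v 1) (v 2)) (hmem 1) (hmem 0) (hmem 0)
  have h2 := AffineSubspace.smul_vsub_vadd_mem _
    (orient (v 0) (v 1) z / orient (v 0) (v 1) (v 2)) (hmem 2) (hmem 0) h1
  convert h2
  ext i
  fin_cases i <;>
  · simp only [vsub_eq_sub, vadd_eq_add, PiLp.add_apply, PiLp.smul_apply, PiLp.sub_apply,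
      smul_eq_mul, Fin.zero_eta, Fin.mk_one]
    field_simp
    unfold orient
    ring

/-- A frontier point has a supporting functional, whose maximal face is spanned by generators and
hence is `{0}` or lies in one side. Conversely, sides maximise their edge functional and the origin
maximises `-z₀`. -/
lemma frontier_hull :
    frontier (convexHull ℝ (insert 0 (range v))) =
      insert 0 (⋃ n : ℤ, segment ℝ (v n) (v (n + 1))) := by
  have hcl := hv.isCompact_hull.isClosed
  rw [hcl.frontier_eq]
  apply subset_antisymm
  · rintro z ⟨hz, hzi⟩
    obtain ⟨φ, hφ, hmax⟩ := geometric_hahn_banach_of_nonempty_interior_point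
      (convex_convexHull ℝ _) hzi hv.interior_hull_nonempty
    obtain ⟨p, q, rfl⟩ := exists_eq_planeFunctional φ
    have hpq : p ≠ 0 ∨ q ≠ 0 := by
      by_contra hc
      push Not at hc
      exact hφ (by rw [hc.1, hc.2]; ext; simp)
    have hM := fun g hg => hmax g (subset_convexHull ℝ (insert 0 (range v)) hg)
    have hface := mem_convexHull_face hM hz rfl
    rcases hv.maximal_subset hpq hM with h | ⟨n, h⟩
    · left
      simpa using convexHull_mono h hface
    · right
      have := convexHull_mono h hface
      rw [convexHull_pair] at this
      exact mem_iUnion.2 ⟨n, this⟩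
  · rintro z (rfl | hz)
    · refine ⟨subset_convexHull ℝ _ (mem_insert _ _),
        notMem_interior_of_le (φ := planeFunctional (-1) 0) (fun h => ?_) fun y hy => ?_⟩
      · have := congrArg (fun φ => φ (v 0)) h
        simp only [planeFunctional_apply, zero_apply] at this
        linarith [hv.pos 0]
      · refine le_of_mem_convexHull ?_ hy
        rintro _ (rfl | ⟨k, rfl⟩)
        · exact le_rfl
        · simpa using (hv.pos k).le
    · obtain ⟨n, hn⟩ := mem_iUnion.1 hz
      have hgen : ∀ k, v k ∈ convexHull ℝ (insert 0 (range v)) := fun k =>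
        subset_convexHull ℝ _ (mem_insert_of_mem _ (mem_range_self k))
      refine ⟨(convex_convexHull ℝ _).segment_subset (hgen _) (hgen _) hn,
        notMem_interior_of_le (hv.edgeFunctional_ne_zero n) fun y hy => ?_⟩
      have hzn : edgeFunctional (v n) (v (n + 1)) z = edgeFunctional (v n) (v (n + 1)) (v n) := by
        obtain ⟨a, b, ha, hb, hab, rfl⟩ := hn
        have e : edgeFunctional (v n) (v (n + 1)) (v (n + 1)) =
            edgeFunctional (v n) (v (n + 1)) (v n) := by
          rw [edgeFunctional_apply]; unfold orient; ring
        rw [map_add, map_smul, map_smul, e, ← add_smul, hab, one_smul]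
      rw [hzn]
      exact le_of_mem_convexHull (hv.edgeFunctional_le n) hy

lemma boundaryIsInfinitePolygon :
    BoundaryIsInfinitePolygon (convexHull ℝ (insert 0 (range v))) 0 :=
  ⟨v, hv.injective, hv.zero_notMem_range, hv.tendsto, hv.extremePoints_hull, hv.frontier_hull⟩

lemma isSmoothBoundaryPoint :
    IsSmoothBoundaryPoint (convexHull ℝ (insert 0 (range v))) 0 := by
  refine ⟨subset_convexHull ℝ _ (mem_insert _ _), ?_, !₂[-1, 0], ⟨?_, fun y hy => ?_⟩, ?_⟩
  · rw [hv.frontier_hull]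
    exact mem_insert _ _
  · simp [EuclideanSpace.norm_eq]
  · have h : ∀ g ∈ insert 0 (range v), planeFunctional (-1) 0 g ≤ 0 := by
      rintro _ (rfl | ⟨k, rfl⟩)
      · simp
      · simpa using (hv.pos k).le
    have := le_of_mem_convexHull h hy
    simpa [PiLp.inner_apply] using this
  · rintro u ⟨hu1, hu⟩
    have hn : ∀ n, u 0 * v n 0 + u 1 * v n 1 ≤ 0 := fun n => by
      have := hu (v n) (subset_convexHull ℝ _ (mem_insert_of_mem _ (mem_range_self n)))
      simp only [PiLp.inner_apply, Fin.sum_univ_two, inner_zero_right, RCLike.inner_apply,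
        conj_trivial] at this
      linarith
    have hu2 := hv.smooth _ _ hn
    have h0 : u 0 ≤ 0 := by
      have := hn 0
      rw [hu2, zero_mul, add_zero] at this
      exact nonpos_of_mul_nonpos_left this (hv.pos 0)
    rw [EuclideanSpace.norm_eq, Real.sqrt_eq_one, Fin.sum_univ_two, hu2] at hu1
    simp only [Real.norm_eq_abs, sq_abs, abs_zero, ne_eq, OfNat.ofNat_ne_zero, not_false_eq_true,
      zero_pow, add_zero] at hu1
    have h1 : u 0 = -1 := by
      rcases mul_eq_zero.1 (show (u 0 - 1) * (u 0 + 1) = 0 by linear_combination hu1) with h | h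
          <;> linarith
    ext i
    fin_cases i
    · simpa using h1
    · simpa using hu2

end IsConvexChain

/-! ### Determinants of homogeneous coordinates -/

/-- The determinant of three vectors. -/
def det3 (u v w : ℝ × ℝ × ℝ) : ℝ :=
  u.1 * (v.2.1 * w.2.2 - v.2.2 * w.2.1) - u.2.1 * (v.1 * w.2.2 - v.2.2 * w.1) +
    u.2.2 * (v.1 * w.2.1 - v.2.1 * w.1)

lemma det3_rotate (u v w : ℝ × ℝ × ℝ) : det3 v w u = det3 u v w := by unfold det3; ring

lemma det3_sum_pos {s : Finset ℕ} (hs : s.Nonempty) {h : ℕ → ℝ × ℝ × ℝ} {u v : ℝ × ℝ × ℝ}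
    (hpos : ∀ i ∈ s, 0 < det3 u v (h i)) : 0 < det3 u v (∑ i ∈ s, h i) := by
  have key : det3 u v (∑ i ∈ s, h i) = ∑ i ∈ s, det3 u v (h i) := by
    have h0 : det3 u v 0 = 0 := by simp [det3]
    have hadd : ∀ x y, det3 u v (x + y) = det3 u v x + det3 u v y := fun x y => by
      simp only [det3, Prod.fst_add, Prod.snd_add]; ring
    exact map_sum (AddMonoidHom.mk' (det3 u v) hadd) h s
  rw [key]
  exact Finset.sum_pos hpos hs

/-- Partial sums of a sequence of positively oriented vectors are positively oriented. -/
lemma det3_partialSums_pos {h : ℕ → ℝ × ℝ × ℝ}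
    (hpos : ∀ {r s l}, r < s → s < l → 0 < det3 (h r) (h s) (h l)) {i j k : ℕ} (hij : i < j)
    (hjk : j < k) :
    0 < det3 (∑ r ∈ Finset.range (i + 1), h r) (∑ r ∈ Finset.range (j + 1), h r)
      (∑ r ∈ Finset.range (k + 1), h r) := by
  have e1 := Finset.sum_range_add_sum_Ico h (show i + 1 ≤ j + 1 by omega)
  have e2 := Finset.sum_range_add_sum_Ico h (show j + 1 ≤ k + 1 by omega)
  rw [← e2, ← e1]
  set A := ∑ r ∈ Finset.range (i + 1), h r with hA
  set B := ∑ r ∈ Finset.Ico (i + 1) (j + 1), h r with hB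
  set C := ∑ r ∈ Finset.Ico (j + 1) (k + 1), h r with hC
  -- Row operations reduce the partial sums to sums over three successive blocks of indices;
  -- multilinearity then leaves determinants of triples `r < s < l`.
  have e : det3 A (A + B) (A + B + C) = det3 A B C := by
    simp only [det3, Prod.fst_add, Prod.snd_add]; ring
  rw [e, hC]
  refine det3_sum_pos (Finset.nonempty_Ico.2 (by omega)) fun l hl => ?_
  rw [← det3_rotate, ← det3_rotate, hB]
  refine det3_sum_pos (Finset.nonempty_Ico.2 (by omega)) fun s hs => ?_
  rw [← det3_rotate, ← det3_rotate, hA]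
  refine det3_sum_pos (Finset.nonempty_range_iff.2 (by omega)) fun r hr => ?_
  rw [det3_rotate]
  rw [Finset.mem_Ico] at hl hs
  rw [Finset.mem_range] at hr
  exact hpos (by omega) (by omega)

/-- The reflection in the horizontal axis. -/
def reflect (z : EuclideanSpace ℝ (Fin 2)) : EuclideanSpace ℝ (Fin 2) := !₂[z 0, -z 1]

@[simp] lemma reflect_zero (z : EuclideanSpace ℝ (Fin 2)) : reflect z 0 = z 0 := rfl

@[simp] lemma reflect_one (z : EuclideanSpace ℝ (Fin 2)) : reflect z 1 = -z 1 := rfl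

lemma reflect_reflect (z : EuclideanSpace ℝ (Fin 2)) : reflect (reflect z) = z := by
  ext i; fin_cases i <;> simp [reflect]

lemma orient_reflect (A B C : EuclideanSpace ℝ (Fin 2)) :
    orient (reflect A) (reflect B) (reflect C) = orient B A C := by
  simp only [orient, reflect_zero, reflect_one]; ring

/-! ### Convex position of the periodic averages -/

namespace Params

variable (D : Params)

/-- Strict concavity, for a first point on or below the graph of `ℓ₁`. -/
lemma concave_orient_pos {t₁ t₂ t₃ y : ℝ} (h3 : 0 ≤ t₃) (h32 : t₃ < t₂) (h21 : t₂ < t₁)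
    (h1 : t₁ ≤ D.a) (hy : y ≤ D.ell t₁) :
    0 < (t₁ - t₃) * D.ell t₂ - (t₂ - t₃) * y - (t₁ - t₂) * D.ell t₃ := by
  have h31 : 0 < t₁ - t₃ := by linarith
  have h := D.ell_concave.2 (x := t₁) (y := t₃) ⟨by linarith, h1⟩ ⟨h3, by linarith⟩ (by linarith)
    (div_pos (sub_pos.2 h32) h31) (div_pos (sub_pos.2 h21) h31)
    (by rw [← add_div, div_eq_one_iff_eq h31.ne']; ring)
  have e : ((t₂ - t₃) / (t₁ - t₃)) • t₁ + ((t₁ - t₂) / (t₁ - t₃)) • t₃ = t₂ := by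
    simp only [smul_eq_mul]
    rw [div_mul_eq_mul_div, div_mul_eq_mul_div, ← add_div, div_eq_iff h31.ne']; ring
  rw [e, smul_eq_mul, smul_eq_mul, div_mul_eq_mul_div, div_mul_eq_mul_div, ← add_div,
    div_lt_iff₀ h31] at h
  have := mul_le_mul_of_nonneg_left hy (sub_pos.2 h32).le
  linarith

/-- Homogeneous coordinates of `λ` times `(a, 0)`, followed by the points `p_k`. -/
noncomputable def homog (k : ℕ) : ℝ × ℝ × ℝ :=
  if k = 0 then (D.lam, D.lam * D.a, 0) else (1, D.x k, D.ell (D.x k))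

/-- For positive indices this is strict concavity of `ℓ₁`. For `r = 0` the first point is `(a, 0)`,
which lies on or below the graph, and its weight `λ` only rescales. -/
lemma det3_homog_pos {r s l : ℕ} (hrs : r < s) (hsl : s < l) :
    0 < det3 (D.homog r) (D.homog s) (D.homog l) := by
  have hs : 1 ≤ s := by omega
  have hl := D.x_pos (by omega : 1 ≤ l)
  have hls := D.x_anti (mem_Ici.2 hs) (mem_Ici.2 (by omega)) hsl
  simp only [homog, if_neg (show s ≠ 0 by omega), if_neg (show l ≠ 0 by omega)]
  split_ifs with hr
  · have h := D.concave_orient_pos hl.le hls (D.x_lt hs) le_rfl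
      (D.ell_nonneg _ ⟨D.a_pos.le, le_rfl⟩)
    have hlam : (0 : ℝ) < D.lam := by exact_mod_cast D.lam_pos
    have := mul_pos hlam h
    simp only [det3]
    linarith
  · have h := D.concave_orient_pos hl.le hls
      (D.x_anti (mem_Ici.2 (by omega)) (mem_Ici.2 hs) hrs) (D.x_lt (by omega : 1 ≤ r)).le le_rfl
    simp only [det3]
    linarith

/-- The sums `λ (a, 0) + p_1 + … + p_N` -/
noncomputable def vertexSum (N : ℕ) : EuclideanSpace ℝ (Fin 2) :=
  (D.lam : ℝ) • !₂[D.a, 0] + ∑ i ∈ Finset.range N, D.curvePoint (i + 1)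

/-- The vertices `(λ (a, 0) + p_1 + … + p_N) / (λ + N)`. -/
noncomputable def vertex (N : ℕ) : EuclideanSpace ℝ (Fin 2) :=
  ((D.lam : ℝ) + N)⁻¹ • D.vertexSum N

lemma weight_pos (N : ℕ) : (0 : ℝ) < D.lam + N := by
  have : (0 : ℝ) < D.lam := by exact_mod_cast D.lam_pos
  positivity

lemma smul_vertex (N : ℕ) : ((D.lam : ℝ) + N) • D.vertex N = D.vertexSum N := by
  rw [vertex, smul_inv_smul₀ (D.weight_pos N).ne']

lemma vertexSum_zero_apply (N : ℕ) :
    D.vertexSum N 0 = D.lam * D.a + ∑ i ∈ Finset.range N, D.x (i + 1) := by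
  simp [vertexSum, curvePoint]

lemma vertexSum_one_apply (N : ℕ) :
    D.vertexSum N 1 = ∑ i ∈ Finset.range N, D.ell (D.x (i + 1)) := by
  simp [vertexSum, curvePoint]

lemma sum_homog (N : ℕ) : ∑ r ∈ Finset.range (N + 1), D.homog r =
    ((D.lam : ℝ) + N, (D.lam + N) * D.vertex N 0, (D.lam + N) * D.vertex N 1) := by
  have h0 : (D.lam + N) * D.vertex N 0 = D.vertexSum N 0 := by rw [← D.smul_vertex N]; rfl
  have h1 : (D.lam + N) * D.vertex N 1 = D.vertexSum N 1 := by rw [← D.smul_vertex N]; rfl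
  rw [h0, h1, vertexSum_zero_apply, vertexSum_one_apply]
  induction N with
  | zero => simp [homog]
  | succ N ih =>
    rw [Finset.sum_range_succ, ih, homog, if_neg (Nat.succ_ne_zero N), Finset.sum_range_succ,
      Finset.sum_range_succ, Prod.mk_add_mk, Prod.mk_add_mk]
    · push_cast
      simp only [add_assoc]
    · rw [← D.smul_vertex N]; rfl
    · rw [← D.smul_vertex N]; rfl

/-- The partial sums of `homog` are homogeneous coordinates of the vertices with positive weights `λ
+ N`, so determinant and signed area have the same sign. -/
lemma orient_vertex_pos {i j k : ℕ} (hij : i < j) (hjk : j < k) :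
    0 < orient (D.vertex i) (D.vertex j) (D.vertex k) := by
  have h := det3_partialSums_pos (h := D.homog) D.det3_homog_pos hij hjk
  rw [D.sum_homog, D.sum_homog, D.sum_homog] at h
  have hw := mul_pos (mul_pos (D.weight_pos i) (D.weight_pos j)) (D.weight_pos k)
  refine (mul_pos_iff_of_pos_left hw).1 ?_
  refine h.trans_eq ?_
  simp only [orient, det3]
  ring

lemma vertex_zero : D.vertex 0 = !₂[D.a, 0] := by
  have h : (D.lam : ℝ) ≠ 0 := by exact_mod_cast D.lam_pos.ne'
  simp [vertex, vertexSum, smul_smul, h]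

lemma vertex_zero_pos (N : ℕ) : 0 < D.vertex N 0 := by
  have h : 0 < D.vertexSum N 0 := by
    rw [vertexSum_zero_apply]
    have : (0 : ℝ) < D.lam := by exact_mod_cast D.lam_pos
    have h2 : 0 ≤ ∑ i ∈ Finset.range N, D.x (i + 1) :=
      Finset.sum_nonneg fun i _ => (D.x_pos (by omega)).le
    have := mul_pos this D.a_pos
    linarith
  exact mul_pos (inv_pos.2 (D.weight_pos N)) h

lemma vertex_one_pos {N : ℕ} (hN : 0 < N) : 0 < D.vertex N 1 := by
  have h : 0 < D.vertexSum N 1 := by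
    rw [vertexSum_one_apply]
    refine Finset.sum_pos (fun i _ => ?_) (Finset.nonempty_range_iff.2 hN.ne')
    exact D.ell_pos ⟨D.x_pos (by omega), (D.x_lt (by omega)).le⟩
  exact mul_pos (inv_pos.2 (D.weight_pos N)) h

/-- `V_{N+1}` is a weighted mean of `V_N` and `p_{N+1}`, and `x_{N+1}` is less than the mean of the
earlier first coordinates. -/
lemma strictAnti_vertex_zero : StrictAnti fun N => D.vertex N 0 := by
  refine strictAnti_nat_of_succ_lt fun N => ?_
  have h0 : (D.lam + N) * D.vertex N 0 = D.vertexSum N 0 := by rw [← D.smul_vertex N]; rfl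
  have h1 : (D.lam + (N + 1 : ℕ)) * D.vertex (N + 1) 0 = D.vertexSum (N + 1) 0 := by
    rw [← D.smul_vertex (N + 1)]; rfl
  have hS : D.vertexSum (N + 1) 0 = D.vertexSum N 0 + D.x (N + 1) := by
    rw [vertexSum_zero_apply, vertexSum_zero_apply, Finset.sum_range_succ, add_assoc]
  have hx : (D.lam + N) * D.x (N + 1) < (D.lam + N) * D.vertex N 0 := by
    rw [h0, vertexSum_zero_apply, add_mul]
    have hlam : (0 : ℝ) < D.lam := by exact_mod_cast D.lam_pos
    have h2 := mul_lt_mul_of_pos_left (D.x_lt (by omega : 1 ≤ N + 1)) hlam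
    have h3 : (N : ℝ) * D.x (N + 1) ≤ ∑ i ∈ Finset.range N, D.x (i + 1) := by
      have := Finset.card_nsmul_le_sum (Finset.range N) (fun i => D.x (i + 1)) (D.x (N + 1))
        fun i hi => D.x_le (by omega) (by have := Finset.mem_range.1 hi; omega)
      simpa using this
    linarith
  have hx' := lt_of_mul_lt_mul_left hx (D.weight_pos N).le
  refine lt_of_mul_lt_mul_left ?_ (D.weight_pos (N + 1)).le
  rw [h1, hS, ← h0]
  push_cast
  linarith

/-- Cesàro means of null sequences; the fixed term `λa` disappears after division by `λ + N`. -/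
lemma tendsto_vertex : Tendsto D.vertex atTop (𝓝 0) := by
  have hx := (D.tendsto_x.comp (tendsto_add_atTop_nat 1)).cesaro
  have he := (D.tendsto_ell_x.comp (tendsto_add_atTop_nat 1)).cesaro
  have hw : ∀ N : ℕ, 0 < N → ((D.lam : ℝ) + N)⁻¹ ≤ (N : ℝ)⁻¹ := fun N hN =>
    inv_anti₀ (by exact_mod_cast hN) (by simp)
  have h0 : Tendsto (fun N => D.vertex N 0) atTop (𝓝 0) := by
    have hlim := (tendsto_const_div_atTop_nhds_zero_nat (D.lam * D.a)).add hx
    rw [zero_add] at hlim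
    refine squeeze_zero' (Eventually.of_forall fun N => (D.vertex_zero_pos N).le) ?_ hlim
    filter_upwards [eventually_gt_atTop 0] with N hN
    have e : D.vertex N 0 = ((D.lam : ℝ) + N)⁻¹ * D.vertexSum N 0 := rfl
    have hpos : 0 ≤ D.vertexSum N 0 := by
      rw [← D.smul_vertex N]; exact (mul_pos (D.weight_pos N) (D.vertex_zero_pos N)).le
    rw [e]
    refine (mul_le_mul_of_nonneg_right (hw N hN) hpos).trans_eq ?_
    rw [vertexSum_zero_apply, mul_add, div_eq_inv_mul]
    rfl
  have h1 : Tendsto (fun N => D.vertex N 1) atTop (𝓝 0) := by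
    have hpos : ∀ N, 0 ≤ D.vertexSum N 1 := fun N => by
      rw [vertexSum_one_apply]
      exact Finset.sum_nonneg fun i _ => D.ell_x_nonneg (by omega)
    refine squeeze_zero' (Eventually.of_forall fun N =>
      mul_nonneg (inv_pos.2 (D.weight_pos N)).le (hpos N)) ?_ he
    filter_upwards [eventually_gt_atTop 0] with N hN
    refine (mul_le_mul_of_nonneg_right (hw N hN) (hpos N)).trans_eq ?_
    rw [vertexSum_one_apply]
    rfl
  have hcont : Continuous fun p : ℝ × ℝ => (!₂[p.1, p.2] : EuclideanSpace ℝ (Fin 2)) := by fun_prop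
  have h := (hcont.tendsto (0, 0)).comp (h0.prodMk_nhds h1)
  have e : (!₂[(0 : ℝ), 0] : EuclideanSpace ℝ (Fin 2)) = 0 := by ext i; fin_cases i <;> simp
  rw [e] at h
  refine h.congr fun N => ?_
  ext i; fin_cases i <;> rfl

lemma orient_vertex_origin_nonneg {j k : ℕ} (hjk : j < k) :
    0 ≤ orient (D.vertex j) (D.vertex k) 0 := by
  have hcont : Continuous fun z => orient (D.vertex j) (D.vertex k) z := by
    unfold orient; fun_prop
  refine ge_of_tendsto ((hcont.tendsto 0).comp D.tendsto_vertex) ?_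
  filter_upwards [eventually_gt_atTop k] with l hl
  exact (D.orient_vertex_pos hjk hl).le

lemma orient_vertex_reflect_pos {j k m : ℕ} (hjk : j < k) (hm : 0 < m) :
    0 < orient (D.vertex j) (D.vertex k) (reflect (D.vertex m)) := by
  have h0 := D.orient_vertex_origin_nonneg hjk
  have h1 : 0 ≤ orient (D.vertex j) (D.vertex k) (D.vertex 0) := by
    rcases Nat.eq_zero_or_pos j with rfl | hj
    · simp [orient]
    · rw [orient_rotate]; exact (D.orient_vertex_pos hj hjk).le
  have hdx : D.vertex k 0 < D.vertex j 0 := D.strictAnti_vertex_zero hjk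
  have hu := D.vertex_zero_pos m
  have hua : D.vertex m 0 < D.a := by
    have : D.vertex m 0 < D.vertex 0 0 := D.strictAnti_vertex_zero hm
    rwa [vertex_zero] at this
  have hv := mul_pos (D.vertex_one_pos hm) (sub_pos.2 hdx)
  -- The reflected vertex lies vertically below a point of the segment from `0` to `V_0 = (a, 0)`.
  -- Both end points have non-negative area with the chord, and moving down increases it since `V_k`
  -- is to the left of `V_j`.
  have key : D.a * orient (D.vertex j) (D.vertex k) (reflect (D.vertex m)) =
      D.vertex m 0 * orient (D.vertex j) (D.vertex k) (D.vertex 0) +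
      (D.a - D.vertex m 0) * orient (D.vertex j) (D.vertex k) 0 +
      D.a * (D.vertex m 1 * (D.vertex j 0 - D.vertex k 0)) := by
    rw [vertex_zero]
    simp only [orient, reflect_zero, reflect_one, PiLp.zero_apply, Matrix.cons_val_zero,
      Matrix.cons_val_one, Matrix.cons_val_fin_one]
    ring
  refine (mul_pos_iff_of_pos_left D.a_pos).1 ?_
  rw [key]
  have := mul_pos D.a_pos hv
  have := mul_nonneg hu.le h1
  have := mul_nonneg (sub_pos.2 hua).le h0
  linarith

/-- The vertices of the rotation set. -/
noncomputable def polygonVertex : ℤ → EuclideanSpace ℝ (Fin 2)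
  | Int.ofNat N => D.vertex N
  | Int.negSucc N => reflect (D.vertex (N + 1))

lemma polygonVertex_natCast (N : ℕ) : D.polygonVertex N = D.vertex N := rfl

lemma reflect_vertex_zero : reflect (D.vertex 0) = D.vertex 0 := by
  rw [vertex_zero]; ext i; fin_cases i <;> simp [reflect]

lemma polygonVertex_neg_natCast (N : ℕ) : D.polygonVertex (-N) = reflect (D.vertex N) := by
  cases N with
  | zero => rw [reflect_vertex_zero]; rfl
  | succ N => rfl

lemma polygonVertex_neg (n : ℤ) : D.polygonVertex (-n) = reflect (D.polygonVertex n) := by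
  obtain ⟨N, rfl | rfl⟩ := n.eq_nat_or_neg
  · rw [polygonVertex_neg_natCast, polygonVertex_natCast]
  · rw [neg_neg, polygonVertex_neg_natCast, polygonVertex_natCast, reflect_reflect]

/-- Reflection reverses both the order of the indices and the orientation, so the middle index may
be taken non-negative; then only the first vertex can be a mirror image. -/
lemma orient_polygonVertex_pos {i j k : ℤ} (hij : i < j) (hjk : j < k) :
    0 < orient (D.polygonVertex i) (D.polygonVertex j) (D.polygonVertex k) := by
  have key : ∀ {i j k : ℤ}, i < j → j < k → 0 ≤ j →
      0 < orient (D.polygonVertex i) (D.polygonVertex j) (D.polygonVertex k) := by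
    intro i j k hij hjk hj
    lift j to ℕ using hj
    lift k to ℕ using by omega
    obtain ⟨i, rfl | rfl⟩ := i.eq_nat_or_neg
    · simp only [polygonVertex_natCast]
      exact D.orient_vertex_pos (by omega) (by omega)
    · rw [polygonVertex_natCast, polygonVertex_natCast, polygonVertex_neg_natCast]
      rcases Nat.eq_zero_or_pos i with rfl | hi
      · rw [reflect_vertex_zero]
        exact D.orient_vertex_pos (by omega) (by omega)
      · rw [← orient_rotate]
        exact D.orient_vertex_reflect_pos (by omega) hi
  rcases le_total 0 j with hj | hj
  · exact key hij hjk hj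
  · have h := key (neg_lt_neg hjk) (neg_lt_neg hij) (neg_nonneg.2 hj)
    rw [D.polygonVertex_neg, D.polygonVertex_neg, D.polygonVertex_neg, orient_reflect] at h
    rwa [orient_rotate] at h

lemma tendsto_polygonVertex : Tendsto D.polygonVertex cofinite (𝓝 0) := by
  have hr : Continuous reflect := by unfold reflect; fun_prop
  have h2 := (hr.tendsto 0).comp D.tendsto_vertex
  have e : reflect 0 = 0 := by ext i; fin_cases i <;> simp [reflect]
  rw [e] at h2
  have htoNat : Tendsto Int.toNat atTop atTop := tendsto_atTop.2 fun b => by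
    filter_upwards [eventually_ge_atTop (b : ℤ)] with n hn
    omega
  rw [Int.cofinite_eq]
  refine Tendsto.sup ?_ ?_
  · have h3 : Tendsto (fun n : ℤ => (-n).toNat) atBot atTop :=
      htoNat.comp tendsto_neg_atBot_atTop
    refine (h2.comp h3).congr' ?_
    filter_upwards [eventually_le_atBot 0] with n hn
    rw [Function.comp_apply, Function.comp_apply, ← polygonVertex_neg_natCast]
    congr 1
    omega
  · refine (D.tendsto_vertex.comp htoNat).congr' ?_
    filter_upwards [eventually_ge_atTop 0] with n hn
    rw [Function.comp_apply, ← polygonVertex_natCast]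
    congr 1
    omega

lemma polygonVertex_pos (n : ℤ) : 0 < D.polygonVertex n 0 := by
  obtain ⟨N, rfl | rfl⟩ := n.eq_nat_or_neg
  · exact D.vertex_zero_pos N
  · rw [polygonVertex_neg_natCast]; exact D.vertex_zero_pos N

lemma summable_x : Summable fun i => D.x (i + 1) := by
  obtain ⟨C, r, hr0, hr1, h⟩ := D.x_exp
  refine Summable.of_nonneg_of_le (fun i => (D.x_pos (by omega)).le)
    (fun i => h (i + 1) (by omega)) ?_
  exact ((summable_nat_add_iff 1).2 (summable_geometric_of_lt_one hr0.le hr1)).mul_left C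

/-- The vertices form a convex chain if the series of the `ℓ₁(x_k)` diverges. -/
lemma isConvexChain (hdiv : Tendsto (fun N => ∑ i ∈ Finset.range N, D.ell (D.x (i + 1))) atTop
    atTop) :
    IsConvexChain D.polygonVertex where
  orient_pos := D.orient_polygonVertex_pos
  tendsto := D.tendsto_polygonVertex
  pos := D.polygonVertex_pos
  smooth p q h := by
    by_contra hq
    have hq' : 0 < |q| := abs_pos.2 hq
    -- Testing at `V_N` and its mirror image bounds `|q| ∑ ℓ₁(x_k)` by `-p` times the sum of first
    -- coordinates, which stays bounded because `∑ x_k` converges.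
    have hb : ∀ N, |q| * D.vertexSum N 1 ≤ |p| * (D.lam * D.a + ∑' i, D.x (i + 1)) := by
      intro N
      have h1 := h N
      have h2 := h (-N)
      rw [polygonVertex_natCast] at h1
      rw [polygonVertex_neg_natCast, reflect_zero, reflect_one] at h2
      have e0 : (D.lam + N) * D.vertex N 0 = D.vertexSum N 0 := by rw [← D.smul_vertex N]; rfl
      have e1 : (D.lam + N) * D.vertex N 1 = D.vertexSum N 1 := by rw [← D.smul_vertex N]; rfl
      have h1' := mul_nonpos_of_nonneg_of_nonpos (D.weight_pos N).le h1
      have h2' := mul_nonpos_of_nonneg_of_nonpos (D.weight_pos N).le h2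
      have hx : D.vertexSum N 0 ≤ D.lam * D.a + ∑' i, D.x (i + 1) := by
        rw [vertexSum_zero_apply]
        have := D.summable_x.sum_le_tsum (Finset.range N) fun i _ => (D.x_pos (by omega)).le
        linarith
      have hx0 : 0 ≤ D.vertexSum N 0 := e0 ▸ (mul_pos (D.weight_pos N) (D.vertex_zero_pos N)).le
      have h3 : |q| * D.vertexSum N 1 ≤ -p * D.vertexSum N 0 := by
        rw [← e0, ← e1]
        rcases abs_choice q with hh | hh <;> rw [hh] <;> linarith
      calc |q| * D.vertexSum N 1 ≤ -p * D.vertexSum N 0 := h3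
        _ ≤ |p| * D.vertexSum N 0 := mul_le_mul_of_nonneg_right (neg_le_abs p) hx0
        _ ≤ _ := mul_le_mul_of_nonneg_left hx (abs_nonneg p)
    obtain ⟨N, hN⟩ := (hdiv.eventually_gt_atTop
      (|p| * (D.lam * D.a + ∑' i, D.x (i + 1)) / |q|)).exists
    rw [div_lt_iff₀ hq', ← vertexSum_one_apply, mul_comm (D.vertexSum N 1)] at hN
    exact absurd (hb N) (not_le.2 hN)

end Params

/-! ### The rotation set is the convex hull of the vertices -/

/-- The involution of the shift space that exchanges the two symbol sets. -/
def flip (ξ : FourShift) : FourShift := fun k => ξ k + 2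

lemma measurable_flip : Measurable flip :=
  measurable_pi_lambda _ fun k => (measurable_of_countable fun s : Fin 4 => s + 2).comp
    (measurable_pi_apply k)

lemma flip_apply_mem_symOne {ξ : FourShift} {k : ℕ} : flip ξ k ∈ symOne ↔ ξ k ∈ symTwo := by
  rw [flip, mem_symOne, mem_symTwo]; generalize ξ k = s; revert s; decide

lemma flip_apply_mem_symTwo {ξ : FourShift} {k : ℕ} : flip ξ k ∈ symTwo ↔ ξ k ∈ symOne := by
  rw [flip, mem_symOne, mem_symTwo]; generalize ξ k = s; revert s; decide

lemma flip_apply_eq_one {ξ : FourShift} {k : ℕ} : flip ξ k = 1 ↔ ξ k = 3 := by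
  rw [flip]; generalize ξ k = s; revert s; decide

lemma flip_apply_eq_three {ξ : FourShift} {k : ℕ} : flip ξ k = 3 ↔ ξ k = 1 := by
  rw [flip]; generalize ξ k = s; revert s; decide

/-- Convex combinations of invariant measures realize convex combinations of rotation vectors. -/
lemma convex_rotationSet {Ψ : FourShift → EuclideanSpace ℝ (Fin 2)} (hΨ : Continuous Ψ) :
    Convex ℝ (rotationSet shift Ψ) := by
  rintro _ ⟨μ, hμ, rfl⟩ _ ⟨ν, hν, rfl⟩ a b ha hb hab
  set ρ : Measure FourShift :=
    ENNReal.ofReal a • (μ : Measure FourShift) + ENNReal.ofReal b • (ν : Measure FourShift) with hρ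
  have hprob : IsProbabilityMeasure ρ := ⟨by
    simp [hρ, ← ENNReal.ofReal_add ha hb, hab]⟩
  refine ⟨⟨ρ, hprob⟩, ⟨measurable_shift, ?_⟩, ?_⟩
  · change Measure.map shift ρ = ρ
    rw [hρ, Measure.map_add _ _ measurable_shift, Measure.map_smul, Measure.map_smul]
    rw [show Measure.map shift (μ : Measure FourShift) = μ from hμ.map_eq,
      show Measure.map shift (ν : Measure FourShift) = ν from hν.map_eq]
  · ext i
    have h1 := integrable_coord hΨ (μ : Measure FourShift) i
    have h2 := integrable_coord hΨ (ν : Measure FourShift) i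
    change ∫ ξ, Ψ ξ i ∂ρ = a * ∫ ξ, Ψ ξ i ∂(μ : Measure FourShift) +
      b * ∫ ξ, Ψ ξ i ∂(ν : Measure FourShift)
    rw [hρ, integral_add_measure (h1.smul_measure ENNReal.ofReal_ne_top)
      (h2.smul_measure ENNReal.ofReal_ne_top), integral_smul_measure, integral_smul_measure,
      ENNReal.toReal_ofReal ha, ENNReal.toReal_ofReal hb, smul_eq_mul, smul_eq_mul]

/-- The averages along periodic orbits are rotation vectors. -/
lemma orbitAverage_mem_rotationSet {Ψ : FourShift → EuclideanSpace ℝ (Fin 2)}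
    {ξ : FourShift} {p : ℕ} (hp : 0 < p) (hξ : shift^[p] ξ = ξ) :
    (p : ℝ)⁻¹ • ∑ i ∈ Finset.range p, Ψ (shift^[i] ξ) ∈ rotationSet shift Ψ := by
  set σ : Measure FourShift := ∑ i ∈ Finset.range p, Measure.dirac (shift^[i] ξ) with hσ
  have hp' : (p : ENNReal) ≠ 0 := by exact_mod_cast hp.ne'
  have hprob : IsProbabilityMeasure ((p : ENNReal)⁻¹ • σ) := ⟨by
    simp [hσ, ENNReal.inv_mul_cancel hp' (ENNReal.natCast_ne_top p)]⟩
  have hinv : Measure.map shift σ = σ := by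
    have hmap : Measure.map shift σ = ∑ i ∈ Finset.range p, Measure.dirac (shift^[i + 1] ξ) := by
      rw [hσ, ← Measure.mapₗ_apply_of_measurable measurable_shift, map_sum]
      refine Finset.sum_congr rfl fun i _ => ?_
      rw [Measure.mapₗ_apply_of_measurable measurable_shift, Measure.map_dirac' measurable_shift,
        Function.iterate_succ_apply']
    rw [hmap, hσ]
    -- The shift moves the orbit points cyclically: the last image is `ξ` itself and takes the place
    -- of the first point.
    obtain ⟨q, rfl⟩ := Nat.exists_eq_succ_of_ne_zero hp.ne'
    rw [Finset.sum_range_succ, hξ, Finset.sum_range_succ' _ q]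
    rfl
  refine ⟨⟨_, hprob⟩, ⟨measurable_shift, ?_⟩, ?_⟩
  · change Measure.map shift ((p : ENNReal)⁻¹ • σ) = _
    rw [Measure.map_smul, hinv]
    rfl
  · ext i
    change ∫ η, Ψ η i ∂((p : ENNReal)⁻¹ • σ) = _
    rw [integral_smul_measure, hσ, integral_finsetSum_measure fun j _ =>
      integrable_dirac (by finiteness)]
    simp

/-! ### Symmetry of the rotation set and realization of the vertices -/

namespace Params

variable (D : Params)

/-- Adding `2` modulo `4` exchanges `S₁` with `S₂` and `1` with `3`, matching `ℓ₂ = -ℓ₁`. -/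
lemma potential_flip (ξ : FourShift) : D.potential (flip ξ) = reflect (D.potential ξ) := by
  classical
  have hv : ∀ s t : ℝ, reflect !₂[s, t] = !₂[s, -t] := fun s t => by
    ext i; fin_cases i <;> simp [reflect]
  rcases D.trichotomy ξ with h | h | ⟨m, hm, h⟩ | ⟨m, hm, h⟩
  · rw [D.potential_out h.1 h.2, D.potential_out, hv, neg_zero]
    · simpa only [flip_apply_mem_symOne] using h.2
    · simpa only [flip_apply_mem_symTwo] using h.1
  · rw [D.potential_never h, D.potential_never]
    · ext i; fin_cases i <;> simp [reflect]
    · simpa only [flip_apply_mem_symOne, flip_apply_mem_symTwo] using h.symm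
  · rw [D.potential_exit_one hm h, D.potential_exit_two hm]
    · rw [hv]
      simp only [flip_apply_eq_three]
      split_ifs <;> simp
    · simpa only [flip_apply_mem_symTwo] using h
  · rw [D.potential_exit_two hm h, D.potential_exit_one hm]
    · rw [hv]
      simp only [flip_apply_eq_one]
      split_ifs <;> simp
    · simpa only [flip_apply_mem_symOne] using h

lemma reflect_mem_rotationSet {w : EuclideanSpace ℝ (Fin 2)}
    (hw : w ∈ rotationSet shift D.potential) : reflect w ∈ rotationSet shift D.potential := by
  obtain ⟨μ, hμ, rfl⟩ := hw
  refine ⟨μ.map measurable_flip.aemeasurable, ⟨measurable_shift, ?_⟩, ?_⟩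
  · change Measure.map shift (Measure.map flip (μ : Measure FourShift)) =
      Measure.map flip (μ : Measure FourShift)
    rw [Measure.map_map measurable_shift measurable_flip]
    have : shift ∘ flip = flip ∘ shift := rfl
    rw [this, ← Measure.map_map measurable_flip measurable_shift,
      show Measure.map shift (μ : Measure FourShift) = μ from hμ.map_eq]
  · have h : ∀ i, rotationVector D.potential (μ.map measurable_flip.aemeasurable) i =
        ∫ ξ, reflect (D.potential ξ) i ∂(μ : Measure FourShift) := by
      intro i
      simp only [← D.potential_flip]
      have hc : Continuous fun ξ => D.potential ξ i := by
        have := D.continuous_potential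
        fun_prop
      exact integral_map measurable_flip.aemeasurable hc.aestronglyMeasurable
    ext i
    rw [h]
    fin_cases i
    · rfl
    · exact integral_neg _

/-- The periodic word `1 ⋯ 1 2` of period `p`. -/
def periodicPoint (p : ℕ) : FourShift := fun k => if (k + 1) % p = 0 then 2 else 1

lemma shift_iterate_periodicPoint (p : ℕ) : shift^[p] (periodicPoint p) = periodicPoint p := by
  funext k
  rw [shift_iterate_apply, periodicPoint, periodicPoint, show k + p + 1 = k + 1 + p by ring,
    Nat.add_mod_right]

/-- After `p - 1 - m` shifts exactly `m` symbols `1` precede the next `2`, so `m` is the exit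
position from `S₁`. -/
lemma potential_periodicPoint {p m : ℕ} (hp : 2 ≤ p) (hm : m < p) :
    D.potential (shift^[p - 1 - m] (periodicPoint p)) =
      if m < D.lam then !₂[D.a, 0] else D.curvePoint (m + 1 - D.lam) := by
  classical
  have hl := D.lam_ge
  set ξ := shift^[p - 1 - m] (periodicPoint p) with hξ
  have h1 : ∀ j < m, ξ j = 1 := fun j hj => by
    rw [hξ, shift_iterate_apply, periodicPoint, if_neg]
    rw [Nat.mod_eq_of_lt (by omega)]
    omega
  have h2 : ξ m = 2 := by
    rw [hξ, shift_iterate_apply, periodicPoint, if_pos]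
    rw [show m + (p - 1 - m) + 1 = p by omega, Nat.mod_self]
  have h2' : ξ m ∉ symOne := by rw [h2, mem_symOne]; decide
  -- Needed for `m = 0`: the point starts with `21`, and `λ ≥ 2` keeps it out of `Ỹ₂(λ)`.
  have h3 : ξ (m + 1) = 1 := by
    rw [hξ, shift_iterate_apply, periodicPoint, if_neg]
    rw [show m + 1 + (p - 1 - m) + 1 = 1 + p by omega, Nat.add_mod_right, Nat.mod_eq_of_lt hp]
    exact one_ne_zero
  have h1' : (1 : Fin 4) ∉ symTwo := by rw [mem_symTwo]; decide
  split_ifs with hlt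
  · refine D.potential_out (fun h => h2' (h m hlt)) fun h => ?_
    rcases Nat.eq_zero_or_pos m with rfl | hm0
    · exact h1' (h3 ▸ h (0 + 1) (by omega))
    · exact h1' (h1 0 hm0 ▸ h 0 (by omega))
  · rw [D.potential_exit_one (not_lt.1 hlt) ⟨fun j hj => mem_symOne.2 (Or.inr (h1 j hj)), h2'⟩,
      if_pos h1, curvePoint]

/-- Read backwards, the orbit of period `λ + N` contributes `(a, 0)` for the exit positions below
`λ`, then `p_1, …, p_N`. -/
lemma vertex_mem_rotationSet (N : ℕ) : D.vertex N ∈ rotationSet shift D.potential := by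
  have hl := D.lam_ge
  have h := orbitAverage_mem_rotationSet (Ψ := D.potential) (show 0 < D.lam + N by omega)
    (shift_iterate_periodicPoint (D.lam + N))
  rw [← Finset.sum_range_reflect, Finset.sum_congr rfl fun m hm =>
    D.potential_periodicPoint (p := D.lam + N) (by omega) (Finset.mem_range.1 hm),
    Finset.sum_range_add, Finset.sum_congr rfl fun m hm => if_pos (Finset.mem_range.1 hm)] at h
  simp only [Finset.sum_const, Finset.card_range] at h
  rw [vertex, vertexSum]
  convert h using 2
  · push_cast; rfl
  · congr 1
    · exact Nat.cast_smul_eq_nsmul ℝ _ _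
    · refine Finset.sum_congr rfl fun i _ => ?_
      rw [if_neg (by omega)]
      congr 1
      omega

lemma convexHull_subset_rotationSet :
    convexHull ℝ (insert 0 (range D.polygonVertex)) ⊆ rotationSet shift D.potential := by
  refine convexHull_min ?_ (convex_rotationSet D.continuous_potential)
  rintro _ (rfl | ⟨n, rfl⟩)
  · exact D.zero_mem_rotationSet
  · obtain ⟨N, rfl | rfl⟩ := n.eq_nat_or_neg
    · exact D.vertex_mem_rotationSet N
    · rw [polygonVertex_neg_natCast]
      exact D.reflect_mem_rotationSet (D.vertex_mem_rotationSet N)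

/-! ### Ergodic optimization -/

/-- The maximal gain `φ(Φ(ξ)) - M` at a point `ξ` that leaves `S₁` after exactly `j + 1` steps, for
`φ(z) = α z₀ + β z₁` with `β ≥ 0`. -/
noncomputable def gain (α β M : ℝ) (j : ℕ) : ℝ :=
  if j + 1 < D.lam then α * D.a - M
  else α * D.x (j + 2 - D.lam) + β * D.ell (D.x (j + 2 - D.lam)) - M

open scoped Classical in
/-- The total gain until `S₁` is left, cut off after the last `J` steps. -/
noncomputable def transfer (α β M : ℝ) (J : ℕ) (ξ : FourShift) : ℝ :=
  ∑ j ∈ Finset.range J, if ∀ i ≤ j, ξ i ∈ symOne then D.gain α β M j else 0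

variable {D} {α β M : ℝ} {J : ℕ}

lemma transfer_never {ξ : FourShift} (h : ∀ j, ξ j ∈ symOne) :
    D.transfer α β M J ξ = ∑ j ∈ Finset.range J, D.gain α β M j :=
  Finset.sum_congr rfl fun _ _ => if_pos fun i _ => h i

lemma transfer_exit {ξ : FourShift} {m : ℕ} (h : (∀ j < m, ξ j ∈ symOne) ∧ ξ m ∉ symOne) :
    D.transfer α β M J ξ = ∑ j ∈ Finset.range (min J m), D.gain α β M j := by
  rw [transfer, ← Finset.sum_filter]
  congr 1
  ext j
  simp only [Finset.mem_filter, Finset.mem_range, lt_min_iff]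
  refine and_congr_right fun _ => ⟨fun hj => ?_, fun hj i hi => h.1 i (by omega)⟩
  by_contra hc
  exact h.2 (hj m (by omega))

lemma exists_transfer_eq (ξ : FourShift) :
    ∃ n, D.transfer α β M J ξ = ∑ j ∈ Finset.range n, D.gain α β M j := by
  rcases Ytilde_or_exits symOne 0 (ξ := ξ) (fun j hj => absurd hj (by omega)) with h | ⟨m, -, h⟩
  · exact ⟨_, transfer_never h⟩
  · exact ⟨_, transfer_exit h⟩

lemma measurable_transfer : Measurable (D.transfer α β M J) := by
  classical
  refine measurable_of_dependsOn_prefix (m := J) fun ξ η h => ?_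
  refine Finset.sum_congr rfl fun j hj => ?_
  have : (∀ i ≤ j, ξ i ∈ symOne) ↔ ∀ i ≤ j, η i ∈ symOne :=
    forall₂_congr fun i hi => by rw [h i (by have := Finset.mem_range.1 hj; omega)]
  simp only [this]

lemma norm_transfer_le (ξ : FourShift) :
    ‖D.transfer α β M J ξ‖ ≤ ∑ j ∈ Finset.range J, ‖D.gain α β M j‖ := by
  classical
  refine (norm_sum_le _ _).trans (Finset.sum_le_sum fun j _ => ?_)
  split_ifs
  · exact le_rfl
  · simp

/-- The total gain along a run of symbols in `S₁`, together with one step outside of `S₁`, is not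
positive. -/
lemma add_sum_gain_nonpos (hV : ∀ N, α * D.vertex N 0 + β * D.vertex N 1 ≤ M) (n : ℕ) :
    α * D.a - M + ∑ j ∈ Finset.range n, D.gain α β M j ≤ 0 := by
  have hl := D.lam_pos
  have h0 := hV 0
  rw [vertex_zero] at h0
  simp only [Matrix.cons_val_zero, Matrix.cons_val_one, Matrix.cons_val_fin_one, mul_zero,
    add_zero] at h0
  have hsmall : ∀ k ≤ D.lam - 1, ∑ j ∈ Finset.range k, D.gain α β M j = k * (α * D.a - M) := by
    intro k hk
    rw [Finset.sum_congr rfl fun j hj => show D.gain α β M j = α * D.a - M from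
      if_pos (by have := Finset.mem_range.1 hj; omega)]
    rw [Finset.sum_const, Finset.card_range, nsmul_eq_mul]
  rcases le_total n (D.lam - 1) with hn | hn
  · rw [hsmall n hn]
    have := mul_nonpos_of_nonneg_of_nonpos (n.cast_nonneg (α := ℝ)) (sub_nonpos.2 h0)
    linarith
  · obtain ⟨N, rfl⟩ := Nat.exists_eq_add_of_le hn
    -- With `n = λ - 1 + N`, the step outside and the run together form one turn of the periodic
    -- orbit of `V_N`, of total gain `(λ + N)(φ(V_N) - M)`.
    have hN : (D.lam + N) * (α * D.vertex N 0 + β * D.vertex N 1 - M) ≤ 0 :=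
      mul_nonpos_of_nonneg_of_nonpos (D.weight_pos N).le (sub_nonpos.2 (hV N))
    have e0 : (D.lam + N) * D.vertex N 0 = D.vertexSum N 0 := by rw [← D.smul_vertex N]; rfl
    have e1 : (D.lam + N) * D.vertex N 1 = D.vertexSum N 1 := by rw [← D.smul_vertex N]; rfl
    rw [vertexSum_zero_apply] at e0
    rw [vertexSum_one_apply] at e1
    have hbig : ∑ j ∈ Finset.range N, D.gain α β M (D.lam - 1 + j) =
        α * (∑ i ∈ Finset.range N, D.x (i + 1)) +
          β * (∑ i ∈ Finset.range N, D.ell (D.x (i + 1))) - N * M := by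
      rw [Finset.mul_sum, Finset.mul_sum, ← Finset.sum_add_distrib]
      have : (N : ℝ) * M = ∑ _i ∈ Finset.range N, M := by simp
      rw [this, ← Finset.sum_sub_distrib]
      refine Finset.sum_congr rfl fun j _ => ?_
      rw [gain, if_neg (by omega), show D.lam - 1 + j + 2 - D.lam = j + 1 by omega]
    rw [Finset.sum_range_add, hsmall _ le_rfl, hbig, Nat.cast_pred hl]
    linear_combination hN + (-α) * e0 + (-β) * e1

/-- Starting outside `S₁`, the second coordinate is at most `0` and the first lies in `[0, a]`, so
`β ≥ 0` leaves only the bounds at `0` and `a`. -/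
lemma potential_symTwo_le (hβ : 0 ≤ β) (hM : 0 ≤ M) (ha : α * D.a ≤ M) {ξ : FourShift}
    (h : ξ 0 ∉ symOne) : α * D.potential ξ 0 + β * D.potential ξ 1 ≤ M := by
  classical
  have hl := D.lam_pos
  rcases D.trichotomy ξ with h' | h' | ⟨m, hm, h'⟩ | ⟨m, hm, h'⟩
  · rw [D.potential_out h'.1 h'.2]; simpa using ha
  · rw [D.potential_never h']; simpa using hM
  · exact absurd (h'.1 0 (by omega)) h
  · have hx := D.x_mem_Icc (by omega : 1 ≤ m + 1 - D.lam)
    have h1 : α * D.x (m + 1 - D.lam) ≤ M := by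
      rcases le_total 0 α with hα | hα
      · exact (mul_le_mul_of_nonneg_left hx.2 hα).trans ha
      · exact (mul_nonpos_of_nonpos_of_nonneg hα hx.1).trans hM
    have h2 : D.potential ξ 1 ≤ 0 := (D.potential_tail_two hm h'.1).2.1.2
    have h3 := mul_nonpos_of_nonneg_of_nonpos hβ h2
    have h4 : D.potential ξ 0 = D.x (m + 1 - D.lam) := by rw [D.potential_exit_two hm h']; rfl
    rw [h4]
    linarith

lemma potential_le_gain (hβ : 0 ≤ β) {ξ : FourShift} {m : ℕ}
    (h : (∀ j < m + 1, ξ j ∈ symOne) ∧ ξ (m + 1) ∉ symOne) :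
    α * D.potential ξ 0 + β * D.potential ξ 1 - M ≤ D.gain α β M m := by
  classical
  have hl := D.lam_pos
  rw [gain]
  split_ifs with hm
  · rw [D.potential_out (fun hc => h.2 (hc _ hm)) fun hc =>
      (mem_symTwo_iff_notMem_symOne _).1 (hc 0 hl) (h.1 0 (by omega))]
    simp
  · rw [D.potential_exit_one (by omega) h, show m + 1 + 1 - D.lam = m + 2 - D.lam by omega]
    simp only [Matrix.cons_val_zero, Matrix.cons_val_one, Matrix.cons_val_fin_one]
    have := mul_nonneg hβ (D.ell_x_nonneg (by omega : 1 ≤ m + 2 - D.lam))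
    split_ifs <;> linarith

/-- The potential is dominated by a coboundary. -/
lemma potential_sub_le_transfer (hβ : 0 ≤ β) (hM : 0 ≤ M)
    (hV : ∀ N, α * D.vertex N 0 + β * D.vertex N 1 ≤ M) (hJ : ∀ j ≥ J, D.gain α β M j ≤ 0)
    (ξ : FourShift) :
    α * D.potential ξ 0 + β * D.potential ξ 1 - M ≤
      D.transfer α β M J ξ - D.transfer α β M J (shift ξ) := by
  have hl := D.lam_ge
  have ha : α * D.a ≤ M := by simpa [vertex_zero] using hV 0
  rcases Ytilde_or_exits symOne 0 (ξ := ξ) (fun j hj => absurd hj (by omega)) with h | ⟨m, -, h⟩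
  · rw [transfer_never h, transfer_never (ξ := shift ξ) fun j => h (j + 1), D.potential_never
      (Or.inl h)]
    simpa using hM
  · rcases m with _ | m
    · rw [transfer_exit h, Nat.min_zero, Finset.range_zero, Finset.sum_empty, zero_sub]
      have h0 := potential_symTwo_le hβ hM ha h.2
      -- Entering `S₁` starts a new run: the present step has value `(a, 0)` as `λ ≥ 2`, and
      -- `add_sum_gain_nonpos` bounds it together with the gain of the whole run.
      by_cases h1 : ξ 1 ∈ symOne
      · obtain ⟨n, hn⟩ := exists_transfer_eq (D := D) (α := α) (β := β) (M := M) (J := J) (shift ξ)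
        have := add_sum_gain_nonpos hV n
        rw [hn, D.potential_out (fun hc => h.2 (hc 0 (by omega))) fun hc =>
          (mem_symTwo_iff_notMem_symOne _).1 (hc 1 (by omega)) h1]
        simp only [Matrix.cons_val_zero, Matrix.cons_val_one, Matrix.cons_val_fin_one, mul_zero,
          add_zero]
        linarith
      · rw [transfer_exit (ξ := shift ξ) (m := 0) ⟨fun j hj => absurd hj (by omega), h1⟩]
        simp only [Nat.min_zero, Finset.range_zero, Finset.sum_empty, neg_zero]
        linarith
    · have hs : (∀ j < m, shift ξ j ∈ symOne) ∧ shift ξ m ∉ symOne :=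
        ⟨fun j hj => h.1 (j + 1) (by omega), h.2⟩
      rw [transfer_exit h, transfer_exit hs]
      -- Inside a run the transfer sums telescope to the single gain of index `m`, or to `0` beyond
      -- the cut-off, where gains are non-positive.
      refine (potential_le_gain hβ h).trans ?_
      rcases lt_or_ge m J with hm | hm
      · rw [min_eq_right (by omega), min_eq_right (by omega), Finset.sum_range_succ]
        linarith
      · rw [min_eq_left (by omega), min_eq_left (by omega), sub_self]
        exact hJ m hm

lemma rotationVector_le_of_nonneg (hβ : 0 ≤ β) (hM : 0 < M)
    (hV : ∀ N, α * D.vertex N 0 + β * D.vertex N 1 ≤ M) {μ : ProbabilityMeasure FourShift}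
    (hμ : μ ∈ invariantMeasures shift) :
    α * rotationVector D.potential μ 0 + β * rotationVector D.potential μ 1 ≤ M := by
  -- Since `p_k → 0` and `M > 0`, late gains are negative; cutting them off keeps the transfer
  -- function bounded, also on `Y₁(∞)`.
  obtain ⟨J, hJ⟩ : ∃ J, ∀ j ≥ J, D.gain α β M j ≤ 0 := by
    have h : Tendsto (fun k => α * D.x k + β * D.ell (D.x k)) atTop (𝓝 0) := by
      simpa using (D.tendsto_x.const_mul α).add (D.tendsto_ell_x.const_mul β)
    obtain ⟨k, hk⟩ := eventually_atTop.1 (h.eventually (gt_mem_nhds hM))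
    refine ⟨k + D.lam, fun j hj => ?_⟩
    rw [gain, if_neg (by omega)]
    have := hk (j + 2 - D.lam) (by omega)
    linarith
  have hi := integrable_coord D.continuous_potential (μ : Measure FourShift)
  have hi' : Integrable (fun ξ => α * D.potential ξ 0 + β * D.potential ξ 1)
      (μ : Measure FourShift) := ((hi 0).const_mul α).add ((hi 1).const_mul β)
  have hu : Integrable (D.transfer α β M J) (μ : Measure FourShift) :=
    Integrable.of_bound measurable_transfer.aestronglyMeasurable _
      (Eventually.of_forall norm_transfer_le)
  have hμ' : MeasurePreserving shift (μ : Measure FourShift) (μ : Measure FourShift) := hμ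
  have hus : Integrable (fun ξ => D.transfer α β M J (shift ξ)) (μ : Measure FourShift) :=
    hμ'.integrable_comp_of_integrable hu
  have hle : ∫ ξ, (α * D.potential ξ 0 + β * D.potential ξ 1 - M) ∂(μ : Measure FourShift) ≤
      ∫ ξ, (D.transfer α β M J ξ - D.transfer α β M J (shift ξ)) ∂(μ : Measure FourShift) :=
    integral_mono (hi'.sub (integrable_const M))
      (hu.sub hus) fun ξ => potential_sub_le_transfer hβ hM.le hV hJ ξ
  have hzero : ∫ ξ, D.transfer α β M J (shift ξ) ∂(μ : Measure FourShift) =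
      ∫ ξ, D.transfer α β M J ξ ∂(μ : Measure FourShift) := by
    conv_rhs => rw [← hμ'.map_eq]
    rw [integral_map measurable_shift.aemeasurable measurable_transfer.aestronglyMeasurable]
  rw [integral_sub hu hus, hzero, sub_self, integral_sub hi' (integrable_const M),
    integral_add ((hi 0).const_mul α)
    ((hi 1).const_mul β), integral_const_mul, integral_const_mul, integral_const, probReal_univ,
    one_smul] at hle
  exact sub_nonpos.1 hle

/-- A rotation vector outside the compact hull is separated by a functional with bound `M > 0`,
because `0` is in the hull. A negative second coefficient is reduced to the other case by
reflection. -/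
lemma rotationSet_subset_convexHull (hv : IsConvexChain D.polygonVertex) :
    rotationSet shift D.potential ⊆ convexHull ℝ (insert 0 (range D.polygonVertex)) := by
  intro w hw
  by_contra hn
  obtain ⟨φ, M, hM, hwM⟩ := geometric_hahn_banach_closed_point (convex_convexHull ℝ _)
    hv.isCompact_hull.isClosed hn
  obtain ⟨α, β, rfl⟩ := exists_eq_planeFunctional φ
  have h0 : 0 < M := by
    simpa using hM 0 (subset_convexHull ℝ _ (mem_insert _ _))
  have hgen : ∀ n, α * D.polygonVertex n 0 + β * D.polygonVertex n 1 ≤ M := fun n =>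
    (hM _ (subset_convexHull ℝ _ (mem_insert_of_mem _ (mem_range_self n)))).le
  rw [planeFunctional_apply] at hwM
  rcases le_total 0 β with hβ | hβ
  · obtain ⟨μ, hμ, rfl⟩ := hw
    exact absurd (rotationVector_le_of_nonneg hβ h0 (fun N => hgen N) hμ) (not_le.2 hwM)
  · obtain ⟨μ, hμ, hμw⟩ := D.reflect_mem_rotationSet hw
    have h := rotationVector_le_of_nonneg (D := D) (α := α) (neg_nonneg.2 hβ) h0 (fun N => ?_) hμ
    · rw [hμw, reflect_zero, reflect_one, neg_mul_neg] at h
      exact absurd h (not_le.2 hwM)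
    · have := hgen (-N)
      rwa [polygonVertex_neg_natCast, reflect_zero, reflect_one, mul_neg, ← neg_mul] at this

lemma rotationSet_eq_convexHull (hv : IsConvexChain D.polygonVertex) :
    rotationSet shift D.potential = convexHull ℝ (insert 0 (range D.polygonVertex)) :=
  subset_antisymm (rotationSet_subset_convexHull hv) D.convexHull_subset_rotationSet

end Params

/-! ### Parameters with a smooth exposed point -/

/-- The function `-1 / log t` (which takes the value `0` at `0`). -/
noncomputable def logEll (t : ℝ) : ℝ := -(Real.log t)⁻¹

lemma log_lt_of_mem {t : ℝ} (h0 : 0 < t) (h : t ≤ Real.exp (-3)) : Real.log t ≤ -3 := by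
  have := Real.log_le_log h0 h
  rwa [Real.log_exp] at this

lemma continuousOn_logEll : ContinuousOn logEll (Icc 0 (Real.exp (-3))) := by
  intro t ht
  rcases ht.1.eq_or_lt with rfl | h0
  · rw [ContinuousWithinAt, logEll, Real.log_zero, inv_zero, neg_zero]
    have h1 : Tendsto logEll (𝓝[≠] 0) (𝓝 0) := by
      have := (tendsto_inv_atBot_zero.comp Real.tendsto_log_nhdsNE_zero).neg
      rwa [neg_zero] at this
    have h2 : Tendsto logEll (pure 0) (𝓝 0) := by
      have : logEll 0 = 0 := by simp [logEll]
      exact tendsto_pure_left.2 fun s hs => by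
        rw [this]; exact mem_of_mem_nhds hs
    have h3 := h1.sup h2
    rw [sup_comm, pure_sup_nhdsNE] at h3
    exact h3.mono_left nhdsWithin_le_nhds
  · have hlog := log_lt_of_mem h0 ht.2
    exact ((Real.continuousAt_log h0.ne').inv₀ (by linarith)).neg.continuousWithinAt

lemma deriv_logEll {t : ℝ} (ht : t ∈ Ioo 0 (Real.exp (-3))) :
    deriv logEll t = (t * Real.log t ^ 2)⁻¹ := by
  have hlog := log_lt_of_mem ht.1 ht.2.le
  have h := ((Real.hasDerivAt_log ht.1.ne').inv (by linarith)).neg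
  rw [show logEll = -(Real.log)⁻¹ from rfl, h.deriv]
  have := ht.1.ne'
  have : Real.log t ≠ 0 := by linarith
  field_simp

/-- The derivative is `1 / (t log² t)`, and `t log² t` has derivative `log t (log t + 2)`, which is
positive for `log t < -2`. This is why the interval ends at `e^{-3}`. -/
lemma strictConcaveOn_logEll : StrictConcaveOn ℝ (Icc 0 (Real.exp (-3))) logEll := by
  refine StrictAntiOn.strictConcaveOn_of_deriv (convex_Icc _ _) continuousOn_logEll ?_
  rw [interior_Icc]
  have hmono : StrictMonoOn (fun t => t * Real.log t ^ 2) (Ioo 0 (Real.exp (-3))) := by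
    refine strictMonoOn_of_deriv_pos (convex_Ioo _ _) (fun t ht => ?_) fun t ht => ?_
    · exact (continuousAt_id.mul ((Real.continuousAt_log ht.1.ne').pow 2)).continuousWithinAt
    · rw [interior_Ioo] at ht
      have hlog := log_lt_of_mem ht.1 ht.2.le
      have h := (hasDerivAt_id t).mul ((Real.hasDerivAt_log ht.1.ne').pow 2)
      have e : (fun t => t * Real.log t ^ 2) = id * Real.log ^ 2 := rfl
      rw [e, h.deriv]
      have ht0 := ht.1.ne'
      have e2 : 1 * (Real.log ^ 2) t + id t * (((2 : ℕ) : ℝ) * Real.log t ^ (2 - 1) * t⁻¹) =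
          Real.log t * (Real.log t + 2) := by
        simp only [Pi.pow_apply, id_eq]
        field_simp
        push_cast
        ring
      rw [e2]
      exact mul_pos_of_neg_of_neg (by linarith) (by linarith)
  intro s hs t ht hst
  rw [deriv_logEll hs, deriv_logEll ht]
  have hlog := log_lt_of_mem hs.1 hs.2.le
  have hlog' : Real.log s ≠ 0 := by linarith
  exact inv_strictAnti₀ (mul_pos hs.1 (by positivity)) (hmono hs ht hst)

lemma logEll_nonneg {t : ℝ} (ht : t ∈ Icc 0 (Real.exp (-3))) : 0 ≤ logEll t := by
  rcases ht.1.eq_or_lt with rfl | h0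
  · simp [logEll]
  · have := log_lt_of_mem h0 ht.2
    exact neg_nonneg.2 (inv_nonpos.2 (by linarith))

lemma monotoneOn_logEll : MonotoneOn logEll (Icc 0 (Real.exp (-3))) := by
  intro s hs t ht hst
  rcases hs.1.eq_or_lt with rfl | h0
  · have : logEll 0 = 0 := by simp [logEll]
    rw [this]
    exact logEll_nonneg ht
  · have h1 := log_lt_of_mem (h0.trans_le hst) ht.2
    have h2 := Real.log_le_log h0 hst
    exact neg_le_neg ((inv_le_inv_of_neg (by linarith) (by linarith)).2 h2)

/-- Parameters with `x_k = e^{-(k + 3)}` and `ℓ₁(x_k) = 1 / (k + 3)`. -/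
noncomputable def smoothParams : Params where
  a := Real.exp (-3)
  ell := logEll
  x k := Real.exp (-(k + 3 : ℝ))
  lam := 3
  a_pos := Real.exp_pos _
  ell_cont := continuousOn_logEll
  ell_nonneg _ := logEll_nonneg
  ell_mono := monotoneOn_logEll
  ell_concave := strictConcaveOn_logEll
  ell_zero := by simp [logEll]
  x_mem k hk := ⟨Real.exp_pos _, Real.exp_lt_exp.2 (by
    have : (1 : ℝ) ≤ k := by exact_mod_cast hk
    linarith)⟩
  x_anti k _ l _ hkl := Real.exp_lt_exp.2 (by
    have : (k : ℝ) < l := by exact_mod_cast hkl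
    linarith)
  x_exp := ⟨1, Real.exp (-1), Real.exp_pos _, by simp, fun k _ => by
    rw [one_mul, ← Real.exp_nat_mul]
    exact Real.exp_le_exp.2 (by linarith)⟩
  lam_ge := le_rfl

/-- The terms are `1 / (i + 4)`, a tail of the harmonic series. -/
lemma tendsto_sum_ell_smoothParams :
    Tendsto (fun N => ∑ i ∈ Finset.range N, smoothParams.ell (smoothParams.x (i + 1)))
      atTop atTop := by
  have h : ∀ i : ℕ, smoothParams.ell (smoothParams.x (i + 1)) = 1 / ((i + 4 : ℕ) : ℝ) := by
    intro i
    change -(Real.log (Real.exp (-((i + 1 : ℕ) + 3 : ℝ))))⁻¹ = _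
    rw [Real.log_exp, inv_neg, neg_neg, one_div]
    push_cast
    ring_nf
  simp only [h]
  refine (not_summable_iff_tendsto_nat_atTop_of_nonneg fun i => by positivity).1 fun hs => ?_
  exact Real.not_summable_one_div_natCast ((summable_nat_add_iff 4).1 hs)

end LocEnt

open LocEnt Filter Topology in
theorem theoremD :
    (∀ D : Params, ∃ Φ : C(FourShift, EuclideanSpace ℝ (Fin 2)),
      (∀ ξ, Φ ξ = D.potential ξ) ∧
      0 ∈ (rotationSet shift Φ).exposedPoints ℝ ∧
      0 ∈ frontier (rotationSet shift Φ) ∧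
      localizedEntropy shift Φ 0 = ((Real.log 2 : ℝ) : EReal) ∧
      ¬ ContinuousWithinAt
          (fun p : C(FourShift, EuclideanSpace ℝ (Fin 2)) × EuclideanSpace ℝ (Fin 2) =>
            localizedEntropy shift p.1 p.2)
          {p | p.2 ∈ rotationSet shift p.1} (Φ, 0) ∧
      (∃ K : ℕ → ℕ, D.IsCutoff K) ∧
      ∀ K : ℕ → ℕ, D.IsCutoff K →
        ∃ Ψ : ℕ → C(FourShift, EuclideanSpace ℝ (Fin 2)),
          (∀ n ξ, Ψ n ξ = D.approx (K n) ξ) ∧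
          (∀ n, IsLocallyConstant (Ψ n)) ∧
          (∀ n ξ η, (∀ j < K n, ξ j = η j) → Ψ n ξ = Ψ n η) ∧
          (∀ n, ‖Ψ n - Φ‖ < (1 / 2 : ℝ) ^ n) ∧
          Tendsto (fun n => minLocalEntropy shift (Ψ n) 0 ((1 / 2 : ℝ) ^ n)) atTop (𝓝 0) ∧
          Tendsto (fun n => maxLocalEntropy shift (Ψ n) 0 ((1 / 2 : ℝ) ^ n)) atTop
            (𝓝 ((Real.log 2 : ℝ) : EReal))) ∧
    (∃ D : Params,
      BoundaryIsInfinitePolygon (rotationSet shift D.potential) 0 ∧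
      IsSmoothBoundaryPoint (rotationSet shift D.potential) 0) := by
  refine ⟨fun D => ⟨D.potentialMap, fun ξ => rfl, D.zero_mem_exposedPoints, D.zero_mem_frontier,
    D.localizedEntropy_zero, D.not_continuousWithinAt_localizedEntropy, D.exists_isCutoff,
    fun K hK => ⟨Params.approxMap hK, fun n ξ => rfl,
      fun n => D.isLocallyConstant_approx (hK.lam_le n),
      fun n ξ η h => D.approx_eq_of_cylinder (hK.lam_le n) h,
      Params.norm_approxMap_sub_lt hK, ?_, Params.tendsto_maxLocalEntropy hK⟩⟩, ?_⟩
  · exact tendsto_const_nhds.congr fun n =>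
      (Params.minLocalEntropy_approx (hK.lam_le n) (hK.norm_lt n).le).symm
  · have hv := smoothParams.isConvexChain tendsto_sum_ell_smoothParams
    refine ⟨smoothParams, ?_⟩
    rw [Params.rotationSet_eq_convexHull hv]
    exact ⟨hv.boundaryIsInfinitePolygon, hv.isSmoothBoundaryPoint⟩
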